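/- Let $R$ be a reduced irreducible (crystallographic) root system in a real vector space $\mathfrak h^*$, with coroots $\alpha^\vee$, a choice of positive roots $R^+$, Weyl group $W$, weight lattice $P=\{\lambda\in\mathfrak h^* : \langle\lambda,\alpha^\vee\rangle\in\mathbb Z \text{ for all }\alpha\in R\}$, dominant weights $P^+=\{\lambda\in P:\langle\lambda,\alpha^\vee\rangle\ge 0\text{ for all }\alpha\in R^+\}$ and $\rho=\frac12\sum_{\alpha\in R^+}\alpha$. Let $\tilde W=\{t_\lambda w : \lambda\in P, w\in W\}$ be the extended affine Weyl group acting on $\mathfrak h^*$, where $t_\lambda$ is translation by $\lambda$. Let $A=\{x : 0<\langle x,\alpha^\vee\rangle<1\text{ for all }\alpha\in R^+\}$ be the fundamental alcove, and let $\ell(w)$, $w\in\tilde W$, be the number of hyperplanes $H_{\alpha,k}=\{x:\langle x,\alpha^\vee\rangle=k\}$ ($\alpha\in R^+$, $k\in\mathbb Z$) that separate $A$ from $w^{-1}A$. The simple reflections are the reflections in the walls of $A$. Let $\mathbb F$ be the field of fractions of $\mathbb Z[q,q^{-1}]$. The affine Hecke algebra $\tilde H$ (over $\mathbb F$) is generated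 by $T_w$, $w\in\tilde W$, with relations $T_1=1$, $T_uT_v=T_{uv}$ if $\ell(uv)=\ell(u)+\ell(v)$, and $T_sT_w=(q-q^{-1})T_w+T_{sw}$ if $s$ is a simple reflection and $\ell(sw)<\ell(w)$. For $\lambda\in P$ let $x^\lambda=T_{t_\mu}T_{t_\nu}^{-1}\in\tilde H$, where $\lambda=\mu-\nu$ with $\mu,\nu\in P^+$; elements $\sum_\lambda c_\lambda x^\lambda$ of the group algebra $\mathbb F[P]$ are regarded as elements of $\tilde H$ in this way. The group $W$ acts on $\mathbb F[P]$ and on its field of fractions by $wx^\lambda=x^{w\lambda}$. For $\mu\in P$ put $$W_\mu=\{w\in W: w\mu=\mu\},\qquad W_\mu(t)=\sum_{w\in W_\mu}t^{\ell(w)},\qquad {\bf 1}_0=\frac1{W_0(q^2)}\sum_{w\in W}q^{\ell(w)}T_w,$$ $$P_\mu(x;t)=\frac1{W_\mu(t)}\sum_{w\in W}w\Big(x^\mu\prod_{\alpha\in R^+}\frac{1-tx^{-\alpha}}{1-x^{-\alpha}}\Big),\qquad a_\mu=\sum_{w\in W}(-1)^{\ell(w)}x^{w\mu},\qquad s_\mu=\frac{a_{\mu+\rho}}{a_\rho}.$$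 The bar involution is the ring automorphism of $\tilde H$ with $\overline q=q^{-1}$ and $\overline{T_w}=(T_{w^{-1}})^{-1}$ for $w\in\tilde W$. For $w\in\tilde W$ the Kazhdan–Lusztig basis element $C'_w$ is the unique element of $\tilde H$ with $\overline{C'_w}=C'_w$ and $C'_w=T_w+\sum_{y<w}p_{yw}T_y$ with $p_{yw}\in q^{-1}\mathbb Z[q^{-1}]$, where $\le$ is the Bruhat order: $v\le w$ if there are $g\in\tilde W$ with $\ell(g)=0$ and a reduced word $w=s_{1}\cdots s_{p}g$ ($s_i$ simple reflections, $p=\ell(w)$) such that $v$ has a reduced word $s_{i_1}\cdots s_{i_k}g$ ($k=\ell(v)$) with $i_1<\dots<i_k$. Then: (a) For every $\mu\in P$, $P_\mu(x;q^{-2})$ lies in $\mathbb F[P]$ and, in $\tilde H$, $$\frac{W_\mu(q^{-2})}{W_0(q^{-2})}\,P_\mu(x;q^{-2})\,{\bf 1}_0=M_\mu,\qquad\text{where } M_\mu={\bf 1}_0x^\mu{\bf 1}_0 .$$ (b) Let $w_0$ be the longest element of $W$. For every $\lambda\in P^+$ the Weyl character $s_\lambda$ lies in $\mathbb F[P]$,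 the double coset $Wt_\lambda W$ has a unique element $n_\lambda$ of maximal length, there is exactly one element $C'_{n_\lambda}$ of $\tilde H$ with the properties above, and $$q^{-\ell(w_0)}\,W_0(q^2)\,s_\lambda\,{\bf 1}_0=C'_{n_\lambda}.$$ -/

import Mathlib

open scoped LaurentPolynomial

noncomputable section

namespace AffineHecke

section Coefficients

/-- The field of fractions of `ℤ[q, q⁻¹]`. -/
abbrev Coeff : Type := FractionRing ℤ[T;T⁻¹]

/-- The indeterminate `q`. -/
def q : Coeff := algebraMap ℤ[T;T⁻¹] Coeff (LaurentPolynomial.T 1)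

/-- The automorphism of the coefficient field with `q ↦ q⁻¹`. -/
def coeffBar : Coeff ≃+* Coeff :=
  IsFractionRing.ringEquivOfRingEquiv
    (LaurentPolynomial.invert : ℤ[T;T⁻¹] ≃ₐ[ℤ] ℤ[T;T⁻¹]).toRingEquiv

/-- The subset `q⁻¹ ℤ[q⁻¹]` of the coefficient field. -/
def negativePart : Set Coeff :=
  {c | ∃ p : Polynomial ℤ, c = q⁻¹ * Polynomial.aeval q⁻¹ p}

end Coefficients

section Lattice

variable {ι V N : Type*} [AddCommGroup V] [Module ℝ V] [AddCommGroup N] [Module ℝ N]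

/-- The weight lattice `{v | ⟨v, α^∨⟩ ∈ ℤ for all roots α}`. -/
def weightLattice (R : RootPairing ι ℝ V N) : AddSubgroup V where
  carrier := {v | ∀ i, ∃ n : ℤ, R.coroot' i v = n}
  zero_mem' := fun _ => ⟨0, by simp⟩
  add_mem' := by
    intro v w hv hw i
    obtain ⟨m, hm⟩ := hv i
    obtain ⟨n, hn⟩ := hw i
    exact ⟨m + n, by rw [map_add, hm, hn]; push_cast; ring⟩
  neg_mem' := by
    intro v hv i
    obtain ⟨m, hm⟩ := hv i
    exact ⟨-m, by rw [map_neg, hm]; push_cast; ring⟩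

lemma root_mem_weightLattice (R : RootPairing ι ℝ V N) [R.IsCrystallographic] (i : ι) :
    R.root i ∈ weightLattice R := by
  intro j
  refine ⟨R.pairingIn ℤ i j, ?_⟩
  rw [R.root_coroot'_eq_pairing]
  exact (R.algebraMap_pairingIn ℤ i j).symm

lemma weyl_smul_mem (R : RootPairing ι ℝ V N) [R.IsCrystallographic]
    (w : R.weylGroup) {v : V} (hv : v ∈ weightLattice R) : w • v ∈ weightLattice R := by
  obtain ⟨g, hg⟩ := w
  change g • v ∈ weightLattice R
  induction hg using RootPairing.weylGroup.induction generalizing v with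
  | mem i =>
    rw [RootPairing.Equiv.reflection_smul, RootPairing.reflection_apply]
    obtain ⟨n, hn⟩ := hv i
    rw [hn, Int.cast_smul_eq_zsmul]
    exact sub_mem hv (zsmul_mem (root_mem_weightLattice R i) n)
  | one => simpa using hv
  | mul x y hx hy hx' hy' =>
    rw [mul_smul]
    exact hx' (hy' hv)

instance weylActionLattice (R : RootPairing ι ℝ V N) [R.IsCrystallographic] :
    DistribMulAction R.weylGroup (weightLattice R) where
  smul w v := ⟨w • (v : V), weyl_smul_mem R w v.2⟩
  one_smul v := Subtype.ext (one_smul R.weylGroup (v : V))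
  mul_smul x y v := Subtype.ext (mul_smul x y (v : V))
  smul_zero w := Subtype.ext (smul_zero (A := V) w)
  smul_add w x y := Subtype.ext (smul_add w (x : V) (y : V))

/-- A root as an element of the weight lattice. -/
def rootWeight (R : RootPairing ι ℝ V N) [R.IsCrystallographic] (i : ι) : weightLattice R :=
  ⟨R.root i, root_mem_weightLattice R i⟩

instance weylGroupFinite [Finite ι] (R : RootPairing ι ℝ V N) [R.IsRootSystem] :
    Finite R.weylGroup := by
  refine Finite.of_injective (R.weylGroupToPerm : R.weylGroup → Equiv.Perm ι) ?_
  intro g h hgh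
  apply Subtype.ext
  apply RootPairing.Equiv.weightHom_injective R
  apply LinearEquiv.toLinearMap_injective
  apply LinearMap.ext_on_range (v := R.root) (RootPairing.IsRootSystem.span_root_eq_top)
  intro i
  have h1 := R.weylGroup_apply_root g i
  have h2 := R.weylGroup_apply_root h i
  rw [hgh, ← h2] at h1
  exact h1

instance weylGroupFintype [Finite ι] (R : RootPairing ι ℝ V N) [R.IsRootSystem] :
    Fintype R.weylGroup := Fintype.ofFinite _

instance weightLatticeUniqueSums (R : RootPairing ι ℝ V N) :
    TwoUniqueSums (weightLattice R) := by
  let _ : Module ℚ V := Module.compHom V (algebraMap ℚ ℝ)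
  exact TwoUniqueSums.of_injective_addHom (weightLattice R).subtype.toAddHom
    Subtype.val_injective inferInstance

/-- The action of the Weyl group on the weight lattice, as a homomorphism to automorphisms. -/
def latticeAut (R : RootPairing ι ℝ V N) [R.IsCrystallographic] :
    R.weylGroup →* MulAut (Multiplicative (weightLattice R)) where
  toFun w := AddEquiv.toMultiplicative (DistribMulAction.toAddEquiv (weightLattice R) w)
  map_one' := MulEquiv.ext fun v => one_smul R.weylGroup (Multiplicative.toAdd v)
  map_mul' x y := MulEquiv.ext fun v => mul_smul x y (Multiplicative.toAdd v)

/-- The extended affine Weyl group, in which the pair `(λ, w)` is the transformation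
`t_λ w : x ↦ λ + w x`. -/
abbrev ExtWeyl (R : RootPairing ι ℝ V N) [R.IsCrystallographic] : Type _ :=
  Multiplicative (weightLattice R) ⋊[latticeAut R] R.weylGroup

/-- The translation `t_λ`. -/
def translation {R : RootPairing ι ℝ V N} [R.IsCrystallographic] (lam : weightLattice R) :
    ExtWeyl R :=
  SemidirectProduct.inl (Multiplicative.ofAdd lam)

/-- The inclusion of the finite Weyl group in the extended affine Weyl group. -/
def ofWeyl {R : RootPairing ι ℝ V N} [R.IsCrystallographic] (w : R.weylGroup) : ExtWeyl R :=
  SemidirectProduct.inr w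

/-- The action of the extended affine Weyl group on the ambient space. -/
def affAct {R : RootPairing ι ℝ V N} [R.IsCrystallographic] (g : ExtWeyl R) (x : V) : V :=
  (Multiplicative.toAdd g.left : weightLattice R) + g.right • x

/-- The reflection `t_{kα} s_α` in the hyperplane `⟨x, α^∨⟩ = k`. -/
def affReflection (R : RootPairing ι ℝ V N) [R.IsCrystallographic] (i : ι) (k : ℤ) :
    ExtWeyl R :=
  translation (k • rootWeight R i) * ofWeyl (RootPairing.weylGroup.ofIdx R i)

end Lattice

section Length

variable {ι V N : Type*} [AddCommGroup V] [Module ℝ V] [AddCommGroup N] [Module ℝ N]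
  {R : RootPairing ι ℝ V N}

/-- The fundamental alcove. -/
def alcove (b : R.Base) : Set V :=
  {x | ∀ i, b.IsPos i → 0 < R.coroot' i x ∧ R.coroot' i x < 1}

/-- A weight is dominant if it pairs non-negatively with all positive coroots. -/
def IsDominant (b : R.Base) (lam : weightLattice R) : Prop :=
  ∀ i, b.IsPos i → 0 ≤ R.coroot' i (lam : V)

variable [R.IsCrystallographic]

/-- The inversion set of `g`: the hyperplanes `⟨x, α^∨⟩ = k`, with `α` a positive root and
`k` an integer, that lie between the fundamental alcove `A` and `g⁻¹ A`. -/
def inversions (b : R.Base) (g : ExtWeyl R) : Set (ι × ℤ) :=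
  {p | b.IsPos p.1 ∧ ∀ x ∈ alcove b, ∀ y ∈ alcove b,
    (R.coroot' p.1 x - p.2) * (R.coroot' p.1 (affAct g⁻¹ y) - p.2) < 0}

/-- The length function of the extended affine Weyl group. -/
def length (b : R.Base) (g : ExtWeyl R) : ℕ := (inversions b g).ncard

/-- The reflections `s_0, s_1, …, s_n` in the walls of the fundamental alcove: the affine
reflections of length one. -/
def IsSimpleReflection (b : R.Base) (s : ExtWeyl R) : Prop :=
  (∃ i k, s = affReflection R i k) ∧ length b s = 1

/-- `g` has length zero and `w = s_1 ⋯ s_p g` with `s_1, …, s_p` simple reflections and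
`p = ℓ(w)`, where `l` is the list `s_1, …, s_p`. -/
def IsReducedWord (b : R.Base) (w : ExtWeyl R) (l : List (ExtWeyl R)) (g : ExtWeyl R) : Prop :=
  (∀ s ∈ l, IsSimpleReflection b s) ∧ length b g = 0 ∧ w = l.prod * g ∧ l.length = length b w

/-- The Bruhat order: some reduced word of `v` is a subword of some reduced word of `w`
(with the same factor of length zero). -/
def BruhatLE (b : R.Base) (v w : ExtWeyl R) : Prop :=
  ∃ (l m : List (ExtWeyl R)) (g : ExtWeyl R),
    IsReducedWord b v l g ∧ IsReducedWord b w m g ∧ l.Sublist m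

/-- `n` is the longest element of the set `D`. -/
def IsLongest (b : R.Base) (D : Set (ExtWeyl R)) (n : ExtWeyl R) : Prop :=
  n ∈ D ∧ ∀ y ∈ D, y ≠ n → length b y < length b n

/-- The double coset `W g W`. -/
def weylDoubleCoset (g : ExtWeyl R) : Set (ExtWeyl R) :=
  {y | ∃ u v : R.weylGroup, y = ofWeyl u * g * ofWeyl v}

end Length

section Rho

variable {ι V N : Type*} [AddCommGroup V] [Module ℝ V] [AddCommGroup N] [Module ℝ N]
  {R : RootPairing ι ℝ V N} [Fintype ι]

/-- The finite set of (indices of) positive roots. -/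
def posRoots (b : R.Base) : Finset ι := by
  classical exact Finset.univ.filter fun i => b.IsPos i

lemma mem_posRoots (b : R.Base) (i : ι) : i ∈ posRoots b ↔ b.IsPos i := by
  simp [posRoots]

/-- Half the sum of the positive roots. -/
def rhoVec (b : R.Base) : V := (2⁻¹ : ℝ) • ∑ i ∈ posRoots b, R.root i

variable [R.IsCrystallographic] [R.IsReduced]

lemma coroot_rhoVec_of_simple (b : R.Base) {j : ι} (hj : j ∈ b.support) :
    R.coroot' j (rhoVec b) = 1 := by
  classical
  have hjp : j ∈ posRoots b := (mem_posRoots b j).2 (b.isPos_of_mem_support hj)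
  set D := (posRoots b).erase j with hD
  have hperm : ∑ i ∈ D, R.root (R.reflectionPerm j i) = ∑ i ∈ D, R.root i := by
    have hmap : ∀ i ∈ D, R.reflectionPerm j i ∈ D := by
      intro i hi
      rw [hD, Finset.mem_erase, mem_posRoots] at hi
      rw [hD, Finset.mem_erase, mem_posRoots]
      refine ⟨?_, hi.2.reflectionPerm hj hi.1⟩
      intro h
      have h2 : i = R.reflectionPerm j j := by
        have h' := congrArg (R.reflectionPerm j) h
        rwa [R.reflectionPerm_self] at h'
      have h3 := (RootPairing.Base.IsPos.neg_iff_not (b := b) j).1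
        (by rw [h2] at hi; exact hi.2)
      exact h3 (b.isPos_of_mem_support hj)
    refine Finset.sum_bij (fun i _ => R.reflectionPerm j i) hmap ?_ ?_ (fun _ _ => rfl)
    · intro x _ y _ hxy
      exact (R.reflectionPerm j).injective hxy
    · intro y hy
      exact ⟨R.reflectionPerm j y, hmap y hy, by simp⟩
  have hsum : R.coroot' j (∑ i ∈ D, R.root i) = 0 := by
    have h1 : R.reflection j (∑ i ∈ D, R.root i) = ∑ i ∈ D, R.root i := by
      rw [map_sum, ← hperm]
      conv_rhs => rw [hperm]
      rw [← hperm]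
      exact Finset.sum_congr rfl fun i _ => (R.root_reflectionPerm j i).symm
    rw [RootPairing.reflection_apply, sub_eq_self] at h1
    exact (smul_eq_zero.1 h1).resolve_right (R.ne_zero j)
  rw [rhoVec, ← Finset.add_sum_erase _ _ hjp, ← hD, map_smul, map_add, hsum,
    R.root_coroot'_eq_pairing, R.pairing_same]
  norm_num

lemma rhoVec_mem (b : R.Base) : rhoVec b ∈ weightLattice R := by
  intro i
  have key : ∀ y ∈ AddSubmonoid.closure (R.coroot '' b.support),
      ∃ n : ℤ, R.toLinearMap (rhoVec b) y = n := by
    intro y hy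
    induction hy using AddSubmonoid.closure_induction with
    | mem x hx =>
      obtain ⟨j, hj, rfl⟩ := hx
      exact ⟨1, by simpa using coroot_rhoVec_of_simple b hj⟩
    | zero => exact ⟨0, by simp⟩
    | add x y _ _ hx hy =>
      obtain ⟨m, hm⟩ := hx
      obtain ⟨n, hn⟩ := hy
      exact ⟨m + n, by rw [map_add, hm, hn]; push_cast; ring⟩
  rcases b.coroot_mem_or_neg_mem i with h | h
  · exact key _ h
  · obtain ⟨n, hn⟩ := key _ h
    refine ⟨-n, ?_⟩
    rw [map_neg] at hn
    change R.toLinearMap (rhoVec b) (R.coroot i) = _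
    push_cast
    linarith

/-- The weight `ρ`. -/
def rho (b : R.Base) : weightLattice R := ⟨rhoVec b, rhoVec_mem b⟩

lemma coroot_rhoVec_pos (b : R.Base) {i : ι} (hi : b.IsPos i) :
    0 < R.coroot' i (rhoVec b) := by
  have hself : ∀ j, 0 < R.RootForm (R.root j) (R.root j) := by
    intro j
    rw [R.rootForm_apply_apply]
    refine Finset.sum_pos' (fun k _ => mul_self_nonneg _) ⟨j, Finset.mem_univ j, ?_⟩
    have h2 : R.coroot' j (R.root j) = 2 := by
      rw [R.root_coroot'_eq_pairing, R.pairing_same]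
    rw [h2]
    norm_num
  have hrel : ∀ j, R.RootForm (R.root j) (R.root j) * R.coroot' j (rhoVec b)
      = 2 * R.RootForm (rhoVec b) (R.root j) := by
    intro j
    have h1 := congrArg (R.toLinearMap (rhoVec b)) (R.rootForm_self_smul_coroot j)
    rw [map_smul, map_nsmul, R.toLinearMap_apply_apply_Polarization, smul_eq_mul, nsmul_eq_mul] at h1
    have h2 : R.RootForm (rhoVec b) (R.root j) = R.RootForm (R.root j) (rhoVec b) := by
      simpa using R.rootForm_symmetric.eq (rhoVec b) (R.root j)
    rw [h2]
    exact_mod_cast h1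
  have hpos : 0 < R.RootForm (rhoVec b) (R.root i) := by
    have hs : ∀ j ∈ b.support, 0 < R.RootForm (rhoVec b) (R.root j) := by
      intro j hj
      have h1 := hrel j
      rw [coroot_rhoVec_of_simple b hj] at h1
      have h2 := hself j
      linarith
    refine hi.induction_on_add (p := fun k => 0 < R.RootForm (rhoVec b) (R.root k)) hs ?_
    intro k j l hl hk hj
    rw [hl, map_add]
    exact add_pos hk (hs j hj)
  have h1 := hrel i
  have h2 := hself i
  by_contra h
  push Not at h
  nlinarith [mul_nonneg h2.le (neg_nonneg.2 h)]

/-- Every weight is a difference of two dominant weights. -/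
lemma exists_dominant_sub (b : R.Base) (lam : weightLattice R) :
    ∃ p : weightLattice R × weightLattice R,
      IsDominant b p.1 ∧ IsDominant b p.2 ∧ lam = p.1 - p.2 := by
  choose n hn using lam.2
  choose m hm using (rho b).2
  have hm1 : ∀ i, b.IsPos i → 1 ≤ m i := by
    intro i hi
    have h := coroot_rhoVec_pos b hi
    have h' := hm i
    rw [show ((rho b : weightLattice R) : V) = rhoVec b from rfl] at h'
    rw [h'] at h
    exact_mod_cast h
  set k : ℕ := ∑ i, (n i).natAbs with hk
  have hbound : ∀ i, (n i).natAbs ≤ k := fun i =>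
    Finset.single_le_sum (f := fun i => (n i).natAbs) (fun _ _ => Nat.zero_le _)
      (Finset.mem_univ i)
  refine ⟨(lam + k • rho b, k • rho b), ?_, ?_, by simp⟩
  · intro i hi
    have e : R.coroot' i ((lam + k • rho b : weightLattice R) : V) = ((n i + k * m i : ℤ) : ℝ) := by
      push_cast
      rw [map_add, map_nsmul, hn, hm, nsmul_eq_mul]
    change 0 ≤ R.coroot' i ((lam + k • rho b : weightLattice R) : V)
    rw [e]
    have h1 := hm1 i hi
    have h2 := hbound i
    have h3 : -(k : ℤ) ≤ n i := by omega
    have h4 : (0 : ℤ) ≤ n i + k * m i := by nlinarith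
    exact_mod_cast h4
  · intro i hi
    change 0 ≤ R.coroot' i ((k • rho b : weightLattice R) : V)
    push_cast
    rw [map_nsmul]
    exact nsmul_nonneg (coroot_rhoVec_pos b hi).le k

end Rho

section GroupAlgebra

variable {ι V N : Type*} [AddCommGroup V] [Module ℝ V] [AddCommGroup N] [Module ℝ N]

/-- The group algebra of the weight lattice. -/
abbrev LatticeAlg (R : RootPairing ι ℝ V N) : Type _ := AddMonoidAlgebra Coeff (weightLattice R)

/-- The field of fractions of the group algebra of the weight lattice. -/
abbrev LatticeFrac (R : RootPairing ι ℝ V N) : Type _ := FractionRing (LatticeAlg R)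

variable {R : RootPairing ι ℝ V N}

/-- The monomial `x^λ` in the group algebra of the weight lattice. -/
def mono (lam : weightLattice R) : LatticeAlg R := AddMonoidAlgebra.single lam 1

/-- The monomial `x^λ` in the field of fractions of the group algebra. -/
def fmono (lam : weightLattice R) : LatticeFrac R :=
  algebraMap (LatticeAlg R) (LatticeFrac R) (mono lam)

variable [R.IsCrystallographic]

/-- The action of the Weyl group on the group algebra, `w x^λ = x^{wλ}`. -/
def weylAct (w : R.weylGroup) : LatticeAlg R ≃ₐ[Coeff] LatticeAlg R :=
  AddMonoidAlgebra.domCongr Coeff Coeff (DistribMulAction.toAddEquiv (weightLattice R) w)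

/-- The action of the Weyl group on the field of fractions of the group algebra. -/
def weylActFrac (w : R.weylGroup) : LatticeFrac R ≃+* LatticeFrac R :=
  IsFractionRing.ringEquivOfRingEquiv (weylAct w).toRingEquiv

variable [Fintype ι] [R.IsRootSystem]

/-- `W_μ(t) = ∑ t^{ℓ(w)}`, the sum over the stabilizer of `μ` in the Weyl group. -/
def poincare (b : R.Base) (mu : weightLattice R) (t : Coeff) : Coeff := by
  classical exact
    ∑ w ∈ Finset.univ.filter (fun w : R.weylGroup => w • mu = mu), t ^ length b (ofWeyl w)

/-- The spherical function
`P_μ(x;t) = W_μ(t)⁻¹ ∑_w w (x^μ ∏_{α > 0} (1 - t x^{-α}) / (1 - x^{-α}))`. -/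
def sphericalP (b : R.Base) (mu : weightLattice R) (t : Coeff) : LatticeFrac R :=
  (poincare b mu t)⁻¹ • ∑ w : R.weylGroup, weylActFrac w
    (fmono mu * ∏ i ∈ posRoots b,
      (1 - t • fmono (-rootWeight R i)) / (1 - fmono (-rootWeight R i)))

/-- The alternating sum `a_μ = ∑_w (-1)^{ℓ(w)} w x^μ`. -/
def altSum (b : R.Base) (mu : weightLattice R) : LatticeAlg R :=
  ∑ w : R.weylGroup, (-1) ^ length b (ofWeyl w) * weylAct w (mono mu)

/-- The Weyl character `s_λ = a_{λ+ρ} / a_ρ`. -/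
def weylCharacter [R.IsReduced] (b : R.Base) (lam : weightLattice R) : LatticeFrac R :=
  algebraMap (LatticeAlg R) (LatticeFrac R) (altSum b (lam + rho b)) /
    algebraMap (LatticeAlg R) (LatticeFrac R) (altSum b (rho b))

end GroupAlgebra

section Hecke

variable {ι V N : Type*} [AddCommGroup V] [Module ℝ V] [AddCommGroup N] [Module ℝ N]
  {R : RootPairing ι ℝ V N} [R.IsCrystallographic]

/-- The defining relations of the affine Hecke algebra in the generators `T_w`. -/
inductive HeckeRel (b : R.Base) :
    FreeAlgebra Coeff (ExtWeyl R) → FreeAlgebra Coeff (ExtWeyl R) → Prop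
  | one : HeckeRel b (FreeAlgebra.ι Coeff 1) 1
  | mul (u v : ExtWeyl R) (h : length b (u * v) = length b u + length b v) :
      HeckeRel b (FreeAlgebra.ι Coeff u * FreeAlgebra.ι Coeff v) (FreeAlgebra.ι Coeff (u * v))
  | quad (s w : ExtWeyl R) (hs : IsSimpleReflection b s) (h : length b (s * w) < length b w) :
      HeckeRel b (FreeAlgebra.ι Coeff s * FreeAlgebra.ι Coeff w)
        ((q - q⁻¹) • FreeAlgebra.ι Coeff w + FreeAlgebra.ι Coeff (s * w))

/-- The affine Hecke algebra. -/
abbrev Hecke (b : R.Base) : Type _ := RingQuot (HeckeRel b)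

/-- The generator `T_w`. -/
def T (b : R.Base) (w : ExtWeyl R) : Hecke b :=
  RingQuot.mkAlgHom Coeff (HeckeRel b) (FreeAlgebra.ι Coeff w)

/-- The bar involution: the ring automorphism with `q ↦ q⁻¹` and `T_w ↦ (T_{w⁻¹})⁻¹`. -/
structure IsBarInvolution (b : R.Base) (bar : Hecke b ≃+* Hecke b) : Prop where
  map_coeff : ∀ c : Coeff,
    bar (algebraMap Coeff (Hecke b) c) = algebraMap Coeff (Hecke b) (coeffBar c)
  map_T_mul : ∀ w : ExtWeyl R, bar (T b w) * T b w⁻¹ = 1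
  mul_map_T : ∀ w : ExtWeyl R, T b w⁻¹ * bar (T b w) = 1

/-- `C` is the Kazhdan-Lusztig basis element `C'_w`: it is bar invariant and
`C = T_w + ∑_{y < w} p_y T_y` with `p_y ∈ q⁻¹ ℤ[q⁻¹]`. -/
def IsKazhdanLusztig (b : R.Base) (w : ExtWeyl R) (C : Hecke b) : Prop :=
  (∃ bar : Hecke b ≃+* Hecke b, IsBarInvolution b bar ∧ bar C = C) ∧
  ∃ p : ExtWeyl R →₀ Coeff,
    C = p.sum (fun y c => c • T b y) ∧ p w = 1 ∧
    ∀ y, p y ≠ 0 → y ≠ w → BruhatLE b y w ∧ p y ∈ negativePart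

variable [Fintype ι]

/-- The element `x^λ = T_{t_μ} (T_{t_ν})⁻¹` of the affine Hecke algebra, where `λ = μ - ν` with
`μ` and `ν` dominant. -/
def heckeX [R.IsReduced] (b : R.Base) (lam : weightLattice R) : Hecke b :=
  T b (translation (exists_dominant_sub b lam).choose.1) *
    Ring.inverse (T b (translation (exists_dominant_sub b lam).choose.2))

/-- The map from the group algebra of the weight lattice to the affine Hecke algebra,
`∑ c_λ x^λ ↦ ∑ c_λ x^λ`. -/
def latticeToHecke [R.IsReduced] (b : R.Base) (f : LatticeAlg R) : Hecke b :=
  f.coeff.sum fun lam c => c • heckeX b lam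

variable [R.IsRootSystem]

/-- The idempotent `1_0 = W_0(q²)⁻¹ ∑_{w ∈ W} q^{ℓ(w)} T_w`. -/
def one₀ (b : R.Base) : Hecke b :=
  (poincare b 0 (q ^ 2))⁻¹ • ∑ w : R.weylGroup, q ^ length b (ofWeyl w) • T b (ofWeyl w)

/-- `M_μ = 1_0 x^μ 1_0`. -/
def heckeM [R.IsReduced] (b : R.Base) (mu : weightLattice R) : Hecke b :=
  one₀ b * heckeX b mu * one₀ b

end Hecke

end AffineHecke

end

set_option linter.unusedSectionVars false

noncomputable section

namespace AffineHecke

/-! ### Affine roots and the action of the extended affine Weyl group on them. -/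

section AffineRoots

variable {ι V N : Type*} [AddCommGroup V] [Module ℝ V] [AddCommGroup N] [Module ℝ N]
  {R : RootPairing ι ℝ V N}

/-! Affine roots, the functions x ↦ ⟨x, α^∨⟩ − k, control lengths: ℓ(g) counts those that are
positive on the alcove and made negative by g. This yields descent and exchange (`lengthSystem`),
then the basis T_w through a regular representation (`exists_coord`), the bar involution, and the
elements C'_w. Uniqueness of C'_w rests on the fact that 0 is the only bar invariant element of
q⁻¹ℤ[q⁻¹].

Write E = `sphSum` and let N = ℓ(w₀) be the number of positive roots. For (a), the Bernstein
relation and T_s E = qE make T_{s_i} act on the elements fE, with f in the group algebra, by a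
Demazure–Lusztig operator (q − c_i) + c_i s_i (`exists_simple_operator`). The map f ↦ fE is
injective, so E acts by a well-defined operator ∑ H_v v with rational coefficients. From T_s E = qE
one gets H_{sv} = s(H_v), so everything is determined by H_{w₀}; only T_{w₀} contributes to it, with
the product of all c_α. The outcome is Macdonald's formula E f E = q^{2N} ∑_w w(f ∏_{α>0} (1 −
q⁻²x^{−α})/(1 − x^{−α})) E (`exists_symmetrization`), and f = x^μ gives (a).

For (b), expand the numerator of this product over sets of positive roots. Each summand symmetrizes
to a Weyl quotient `charFrac`, which straightens to zero or to plus or minus one with dominant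
index. Hence the symmetrization of x^μ is (1 + c)χ_μ plus lower χ_ν, where c and the lower
coefficients lie in q⁻¹ℤ[q⁻¹] (`exists_triangular`). By induction χ_μ lies in the group algebra; the
case μ = 0 yields the Weyl denominator formula (`altSum_rho`), so that χ_μ = s_μ.

A degree count gives E x^μ E = q^{3N} T_n plus terms of lower degree, with n = w₀t_μ. Together with
triangularity this shows that q^{−N}χ_μE is T_n up to coefficients in q⁻¹ℤ[q⁻¹]
(`charElt_sub_T_mem`). That element is also bar invariant (`IsBarInvolution.map_charElt`): bar sends
x^λ to T_{w₀} x^{w₀λ} T_{w₀}⁻¹, and W-invariant f commute with the T_{s_i}. These two properties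
characterize C'_n. -/

lemma coroot'_weyl_smul (w : R.weylGroup) (i : ι) (x : V) :
    R.coroot' (R.weylGroupToPerm w i) (w • x) = R.coroot' i x := by
  obtain ⟨g, hg⟩ := w
  have h1 := RootPairing.Hom.coroot_coweightMap_apply R R (g.indexEquiv i) g.toHom
  have h2 := RootPairing.Hom.weight_coweight_transpose_apply R R (R.coroot (g.indexEquiv i)) g.toHom
  rw [h1] at h2
  have h3 := LinearMap.congr_fun h2 x
  simp only [Equiv.symm_apply_apply] at h3
  exact h3

/-- The affine function `x ↦ ⟨x, α^∨⟩ - k`. -/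
def affEval (R : RootPairing ι ℝ V N) (p : ι × ℤ) (x : V) : ℝ := R.coroot' p.1 x - p.2

lemma coroot'_injective (R : RootPairing ι ℝ V N) : Function.Injective R.coroot' := by
  intro i j h
  apply R.coroot.injective
  apply R.flip.toPerfPair.injective
  exact h

/-- The value at 0 recovers k, and the rest recovers the coroot. Identities between affine roots can
therefore be proved by evaluating at points, as is done throughout. -/
lemma affEval_injective (R : RootPairing ι ℝ V N) : Function.Injective (affEval R) := by
  intro p p' h
  have h0 := congrFun h 0
  simp only [affEval, map_zero, zero_sub, neg_inj, Int.cast_inj] at h0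
  refine Prod.ext (coroot'_injective R (LinearMap.ext fun x => ?_)) h0
  have := congrFun h x
  simp only [affEval, h0] at this
  linarith

/-- The integer `⟨λ, α^∨⟩`. -/
def zpair (lam : weightLattice R) (i : ι) : ℤ := ⌊R.coroot' i (lam : V)⌋

/-- The floor loses nothing, since weights pair integrally with coroots; length computations can
then take place in ℤ. -/
lemma coe_zpair (lam : weightLattice R) (i : ι) : (zpair lam i : ℝ) = R.coroot' i (lam : V) := by
  obtain ⟨n, hn⟩ := lam.2 i
  rw [zpair, hn, Int.floor_intCast]

lemma zpair_add (lam mu : weightLattice R) (i : ι) :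
    zpair (lam + mu) i = zpair lam i + zpair mu i := by
  have : ((zpair (lam + mu) i : ℤ) : ℝ) = ((zpair lam i + zpair mu i : ℤ) : ℝ) := by
    push_cast
    rw [coe_zpair, coe_zpair, coe_zpair, AddSubgroup.coe_add, map_add]
  exact_mod_cast this

lemma zpair_neg (lam : weightLattice R) (i : ι) : zpair (-lam) i = -zpair lam i := by
  have : ((zpair (-lam) i : ℤ) : ℝ) = ((-zpair lam i : ℤ) : ℝ) := by
    push_cast
    rw [coe_zpair, coe_zpair, AddSubgroup.coe_neg, map_neg]
  exact_mod_cast this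

@[simp] lemma zpair_zero (i : ι) : zpair (0 : weightLattice R) i = 0 := by
  simp [zpair]

/-- The negative of an affine root. -/
def affNeg (R : RootPairing ι ℝ V N) (p : ι × ℤ) : ι × ℤ := (R.reflectionPerm p.1 p.1, -p.2)

lemma coroot'_reflectionPerm_self (i : ι) (x : V) :
    R.coroot' (R.reflectionPerm i i) x = -R.coroot' i x := by
  change R.toLinearMap x (R.coroot (R.reflectionPerm i i)) = -R.toLinearMap x (R.coroot i)
  simp

lemma affEval_neg (p : ι × ℤ) (x : V) : affEval R (affNeg R p) x = -affEval R p x := by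
  simp only [affEval, affNeg, coroot'_reflectionPerm_self]
  push_cast
  ring

lemma affNeg_affNeg (p : ι × ℤ) : affNeg R (affNeg R p) = p := by
  apply affEval_injective R
  funext x
  rw [affEval_neg, affEval_neg, neg_neg]

variable [R.IsCrystallographic]

lemma coe_weyl_smul (w : R.weylGroup) (lam : weightLattice R) :
    ((w • lam : weightLattice R) : V) = w • (lam : V) := rfl

lemma zpair_smul (w : R.weylGroup) (lam : weightLattice R) (i : ι) :
    zpair (w • lam) (R.weylGroupToPerm w i) = zpair lam i := by
  simp only [zpair, coe_weyl_smul, coroot'_weyl_smul]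

lemma zpair_smul' (w : R.weylGroup) (lam : weightLattice R) (i : ι) :
    zpair (w • lam) i = zpair lam (R.weylGroupToPerm w⁻¹ i) := by
  have h := zpair_smul w lam (R.weylGroupToPerm w⁻¹ i)
  rwa [← Equiv.Perm.mul_apply, ← map_mul, mul_inv_cancel, map_one, Equiv.Perm.one_apply] at h

lemma affAct_one (x : V) : affAct (1 : ExtWeyl R) x = x := by
  simp [affAct]

lemma affAct_mul (g h : ExtWeyl R) (x : V) : affAct (g * h) x = affAct g (affAct h x) := by
  simp only [affAct, SemidirectProduct.mul_left, SemidirectProduct.mul_right, smul_add, mul_smul,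
    ← add_assoc]
  rfl

lemma affAct_apply_inv (g : ExtWeyl R) (x : V) : affAct g (affAct g⁻¹ x) = x := by
  rw [← affAct_mul, mul_inv_cancel, affAct_one]

/-- The action of the extended affine Weyl group on the affine roots. -/
def affRootAct (g : ExtWeyl R) (p : ι × ℤ) : ι × ℤ :=
  (R.weylGroupToPerm g.right p.1,
    p.2 + zpair (Multiplicative.toAdd g.left) (R.weylGroupToPerm g.right p.1))

lemma affEval_act (g : ExtWeyl R) (p : ι × ℤ) (x : V) :
    affEval R (affRootAct g p) (affAct g x) = affEval R p x := by
  simp only [affEval, affRootAct, affAct, map_add, Int.cast_add, coe_zpair]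
  rw [coroot'_weyl_smul]
  ring

lemma affEval_act' (g : ExtWeyl R) (p : ι × ℤ) (x : V) :
    affEval R (affRootAct g p) x = affEval R p (affAct g⁻¹ x) := by
  conv_lhs => rw [← affAct_apply_inv g x]
  rw [affEval_act]

lemma affRootAct_mul (g h : ExtWeyl R) (p : ι × ℤ) :
    affRootAct (g * h) p = affRootAct g (affRootAct h p) := by
  apply affEval_injective R
  funext x
  rw [affEval_act', affEval_act', affEval_act', mul_inv_rev, affAct_mul]

lemma affRootAct_one (p : ι × ℤ) : affRootAct (1 : ExtWeyl R) p = p := by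
  apply affEval_injective R
  funext x
  rw [affEval_act', inv_one, affAct_one]

lemma affRootAct_inv_apply (g : ExtWeyl R) (p : ι × ℤ) :
    affRootAct g⁻¹ (affRootAct g p) = p := by
  rw [← affRootAct_mul, inv_mul_cancel, affRootAct_one]

lemma affRootAct_apply_inv (g : ExtWeyl R) (p : ι × ℤ) :
    affRootAct g (affRootAct g⁻¹ p) = p := by
  rw [← affRootAct_mul, mul_inv_cancel, affRootAct_one]

lemma affRootAct_injective (g : ExtWeyl R) :
    Function.Injective (affRootAct g) :=
  Function.LeftInverse.injective (affRootAct_inv_apply g)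

lemma affRootAct_neg (g : ExtWeyl R) (p : ι × ℤ) :
    affRootAct g (affNeg R p) = affNeg R (affRootAct g p) := by
  apply affEval_injective R
  funext x
  rw [affEval_act', affEval_neg, affEval_neg, affEval_act']

lemma affAct_translation (lam : weightLattice R) (x : V) :
    affAct (translation lam) x = lam + x := by
  simp [affAct, translation]

lemma affAct_ofWeyl (w : R.weylGroup) (x : V) : affAct (ofWeyl w) x = w • x := by
  simp [affAct, ofWeyl]

lemma affAct_injective : Function.Injective (affAct : ExtWeyl R → V → V) := by
  intro g h hgh
  have h0 := congrFun hgh 0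
  simp only [affAct, smul_zero, add_zero, SetLike.coe_eq_coe] at h0
  refine SemidirectProduct.ext h0 ?_
  apply Subtype.ext
  apply RootPairing.Equiv.weightHom_injective R
  ext x
  have hx := congrFun hgh x
  simp only [affAct, h0, add_right_inj] at hx
  exact hx

lemma affAct_reflection (p : ι × ℤ) (x : V) :
    affAct (affReflection R p.1 p.2) x = x - affEval R p x • R.root p.1 := by
  rw [affReflection, affAct_mul, affAct_translation, affAct_ofWeyl,
    RootPairing.weylGroup.ofIdx_smul, RootPairing.Equiv.reflection_smul,
    RootPairing.reflection_apply, affEval, sub_smul]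
  have h2 : ((p.2 • rootWeight R p.1 : weightLattice R) : V) = (p.2 : ℝ) • R.root p.1 := by
    rw [AddSubgroup.coe_zsmul, Int.cast_smul_eq_zsmul]; rfl
  rw [h2]
  abel

lemma affEval_root (p : ι × ℤ) (x : V) (c : ℝ) :
    affEval R p (x - c • R.root p.1) = affEval R p x - 2 * c := by
  simp only [affEval, map_sub, map_smul, R.root_coroot'_eq_pairing, R.pairing_same, smul_eq_mul]
  ring

lemma affReflection_mul_self (p : ι × ℤ) :
    affReflection R p.1 p.2 * affReflection R p.1 p.2 = 1 := by
  apply affAct_injective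
  funext x
  rw [affAct_mul, affAct_reflection, affAct_reflection, affAct_one, affEval_root, sub_sub,
    ← add_smul]
  ring_nf
  simp

lemma affReflection_inv (p : ι × ℤ) :
    (affReflection R p.1 p.2)⁻¹ = affReflection R p.1 p.2 :=
  inv_eq_of_mul_eq_one_right (affReflection_mul_self p)

lemma affEval_reflection (p r : ι × ℤ) (x : V) :
    affEval R (affRootAct (affReflection R p.1 p.2) r) x
      = affEval R r x - R.pairingIn ℤ p.1 r.1 * affEval R p x := by
  rw [affEval_act', affReflection_inv, affAct_reflection]
  have := R.algebraMap_pairingIn ℤ p.1 r.1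
  simp only [affEval, map_sub, map_smul, R.root_coroot'_eq_pairing, ← this]
  simp
  ring

lemma affRootAct_reflection_self (p : ι × ℤ) :
    affRootAct (affReflection R p.1 p.2) p = affNeg R p := by
  apply affEval_injective R
  funext x
  rw [affEval_neg, affEval_reflection, R.pairingIn_same]
  push_cast
  ring

lemma affReflection_act (g : ExtWeyl R) (p : ι × ℤ) :
    affReflection R (affRootAct g p).1 (affRootAct g p).2
      = g * affReflection R p.1 p.2 * g⁻¹ := by
  apply affAct_injective
  funext x
  rw [affAct_mul, affAct_mul, affAct_reflection, affAct_reflection, affEval_act']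
  have h : ∀ y v : V, affAct g (y - v) = affAct g y - g.right • v := by
    intro y v
    simp only [affAct, smul_sub]
    abel
  rw [h, affAct_apply_inv, smul_comm, R.weylGroup_apply_root]
  rfl

lemma affReflection_neg (p : ι × ℤ) :
    affReflection R (affNeg R p).1 (affNeg R p).2 = affReflection R p.1 p.2 := by
  apply affAct_injective
  funext x
  rw [affAct_reflection, affAct_reflection, affEval_neg]
  simp [affNeg]

end AffineRoots

/-! ### Positive affine roots and a point of the fundamental alcove. -/

section Positivity

variable {ι V N : Type*} [AddCommGroup V] [Module ℝ V] [AddCommGroup N] [Module ℝ N]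
  {R : RootPairing ι ℝ V N}

/-- An affine root is positive if it is positive on the fundamental alcove. -/
def AffPos (b : R.Base) (p : ι × ℤ) : Prop :=
  (b.IsPos p.1 ∧ p.2 ≤ 0) ∨ (¬ b.IsPos p.1 ∧ p.2 < 0)

lemma isPos_reflectionPerm_self (b : R.Base) (i : ι) :
    b.IsPos (R.reflectionPerm i i) ↔ ¬ b.IsPos i :=
  RootPairing.Base.IsPos.neg_iff_not (b := b) i

lemma affPos_neg (b : R.Base) (p : ι × ℤ) : AffPos b (affNeg R p) ↔ ¬ AffPos b p := by
  simp only [AffPos, affNeg, isPos_reflectionPerm_self]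
  by_cases h : b.IsPos p.1 <;> simp [h]

/-- On the alcove a positive coroot takes values in (0, 1) and a negative one in (−1, 0). This is
the source of the asymmetry between k ≤ 0 and k < 0 in `AffPos`. -/
lemma AffPos.affEval_pos {b : R.Base} {p : ι × ℤ} (hp : AffPos b p) {x : V}
    (hx : x ∈ alcove b) : 0 < affEval R p x := by
  rcases hp with ⟨h1, h2⟩ | ⟨h1, h2⟩
  · have := (hx _ h1).1
    have h3 : (p.2 : ℝ) ≤ 0 := by exact_mod_cast h2
    rw [affEval]; linarith
  · have := (hx _ ((isPos_reflectionPerm_self b p.1).2 h1)).2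
    rw [coroot'_reflectionPerm_self] at this
    have h3 : (p.2 : ℝ) ≤ -1 := by
      have : p.2 ≤ -1 := by omega
      exact_mod_cast this
    rw [affEval]; linarith

lemma affEval_neg_of_not_affPos {b : R.Base} {p : ι × ℤ} (hp : ¬ AffPos b p) {x : V}
    (hx : x ∈ alcove b) : affEval R p x < 0 := by
  have := ((affPos_neg b p).2 hp).affEval_pos hx
  rw [affEval_neg] at this
  linarith

lemma affPos_iff {b : R.Base} {x : V} (hx : x ∈ alcove b) (p : ι × ℤ) :
    AffPos b p ↔ 0 < affEval R p x := by
  refine ⟨fun h => h.affEval_pos hx, fun h => ?_⟩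
  by_contra hn
  have := affEval_neg_of_not_affPos hn hx
  linarith

lemma not_affPos_iff {b : R.Base} {x : V} (hx : x ∈ alcove b) (p : ι × ℤ) :
    ¬ AffPos b p ↔ affEval R p x < 0 := by
  refine ⟨fun h => affEval_neg_of_not_affPos h hx, fun h hp => ?_⟩
  have := hp.affEval_pos hx
  linarith

/-- A small multiple of ρ lies in the alcove. One such point suffices to test the sign of any affine
root. -/
lemma exists_mem_alcove [Fintype ι] [R.IsCrystallographic] [R.IsReduced] (b : R.Base) :
    ∃ x, x ∈ alcove b := by
  classical
  set M : ℝ := 1 + ∑ i, |R.coroot' i (rhoVec b)| with hM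
  have hle : ∀ i, |R.coroot' i (rhoVec b)| < M := fun i => by
    have := Finset.single_le_sum (f := fun i => |R.coroot' i (rhoVec b)|)
      (fun _ _ => abs_nonneg _) (Finset.mem_univ i)
    linarith
  have hM0 : 0 < M := by
    have : 0 ≤ ∑ i, |R.coroot' i (rhoVec b)| := Finset.sum_nonneg fun _ _ => abs_nonneg _
    linarith
  refine ⟨M⁻¹ • rhoVec b, fun i hi => ?_⟩
  have h1 := coroot_rhoVec_pos b hi
  rw [map_smul, smul_eq_mul]
  refine ⟨mul_pos (inv_pos.2 hM0) h1, ?_⟩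
  rw [inv_mul_lt_iff₀ hM0, mul_one]
  exact (le_abs_self _).trans_lt (hle i)

end Positivity

/-- The properties of the length function `ℓ` of a group and its set `S` of simple reflections
on which the theory of the Hecke algebra rests. -/
structure LengthSystem {G : Type*} [Group G] (ℓ : G → ℕ) (S : Set G) : Prop where
  one : ℓ 1 = 0
  inv : ∀ g, ℓ g⁻¹ = ℓ g
  sq : ∀ s ∈ S, s * s = 1
  step : ∀ s ∈ S, ∀ g, ℓ (s * g) = ℓ g + 1 ∨ ℓ (s * g) + 1 = ℓ g
  descent : ∀ g, ℓ g ≠ 0 → ∃ s ∈ S, ℓ (s * g) < ℓ g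
  -- Unless sg = gt, multiplication by t on the right does not affect whether s is a left descent.
  -- This form of the exchange condition makes sense in the presence of nontrivial elements of
  -- length zero.
  exchange : ∀ s ∈ S, ∀ t ∈ S, ∀ g, s * g ≠ g * t →
    (ℓ (s * g * t) < ℓ (g * t) ↔ ℓ (s * g) < ℓ g)
  zero_mul : ∀ o, ℓ o = 0 → ∀ g, ℓ (o * g) = ℓ g

/-! ### Length as a count of inverted positive affine roots; simple affine roots; descent and
exchange. -/

section Inversions

variable {ι V N : Type*} [AddCommGroup V] [Module ℝ V] [AddCommGroup N] [Module ℝ N]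
  {R : RootPairing ι ℝ V N} [R.IsCrystallographic]

/-- The positive affine roots that `g` makes negative. -/
def posInv (b : R.Base) (g : ExtWeyl R) : Set (ι × ℤ) :=
  {p | AffPos b p ∧ ¬ AffPos b (affRootAct g p)}

lemma posInv_finite [Finite ι] (b : R.Base) (g : ExtWeyl R) : (posInv b g).Finite := by
  classical
  have : ∀ i : ι, ((fun k : ℤ => (i, k)) '' Set.Icc
      (-zpair (Multiplicative.toAdd g.left) (R.weylGroupToPerm g.right i)) 0).Finite :=
    fun i => (Set.finite_Icc _ _).image _
  refine (Set.finite_iUnion this).subset ?_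
  rintro ⟨i, k⟩ ⟨h1, h2⟩
  refine Set.mem_iUnion.2 ⟨i, k, ?_, rfl⟩
  simp only [AffPos, affRootAct, not_or, not_and, not_le, not_lt] at h1 h2
  constructor
  · by_cases h : b.IsPos (R.weylGroupToPerm g.right i)
    · have := h2.1 h; omega
    · have := h2.2 h; omega
  · rcases h1 with h | h <;> omega

/-- No affine root changes sign on the alcove, so separation can be read off at a single point. -/
lemma mem_inversions_iff [Fintype ι] [R.IsReduced] (b : R.Base) (g : ExtWeyl R) (p : ι × ℤ) :
    p ∈ inversions b g ↔ b.IsPos p.1 ∧ (AffPos b p ↔ ¬ AffPos b (affRootAct g p)) := by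
  obtain ⟨x₀, hx₀⟩ := exists_mem_alcove b
  have key : ∀ x y, (R.coroot' p.1 x - p.2) * (R.coroot' p.1 (affAct g⁻¹ y) - p.2)
      = affEval R p x * affEval R (affRootAct g p) y := by
    intro x y
    rw [affEval_act']
    rfl
  simp only [inversions, Set.mem_ofPred_eq, key, and_congr_right_iff]
  intro hp
  constructor
  · intro h
    have h0 := h x₀ hx₀ x₀ hx₀
    rw [affPos_iff hx₀, affPos_iff hx₀]
    constructor
    · intro h1 h2
      nlinarith
    · intro h2
      by_contra h1
      push Not at h1 h2
      nlinarith
  · intro h x hx y hy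
    by_cases h1 : AffPos b p
    · exact mul_neg_of_pos_of_neg (h1.affEval_pos hx) (affEval_neg_of_not_affPos (h.1 h1) hy)
    · have h2 : AffPos b (affRootAct g p) := by
        by_contra h2
        exact h1 (h.2 h2)
      exact mul_neg_of_neg_of_pos (affEval_neg_of_not_affPos h1 hx) (h2.affEval_pos hy)

/-- Each hyperplane carries two opposite affine roots, exactly one of them positive; choosing that
one gives the bijection. -/
lemma length_eq_ncard [Fintype ι] [R.IsReduced] (b : R.Base) (g : ExtWeyl R) :
    length b g = (posInv b g).ncard := by
  classical
  refine Set.ncard_congr (fun p _ => if AffPos b p then p else affNeg R p) ?_ ?_ ?_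
  · intro p hp
    rw [mem_inversions_iff] at hp
    by_cases h : AffPos b p
    · simp only [h, if_true]
      exact ⟨h, hp.2.1 h⟩
    · simp only [h, if_false]
      refine ⟨(affPos_neg b p).2 h, ?_⟩
      rw [affRootAct_neg, affPos_neg, not_not]
      by_contra h2
      exact h (hp.2.2 h2)
  · intro p r hp hr h
    have hp1 := ((mem_inversions_iff b g p).1 hp).1
    have hr1 := ((mem_inversions_iff b g r).1 hr).1
    have hne : ∀ p r : ι × ℤ, b.IsPos p.1 → b.IsPos r.1 → p ≠ affNeg R r := by
      rintro p r hp hr rfl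
      exact (isPos_reflectionPerm_self b r.1).1 hp hr
    split_ifs at h with h1 h2 h2
    · exact h
    · exact absurd h (hne p r hp1 hr1)
    · exact absurd h.symm (hne r p hr1 hp1)
    · rw [← affNeg_affNeg (R := R) p, h, affNeg_affNeg]
  · intro p hp
    by_cases h : b.IsPos p.1
    · refine ⟨p, (mem_inversions_iff b g p).2 ⟨h, iff_of_true hp.1 hp.2⟩, ?_⟩
      simp [hp.1]
    · have h1 : ¬ AffPos b (affNeg R p) := by
        rw [affPos_neg, not_not]; exact hp.1
      refine ⟨affNeg R p, (mem_inversions_iff b g _).2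
        ⟨(isPos_reflectionPerm_self b p.1).2 h, iff_of_false h1 ?_⟩, ?_⟩
      · rw [affRootAct_neg, affPos_neg, not_not]; exact hp.2
      · simp [h1, affNeg_affNeg]

/-- A positive affine root is simple if its reflection makes no other positive affine root
negative. -/
def AffSimple (b : R.Base) (a : ι × ℤ) : Prop :=
  AffPos b a ∧ ∀ p, AffPos b p → p ≠ a → AffPos b (affRootAct (affReflection R a.1 a.2) p)

variable [Fintype ι] [R.IsReduced] (b : R.Base)

lemma length_inv (g : ExtWeyl R) : length b g⁻¹ = length b g := by
  rw [length_eq_ncard, length_eq_ncard]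
  refine Set.ncard_congr (fun p _ => affNeg R (affRootAct g⁻¹ p)) ?_ ?_ ?_
  · intro p hp
    refine ⟨(affPos_neg b _).2 hp.2, ?_⟩
    rw [affRootAct_neg, affRootAct_apply_inv, affPos_neg, not_not]
    exact hp.1
  · intro p r _ _ h
    have := congrArg (affNeg R) h
    simp only [affNeg_affNeg] at this
    exact affRootAct_injective _ this
  · intro p hp
    refine ⟨affNeg R (affRootAct g p), ⟨(affPos_neg b _).2 hp.2, ?_⟩, ?_⟩
    · rw [affRootAct_neg, affRootAct_inv_apply, affPos_neg, not_not]
      exact hp.1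
    · rw [affRootAct_neg, affRootAct_inv_apply, affNeg_affNeg]

lemma length_one : length b (1 : ExtWeyl R) = 0 := by
  rw [length_eq_ncard]
  convert Set.ncard_empty (α := ι × ℤ)
  ext p
  simp [posInv, affRootAct_one]

lemma affPos_act_of_length_eq_zero {o : ExtWeyl R} (ho : length b o = 0) (p : ι × ℤ) :
    AffPos b (affRootAct o p) ↔ AffPos b p := by
  rw [length_eq_ncard, Set.ncard_eq_zero (posInv_finite b o)] at ho
  have key : ∀ p, AffPos b p → AffPos b (affRootAct o p) := by
    intro p hp
    by_contra h
    have : p ∈ posInv b o := ⟨hp, h⟩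
    simp [ho] at this
  refine ⟨fun h => ?_, key p⟩
  by_contra hp
  have := key _ ((affPos_neg b p).2 hp)
  rw [affRootAct_neg, affPos_neg] at this
  exact this h

lemma length_zero_mul {o : ExtWeyl R} (ho : length b o = 0) (g : ExtWeyl R) :
    length b (o * g) = length b g := by
  rw [length_eq_ncard, length_eq_ncard]
  congr 1
  ext p
  simp only [posInv, Set.mem_ofPred_eq, affRootAct_mul, affPos_act_of_length_eq_zero b ho]

variable {b}

lemma AffSimple.posInv_eq {a : ι × ℤ} (ha : AffSimple b a) :
    posInv b (affReflection R a.1 a.2) = {a} := by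
  ext p
  simp only [posInv, Set.mem_ofPred_eq, Set.mem_singleton_iff]
  constructor
  · rintro ⟨h1, h2⟩
    by_contra h
    exact h2 (ha.2 p h1 h)
  · rintro rfl
    refine ⟨ha.1, ?_⟩
    rw [affRootAct_reflection_self, affPos_neg, not_not]
    exact ha.1

lemma AffSimple.isSimpleReflection {a : ι × ℤ} (ha : AffSimple b a) :
    IsSimpleReflection b (affReflection R a.1 a.2) :=
  ⟨⟨_, _, rfl⟩, by rw [length_eq_ncard, ha.posInv_eq, Set.ncard_singleton]⟩

lemma IsSimpleReflection.exists_affSimple {s : ExtWeyl R} (hs : IsSimpleReflection b s) :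
    ∃ a, AffSimple b a ∧ s = affReflection R a.1 a.2 := by
  obtain ⟨⟨i, k, rfl⟩, h⟩ := hs
  rw [length_eq_ncard, Set.ncard_eq_one] at h
  obtain ⟨r, hr⟩ := h
  obtain ⟨a, ha, has⟩ : ∃ a, AffPos b a ∧ affReflection R i k = affReflection R a.1 a.2 := by
    by_cases h : AffPos b (i, k)
    · exact ⟨(i, k), h, rfl⟩
    · exact ⟨affNeg R (i, k), (affPos_neg b _).2 h, (affReflection_neg (i, k)).symm⟩
  rw [has] at hr
  have har : a ∈ posInv b (affReflection R a.1 a.2) := by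
    refine ⟨ha, ?_⟩
    rw [affRootAct_reflection_self, affPos_neg, not_not]
    exact ha
  rw [hr, Set.mem_singleton_iff] at har
  subst har
  refine ⟨a, ⟨ha, fun p hp hpa => ?_⟩, has⟩
  by_contra h
  have : p ∈ posInv b (affReflection R a.1 a.2) := ⟨hp, h⟩
  rw [hr] at this
  exact hpa this

/-- Since s permutes the positive affine roots other than a, the inversions of gs are a and the
s-images of the inversions of g. -/
lemma AffSimple.length_mul_of_pos {a : ι × ℤ} (ha : AffSimple b a) {g : ExtWeyl R}
    (hg : AffPos b (affRootAct g a)) :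
    length b (g * affReflection R a.1 a.2) = length b g + 1 := by
  set s := affReflection R a.1 a.2 with hs
  have hss : ∀ p, affRootAct s (affRootAct s p) = p := by
    intro p
    rw [← affRootAct_mul, affReflection_mul_self, affRootAct_one]
  have hsa : affRootAct s a = affNeg R a := affRootAct_reflection_self a
  have hset : posInv b (g * s) = insert a (affRootAct s '' posInv b g) := by
    ext p
    simp only [posInv, Set.mem_ofPred_eq, affRootAct_mul, Set.mem_insert_iff, Set.mem_image]
    constructor
    · rintro ⟨h1, h2⟩
      by_cases hpa : p = a
      · exact Or.inl hpa
      · exact Or.inr ⟨affRootAct s p, ⟨ha.2 p h1 hpa, h2⟩, hss p⟩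
    · rintro (rfl | ⟨r, ⟨h1, h2⟩, rfl⟩)
      · refine ⟨ha.1, ?_⟩
        rw [hsa, affRootAct_neg, affPos_neg, not_not]
        exact hg
      · rw [hss]
        refine ⟨ha.2 r h1 ?_, h2⟩
        rintro rfl
        exact h2 hg
  have hna : a ∉ affRootAct s '' posInv b g := by
    rintro ⟨r, hr, hra⟩
    have : r = affNeg R a := by rw [← hss r, hra, hsa]
    rw [this] at hr
    exact (affPos_neg b a).1 hr.1 ha.1
  rw [length_eq_ncard, length_eq_ncard, hset,
    Set.ncard_insert_of_notMem hna ((posInv_finite b g).image _),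
    Set.ncard_image_of_injective _ (affRootAct_injective s)]

lemma AffSimple.length_mul_of_neg {a : ι × ℤ} (ha : AffSimple b a) {g : ExtWeyl R}
    (hg : ¬ AffPos b (affRootAct g a)) :
    length b (g * affReflection R a.1 a.2) + 1 = length b g := by
  have h := ha.length_mul_of_pos (g := g * affReflection R a.1 a.2) (by
    rw [affRootAct_mul, affRootAct_reflection_self, affRootAct_neg, affPos_neg]; exact hg)
  rw [mul_assoc, affReflection_mul_self, mul_one] at h
  exact h.symm

lemma AffSimple.length_mul_left {a : ι × ℤ} (g : ExtWeyl R) :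
    length b (affReflection R a.1 a.2 * g) = length b (g⁻¹ * affReflection R a.1 a.2) := by
  rw [← length_inv, mul_inv_rev, affReflection_inv]

lemma AffSimple.length_mul_lt_iff {a : ι × ℤ} (ha : AffSimple b a) (g : ExtWeyl R) :
    length b (affReflection R a.1 a.2 * g) < length b g ↔ ¬ AffPos b (affRootAct g⁻¹ a) := by
  rw [AffSimple.length_mul_left, ← length_inv b g]
  by_cases h : AffPos b (affRootAct g⁻¹ a)
  · have := ha.length_mul_of_pos h
    simp only [h, not_true, iff_false]
    omega
  · have := ha.length_mul_of_neg h
    simp only [h, not_false_iff, iff_true]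
    omega

/-- Among the inversions of g choose `a` of least value at a point x of the alcove. If s_a made
another positive p negative, then either `a` would be a sum of two positive affine roots, or some
positive affine root would equal `a` minus a positive constant. Both produce an inversion of smaller
value. -/
lemma exists_affSimple_mem_posInv (g : ExtWeyl R) (hg : (posInv b g).Nonempty) :
    ∃ a ∈ posInv b g, AffSimple b a := by
  obtain ⟨x, hx⟩ := exists_mem_alcove b
  obtain ⟨a, ha, hmin⟩ := Set.exists_min_image _ (fun p => affEval R p x) (posInv_finite b g) hg
  refine ⟨a, ha, ha.1, ?_⟩
  have hga := affEval_neg_of_not_affPos ha.2 hx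
  have hapos := ha.1.affEval_pos hx
  by_contra! hcon
  obtain ⟨p, hp, hpa, hsp⟩ := hcon
  have hppos := hp.affEval_pos hx
  have hspneg := affEval_neg_of_not_affPos hsp hx
  -- As g makes a = r + r' negative, it makes one of the summands negative, and that summand has
  -- smaller value at x.
  have split : ∀ r r', AffPos b r → AffPos b r' →
      (∀ y, affEval R a y = affEval R r y + affEval R r' y) → False := by
    intro r r' hr hr' h
    have hr1 := hr.affEval_pos hx
    have hr2 := hr'.affEval_pos hx
    have h0 := h x
    have h1 := h (affAct g⁻¹ x)
    rw [← affEval_act', ← affEval_act', ← affEval_act'] at h1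
    by_cases hgr : AffPos b (affRootAct g r)
    · have hgr1 := hgr.affEval_pos hx
      have : affEval R a x ≤ affEval R r' x :=
        hmin r' ⟨hr', (not_affPos_iff hx _).2 (by linarith)⟩
      linarith
    · have : affEval R a x ≤ affEval R r x := hmin r ⟨hr, hgr⟩
      linarith
  set m := R.pairingIn ℤ a.1 p.1 with hm
  have hs := fun y => affEval_reflection (R := R) a p y
  -- Here c = −s_a(p) = m·a − p is positive by assumption; positivity of c and p forces m > 0.
  set c := affNeg R (affRootAct (affReflection R a.1 a.2) p) with hc
  have hcpos : AffPos b c := (affPos_neg b _).2 hsp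
  have hcev : ∀ y, affEval R c y = m * affEval R a y - affEval R p y := by
    intro y
    rw [hc, affEval_neg, hs]
    ring
  have hm0 : 0 < m := by
    by_contra h
    have h' : (m : ℝ) ≤ 0 := by exact_mod_cast not_lt.1 h
    rw [hs] at hspneg
    nlinarith
  -- With the same gradient, p and c = 2a − p differ from `a` by opposite nonzero constants, so one
  -- of them lies below `a`.
  by_cases hpar : p.1 = a.1
  · have hm2 : m = 2 := by rw [hm, hpar, R.pairingIn_same]
    have hk : p.2 ≠ a.2 := fun h => hpa (Prod.ext hpar h)
    have hpev : ∀ y, affEval R p y = affEval R a y + (a.2 - p.2) := by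
      intro y
      simp only [affEval, hpar]
      ring
    have smaller : ∀ r, AffPos b r → ∀ d : ℝ, 0 < d →
        (∀ y, affEval R r y = affEval R a y - d) → False := by
      intro r hr d hd h
      have h1 := h (affAct g⁻¹ x)
      rw [← affEval_act', ← affEval_act'] at h1
      have : affEval R a x ≤ affEval R r x := hmin r ⟨hr, (not_affPos_iff hx _).2 (by linarith)⟩
      have := h x
      linarith
    rcases lt_or_gt_of_ne hk with h | h
    · refine smaller c hcpos (a.2 - p.2) (by have : (p.2 : ℝ) < a.2 := by exact_mod_cast h
                                             linarith) fun y => ?_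
      rw [hcev, hpev, hm2]
      push_cast
      ring
    · refine smaller p hp (p.2 - a.2) (by have : (a.2 : ℝ) < p.2 := by exact_mod_cast h
                                          linarith) fun y => ?_
      rw [hpev]
      ring
  · have hflip : 0 < R.flip.pairingIn ℤ p.1 a.1 := by
      have h1 := R.flip.algebraMap_pairingIn ℤ p.1 a.1
      rw [R.pairing_flip, ← R.algebraMap_pairingIn ℤ a.1 p.1] at h1
      have h2 : R.flip.pairingIn ℤ p.1 a.1 = m := by exact_mod_cast h1
      rw [h2]
      exact hm0
    obtain ⟨d, hd⟩ := R.flip.root_sub_root_mem_of_pairingIn_pos hflip hpar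
    set D : ι × ℤ := (d, p.2 - a.2) with hD
    have hDev : ∀ y, affEval R D y = affEval R p y - affEval R a y := by
      intro y
      have h1 : R.coroot' d y = R.coroot' p.1 y - R.coroot' a.1 y := by
        change R.toLinearMap y (R.coroot d) = R.toLinearMap y (R.coroot p.1)
          - R.toLinearMap y (R.coroot a.1)
        rw [← map_sub]
        exact congrArg _ hd
      simp only [affEval, hD, h1]
      push_cast
      ring
    -- D = p − a is an affine root because m > 0. If it is negative, a = p + (−D). Otherwise
    -- consider E = s_a(D) = a − c.
    by_cases hDp : AffPos b D
    · set E := affRootAct (affReflection R a.1 a.2) D with hE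
      have hEev : ∀ y, affEval R E y = affEval R a y - affEval R c y := by
        intro y
        rw [hE, affEval_act', hDev, ← affEval_act', ← affEval_act', affRootAct_reflection_self,
          affEval_neg, hc, affEval_neg]
        ring
      by_cases hEp : AffPos b E
      · exact split c E hcpos hEp fun y => by rw [hEev]; ring
      -- D > 0 and E < 0 give a < p < (m − 1)a at x, hence m > 2, which occurs only for m = 3. Then
      -- a = D + (−E), since −E = 2a − p.
      · have hm3 : m = 3 := by
          have h1 := hDp.affEval_pos hx
          have h2 := affEval_neg_of_not_affPos hEp hx
          rw [hDev] at h1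
          rw [hEev, hcev] at h2
          have h4 : 2 < m := by
            by_contra h4
            have : (m : ℝ) ≤ 2 := by exact_mod_cast not_lt.1 h4
            nlinarith
          have h5 := R.pairingIn_pairingIn_mem_set_of_isCrystal_of_isRed a.1 p.1
          rw [← hm] at h5
          simp only [Set.mem_insert_iff, Prod.mk.injEq, Set.mem_singleton_iff] at h5
          omega
        refine split D (affNeg R E) hDp ((affPos_neg b E).2 hEp) fun y => ?_
        rw [affEval_neg, hDev, hEev, hcev, hm3]
        push_cast
        ring
    · refine split p (affNeg R D) hp ((affPos_neg b D).2 hDp) fun y => ?_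
      rw [affEval_neg, hDev]
      ring

variable (b)

theorem lengthSystem : LengthSystem (length b) {s | IsSimpleReflection b s} where
  one := length_one b
  inv := length_inv b
  sq := by
    rintro s hs
    obtain ⟨a, _, rfl⟩ := hs.exists_affSimple
    exact affReflection_mul_self a
  step := by
    rintro s hs g
    obtain ⟨a, ha, rfl⟩ := hs.exists_affSimple
    rw [AffSimple.length_mul_left, ← length_inv b g]
    by_cases h : AffPos b (affRootAct g⁻¹ a)
    · exact Or.inl (ha.length_mul_of_pos h)
    · exact Or.inr (ha.length_mul_of_neg h)
  descent := by
    intro g hg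
    rw [← length_inv, length_eq_ncard] at hg
    obtain ⟨a, ha, has⟩ := exists_affSimple_mem_posInv g⁻¹
      (Set.nonempty_of_ncard_ne_zero hg)
    exact ⟨_, has.isSimpleReflection, (has.length_mul_lt_iff g).2 ha.2⟩
  exchange := by
    intro s hs t ht g hne
    obtain ⟨a, ha, rfl⟩ := hs.exists_affSimple
    obtain ⟨c, hc, rfl⟩ := ht.exists_affSimple
    rw [mul_assoc, ha.length_mul_lt_iff, ha.length_mul_lt_iff, mul_inv_rev, affReflection_inv,
      affRootAct_mul, not_iff_not]
    -- If g⁻¹a were c or −c, the two reflections would be conjugate under g, that is, sg = gt.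
    -- Otherwise the simple reflection in c preserves the sign of g⁻¹a.
    set r := affRootAct g⁻¹ a with hr
    have hrefl : affReflection R r.1 r.2 = g⁻¹ * affReflection R a.1 a.2 * g := by
      rw [hr, affReflection_act, inv_inv]
    have h1 : r ≠ c := by
      rintro h
      rw [h] at hrefl
      apply hne
      rw [hrefl]
      group
    have h2 : affNeg R r ≠ c := by
      rintro h
      rw [← affReflection_neg, h] at hrefl
      apply hne
      rw [hrefl]
      group
    by_cases hrp : AffPos b r
    · exact iff_of_true (hc.2 r hrp h1) hrp
    · have := hc.2 _ ((affPos_neg b r).2 hrp) h2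
      rw [affRootAct_neg, affPos_neg] at this
      exact iff_of_false this hrp
  zero_mul := fun o ho g => length_zero_mul b ho g

end Inversions

namespace LengthSystem

variable {G : Type*} [Group G] {ℓ : G → ℕ} {S : Set G}

/-! ### Reduced words and the deletion property. -/

section Words

variable (h : LengthSystem ℓ S)
include h

lemma inv_eq {s : G} (hs : s ∈ S) : s⁻¹ = s := inv_eq_of_mul_eq_one_right (h.sq s hs)

lemma mul_mul_cancel {s : G} (hs : s ∈ S) (g : G) : s * (s * g) = g := by
  rw [← mul_assoc, h.sq s hs, one_mul]

lemma mul_mul_cancel_right {s : G} (hs : s ∈ S) (g : G) : g * s * s = g := by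
  rw [mul_assoc, h.sq s hs, mul_one]

lemma length_mul_simple {s : G} (hs : s ∈ S) (g : G) : ℓ (g * s) = ℓ (s * g⁻¹) := by
  rw [← h.inv (g * s), mul_inv_rev, h.inv_eq hs]

lemma step_right {s : G} (hs : s ∈ S) (g : G) : ℓ (g * s) = ℓ g + 1 ∨ ℓ (g * s) + 1 = ℓ g := by
  rw [h.length_mul_simple hs, ← h.inv g]
  exact h.step s hs g⁻¹

lemma descent_right {g : G} (hg : ℓ g ≠ 0) : ∃ s ∈ S, ℓ (g * s) < ℓ g := by
  rw [← h.inv] at hg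
  obtain ⟨s, hs, hlt⟩ := h.descent g⁻¹ hg
  exact ⟨s, hs, by rwa [h.length_mul_simple hs, ← h.inv g]⟩

lemma exchange_right {s t : G} (hs : s ∈ S) (ht : t ∈ S) (g : G) (hne : s * g ≠ g * t) :
    ℓ (s * g * t) < ℓ (s * g) ↔ ℓ (g * t) < ℓ g := by
  have := h.exchange t ht s hs g⁻¹ (fun he => hne (by
    have := congrArg (·⁻¹) he
    simp only [mul_inv_rev, inv_inv, h.inv_eq hs, h.inv_eq ht] at this
    exact this.symm))
  rw [← h.inv (t * g⁻¹ * s), ← h.inv (g⁻¹ * s), ← h.inv (t * g⁻¹), h.inv g] at this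
  simpa only [mul_inv_rev, inv_inv, h.inv_eq hs, h.inv_eq ht, mul_assoc] using this

lemma mul_zero {o : G} (ho : ℓ o = 0) (g : G) : ℓ (g * o) = ℓ g := by
  rw [← h.inv, mul_inv_rev, h.zero_mul _ (by rw [h.inv, ho]), h.inv]

lemma not_lt_iff {s : G} (hs : s ∈ S) (g : G) : ¬ ℓ (s * g) < ℓ g ↔ ℓ (s * g) = ℓ g + 1 := by
  have := h.step s hs g
  omega

lemma lt_iff {s : G} (hs : s ∈ S) (g : G) : ℓ (s * g) < ℓ g ↔ ℓ (s * g) + 1 = ℓ g := by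
  have := h.step s hs g
  omega

lemma exists_word (g : G) : ∃ (l : List G) (o : G),
    (∀ s ∈ l, s ∈ S) ∧ ℓ o = 0 ∧ g = l.prod * o ∧ l.length = ℓ g := by
  induction hn : ℓ g generalizing g with
  | zero => exact ⟨[], g, by simp, hn, by simp, rfl⟩
  | succ n ih =>
    obtain ⟨s, hs, hlt⟩ := h.descent g (by omega)
    have h1 := (h.lt_iff hs g).1 hlt
    obtain ⟨l, o, hl, ho, he, hlen⟩ := ih (s * g) (by omega)
    refine ⟨s :: l, o, ?_, ho, ?_, by simp [hlen]⟩
    · intro t ht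
      rcases List.mem_cons.1 ht with rfl | ht
      · exact hs
      · exact hl t ht
    · rw [List.prod_cons, mul_assoc, ← he, h.mul_mul_cancel hs]

lemma length_prod_mul_le {l : List G} (hl : ∀ s ∈ l, s ∈ S) (g : G) :
    ℓ (l.prod * g) ≤ l.length + ℓ g := by
  induction l with
  | nil => simp
  | cons s l ih =>
    have h1 := ih fun t ht => hl t (List.mem_cons_of_mem _ ht)
    have h2 := h.step s (hl s List.mem_cons_self) (l.prod * g)
    rw [List.prod_cons, mul_assoc, List.length_cons]
    omega

lemma length_prod_le {l : List G} (hl : ∀ s ∈ l, s ∈ S) : ℓ l.prod ≤ l.length := by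
  have := h.length_prod_mul_le hl 1
  rwa [mul_one, h.one, add_zero] at this

lemma length_mul_le (u v : G) : ℓ (u * v) ≤ ℓ u + ℓ v := by
  obtain ⟨l, o, hl, ho, he, hlen⟩ := h.exists_word u
  conv_lhs => rw [he]
  rw [mul_assoc, ← hlen, ← h.zero_mul o ho v]
  exact h.length_prod_mul_le hl _

/-- Peel off the last letter t of the word ut. If s is already a descent of u, recurse; if not,
`exchange` forces su = ut, and the letter to delete is t. -/
lemma exists_sublist_of_length_lt {l : List G} (hl : ∀ s ∈ l, s ∈ S) (hred : ℓ l.prod = l.length)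
    {s : G} (hs : s ∈ S) (hlt : ℓ (s * l.prod) < ℓ l.prod) :
    ∃ l' : List G, l'.Sublist l ∧ l'.prod = s * l.prod ∧ l'.length + 1 = l.length := by
  induction l using List.reverseRecOn with
  | nil => simp [h.one] at hlt
  | append_singleton u t ih =>
    have hu : ∀ s ∈ u, s ∈ S := fun x hx => hl x (by simp [hx])
    have ht : t ∈ S := hl t (by simp)
    have hprod : (u ++ [t]).prod = u.prod * t := by simp
    rw [hprod] at hlt hred ⊢
    rw [List.length_append, List.length_singleton] at hred
    have h1 := h.length_prod_le hu
    have h2 := h.step_right ht u.prod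
    have hured : ℓ u.prod = u.length := by omega
    by_cases hc : ℓ (s * u.prod) < ℓ u.prod
    · obtain ⟨l', hsub, hp, hlen⟩ := ih hu hured hc
      refine ⟨l' ++ [t], hsub.append (List.Sublist.refl _), ?_, by simp [← hlen]⟩
      simp [hp, mul_assoc]
    · have he : s * u.prod = u.prod * t := by
        by_contra hne
        exact hc ((h.exchange s hs t ht u.prod hne).1 (by rwa [mul_assoc]))
      refine ⟨u, List.sublist_append_left u [t], ?_, by simp⟩
      rw [← he, h.mul_mul_cancel hs]

lemma exists_reduced_sublist {l : List G} (hl : ∀ s ∈ l, s ∈ S) :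
    ∃ l' : List G, l'.Sublist l ∧ l'.prod = l.prod ∧ l'.length = ℓ l.prod := by
  induction l with
  | nil => exact ⟨[], List.Sublist.refl _, rfl, by simp [h.one]⟩
  | cons s l ih =>
    have hs : s ∈ S := hl s List.mem_cons_self
    have hl' : ∀ s ∈ l, s ∈ S := fun t ht => hl t (List.mem_cons_of_mem _ ht)
    obtain ⟨l', hsub, hp, hlen⟩ := ih hl'
    have hl'' : ∀ s ∈ l', s ∈ S := fun t ht => hl' t (hsub.subset ht)
    by_cases hc : ℓ (s * l.prod) < ℓ l.prod
    · rw [← hp] at hc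
      obtain ⟨l₂, hsub₂, hp₂, hlen₂⟩ := h.exists_sublist_of_length_lt hl'' (by rw [hp, hlen]) hs hc
      refine ⟨l₂, (hsub₂.trans hsub).cons s, by rw [hp₂, hp, List.prod_cons], ?_⟩
      rw [List.prod_cons, ← hp]
      have := (h.lt_iff hs _).1 hc
      rw [hp] at this ⊢
      omega
    · refine ⟨s :: l', hsub.cons_cons s, by simp [hp], ?_⟩
      rw [List.prod_cons, (h.not_lt_iff hs _).1 hc, List.length_cons, hlen]

end Words

/-! ### The regular representation of the Hecke algebra. -/

section Regular

variable {K : Type*} [CommRing K]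

open Classical in
/-- Left multiplication by `T_s` in the regular representation of the Hecke algebra. -/
def leftOp (ℓ : G → ℕ) (ξ : K) (s : G) : Module.End K (G →₀ K) :=
  Finsupp.linearCombination K fun w =>
    Finsupp.single (s * w) 1 + if ℓ (s * w) < ℓ w then ξ • Finsupp.single w 1 else 0

open Classical in
/-- Right multiplication by `T_s` in the regular representation of the Hecke algebra. -/
def rightOp (ℓ : G → ℕ) (ξ : K) (s : G) : Module.End K (G →₀ K) :=
  Finsupp.linearCombination K fun w =>
    Finsupp.single (w * s) 1 + if ℓ (w * s) < ℓ w then ξ • Finsupp.single w 1 else 0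

/-- Left translation of the group algebra. -/
def leftShift (K : Type*) [CommRing K] (o : G) : Module.End K (G →₀ K) :=
  Finsupp.linearCombination K fun w => Finsupp.single (o * w) 1

/-- Right translation of the group algebra. -/
def rightShift (K : Type*) [CommRing K] (o : G) : Module.End K (G →₀ K) :=
  Finsupp.linearCombination K fun w => Finsupp.single (w * o) 1

open Classical in
lemma leftOp_single (ξ : K) (s w : G) : leftOp ℓ ξ s (Finsupp.single w 1) =
    Finsupp.single (s * w) 1 + if ℓ (s * w) < ℓ w then ξ • Finsupp.single w 1 else 0 := by
  simp [leftOp]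

open Classical in
lemma rightOp_single (ξ : K) (s w : G) : rightOp ℓ ξ s (Finsupp.single w 1) =
    Finsupp.single (w * s) 1 + if ℓ (w * s) < ℓ w then ξ • Finsupp.single w 1 else 0 := by
  simp [rightOp]

lemma leftShift_single (o w : G) :
    leftShift K o (Finsupp.single w 1) = Finsupp.single (o * w) 1 := by
  simp [leftShift]

lemma rightShift_single (o w : G) :
    rightShift K o (Finsupp.single w 1) = Finsupp.single (w * o) 1 := by
  simp [rightShift]

lemma end_ext {E F : Module.End K (G →₀ K)}
    (hEF : ∀ w, E (Finsupp.single w 1) = F (Finsupp.single w 1)) : E = F := by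
  refine Finsupp.lhom_ext' fun w => LinearMap.ext_ring ?_
  simpa using hEF w

/-- An endomorphism of the regular representation that commutes with all right
multiplications. -/
structure IsRightLinear (ℓ : G → ℕ) (S : Set G) (ξ : K) (E : Module.End K (G →₀ K)) : Prop where
  op : ∀ t ∈ S, Commute E (rightOp ℓ ξ t)
  shift : ∀ o, ℓ o = 0 → Commute E (rightShift K o)

lemma IsRightLinear.mul {ξ : K} {E F : Module.End K (G →₀ K)} (hE : IsRightLinear ℓ S ξ E)
    (hF : IsRightLinear ℓ S ξ F) : IsRightLinear ℓ S ξ (E * F) :=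
  ⟨fun t ht => (hE.op t ht).mul_left (hF.op t ht),
    fun o ho => (hE.shift o ho).mul_left (hF.shift o ho)⟩

lemma IsRightLinear.add {ξ : K} {E F : Module.End K (G →₀ K)} (hE : IsRightLinear ℓ S ξ E)
    (hF : IsRightLinear ℓ S ξ F) : IsRightLinear ℓ S ξ (E + F) :=
  ⟨fun t ht => (hE.op t ht).add_left (hF.op t ht),
    fun o ho => (hE.shift o ho).add_left (hF.shift o ho)⟩

lemma IsRightLinear.smul {ξ : K} {E : Module.End K (G →₀ K)} (hE : IsRightLinear ℓ S ξ E)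
    (c : K) : IsRightLinear ℓ S ξ (c • E) :=
  ⟨fun t ht => (hE.op t ht).smul_left c, fun o ho => (hE.shift o ho).smul_left c⟩

variable (h : LengthSystem ℓ S)
include h

/-- When sw ≠ wt, the exchange condition makes left and right descents independent of each other and
the terms match. When sw = wt, the two operators give the same vector directly. -/
lemma isRightLinear_leftOp (ξ : K) {s : G} (hs : s ∈ S) :
    IsRightLinear ℓ S ξ (leftOp ℓ ξ s) := by
  classical
  constructor
  · intro t ht
    refine end_ext fun w => ?_
    simp only [Module.End.mul_apply, leftOp_single, rightOp_single, map_add, apply_ite, map_smul,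
      map_zero, mul_assoc]
    have e1 : ℓ (s * (w * t)) = ℓ (s * w * t) := by rw [mul_assoc]
    have hst := h.step s hs w
    have htt := h.step_right ht w
    by_cases he : s * w = w * t
    · have hw : s * (w * t) = w := by rw [← he, h.mul_mul_cancel hs]
      rw [hw, he]
      by_cases hc : ℓ (w * t) < ℓ w
      · simp [hc, not_lt.2 hc.le]
      · rw [he] at hst
        have hc2 : ℓ w < ℓ (w * t) := by omega
        simp [hc, hc2]
    · have h1 := h.exchange s hs t ht w he
      have h2 := h.exchange_right hs ht w he
      rw [mul_assoc] at h1 h2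
      simp only [h1, h2]
      by_cases c1 : ℓ (s * w) < ℓ w <;> by_cases c2 : ℓ (w * t) < ℓ w <;> simp [c1, c2] <;> abel
  · intro o ho
    refine end_ext fun w => ?_
    simp only [Module.End.mul_apply, leftOp_single, rightShift_single, map_add, apply_ite,
      map_smul, map_zero, ← mul_assoc, h.mul_zero ho]
    split_ifs <;> rfl

lemma isRightLinear_leftShift (ξ : K) {o : G} (ho : ℓ o = 0) :
    IsRightLinear ℓ S ξ (leftShift K o) := by
  classical
  constructor
  · intro t ht
    refine end_ext fun w => ?_
    simp only [Module.End.mul_apply, leftShift_single, rightOp_single, map_add, apply_ite,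
      map_smul, map_zero, mul_assoc, h.zero_mul o ho]
    split_ifs <;> rfl
  · intro o' ho'
    refine end_ext fun w => ?_
    simp only [Module.End.mul_apply, leftShift_single, rightShift_single, mul_assoc]

/-- The basis vector at 1 generates the whole module under right multiplications, so a right-linear
endomorphism is known from its value there. -/
lemma rightLinear_ext {ξ : K} {E F : Module.End K (G →₀ K)} (hE : IsRightLinear ℓ S ξ E)
    (hF : IsRightLinear ℓ S ξ F) (h1 : E (Finsupp.single 1 1) = F (Finsupp.single 1 1)) :
    E = F := by
  classical
  refine end_ext fun w => ?_
  induction hn : ℓ w generalizing w with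
  | zero =>
    have hE' := LinearMap.congr_fun (hE.shift w hn) (Finsupp.single 1 1)
    have hF' := LinearMap.congr_fun (hF.shift w hn) (Finsupp.single 1 1)
    simp only [Module.End.mul_apply, rightShift_single, one_mul] at hE' hF'
    rw [hE', hF', h1]
  | succ n ih =>
    obtain ⟨t, ht, hlt⟩ := h.descent_right (g := w) (by omega)
    have hstep := h.step_right ht w
    have hw : rightOp ℓ ξ t (Finsupp.single (w * t) 1) = Finsupp.single w 1 := by
      rw [rightOp_single, h.mul_mul_cancel_right ht, if_neg (by omega), add_zero]
    have hE' := LinearMap.congr_fun (hE.op t ht) (Finsupp.single (w * t) 1)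
    have hF' := LinearMap.congr_fun (hF.op t ht) (Finsupp.single (w * t) 1)
    simp only [Module.End.mul_apply, hw] at hE' hF'
    rw [hE', hF', ih (w * t) (by omega)]

/-- Compose left operators along a reduced word of u. Independence of the word need not be checked:
`rightLinear_ext` provides it. -/
lemma exists_isRightLinear (ξ : K) (u : G) : ∃ E, IsRightLinear ℓ S ξ E ∧
    ∀ v, ℓ (u * v) = ℓ u + ℓ v → E (Finsupp.single v 1) = Finsupp.single (u * v) 1 := by
  classical
  induction hn : ℓ u generalizing u with
  | zero => exact ⟨leftShift K u, h.isRightLinear_leftShift ξ hn, fun v _ => leftShift_single u v⟩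
  | succ n ih =>
    obtain ⟨s, hs, hlt⟩ := h.descent u (by omega)
    have hstep := (h.lt_iff hs u).1 hlt
    obtain ⟨E, hE, hE'⟩ := ih (s * u) (by omega)
    refine ⟨leftOp ℓ ξ s * E, (h.isRightLinear_leftOp ξ hs).mul hE, fun v hv => ?_⟩
    have h1 := h.length_mul_le (s * u) v
    have h2 := h.step s hs (u * v)
    rw [← mul_assoc] at h2
    rw [Module.End.mul_apply, hE' v (by omega), leftOp_single, mul_assoc, h.mul_mul_cancel hs,
      if_neg (by rw [← mul_assoc]; omega), add_zero]

/-- The regular representation of the Hecke algebra. -/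
theorem exists_regular (ξ : K) : ∃ L : G → Module.End K (G →₀ K),
    (∀ w, L w (Finsupp.single 1 1) = Finsupp.single w 1) ∧ L 1 = 1 ∧
    (∀ u v, ℓ (u * v) = ℓ u + ℓ v → L u * L v = L (u * v)) ∧
    ∀ s ∈ S, ∀ w, ℓ (s * w) < ℓ w → L s * L w = ξ • L w + L (s * w) := by
  classical
  choose L hL hL' using h.exists_isRightLinear (K := K) ξ
  have hone : ∀ w, L w (Finsupp.single 1 1) = Finsupp.single w 1 := by
    intro w
    have := hL' w 1 (by rw [mul_one, h.one, add_zero])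
    rwa [mul_one] at this
  refine ⟨L, hone, ?_, ?_, ?_⟩
  -- Both sides of each relation are right linear, so each is verified on the basis vector at 1
  -- only.
  · refine h.rightLinear_ext (hL 1) ⟨fun _ _ => Commute.one_left _, fun _ _ => Commute.one_left _⟩ ?_
    rw [hone, Module.End.one_apply]
  · intro u v huv
    refine h.rightLinear_ext ((hL u).mul (hL v)) (hL _) ?_
    rw [Module.End.mul_apply, hone, hL' u v huv, hone]
  · intro s hs w hlt
    have hsl : L s = leftOp ℓ ξ s := by
      refine h.rightLinear_ext (hL s) (h.isRightLinear_leftOp ξ hs) ?_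
      have := h.step s hs 1
      rw [hone, leftOp_single, mul_one, h.one, if_neg (Nat.not_lt_zero _), add_zero]
    refine h.rightLinear_ext ((hL s).mul (hL w)) (((hL w).smul ξ).add (hL (s * w))) ?_
    rw [Module.End.mul_apply, hone, hsl, leftOp_single, if_pos hlt, LinearMap.add_apply,
      LinearMap.smul_apply, hone, hone, add_comm]

end Regular

end LengthSystem

/-! ### The elements T_w form a basis of the affine Hecke algebra. -/

section HeckeBasis

variable {ι V N : Type*} [AddCommGroup V] [Module ℝ V] [AddCommGroup N] [Module ℝ N]
  {R : RootPairing ι ℝ V N} [R.IsCrystallographic] (b : R.Base)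

lemma T_one : T b 1 = 1 := by
  rw [T, RingQuot.mkAlgHom_rel Coeff (HeckeRel.one (b := b)), map_one]

variable {b}

lemma T_mul {u v : ExtWeyl R} (h : length b (u * v) = length b u + length b v) :
    T b u * T b v = T b (u * v) := by
  rw [T, T, T, ← map_mul, RingQuot.mkAlgHom_rel Coeff (HeckeRel.mul u v h)]

lemma T_quad {s w : ExtWeyl R} (hs : IsSimpleReflection b s)
    (h : length b (s * w) < length b w) :
    T b s * T b w = (q - q⁻¹) • T b w + T b (s * w) := by
  rw [T, T, T, ← map_mul, RingQuot.mkAlgHom_rel Coeff (HeckeRel.quad s w hs h), map_add, map_smul]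

variable [Fintype ι] [R.IsReduced]

lemma IsSimpleReflection.mul_self {s : ExtWeyl R} (hs : IsSimpleReflection b s) : s * s = 1 :=
  (lengthSystem b).sq s hs

lemma T_simple_mul {s w : ExtWeyl R} (hs : IsSimpleReflection b s)
    (h : length b w < length b (s * w)) : T b s * T b w = T b (s * w) := by
  have := (lengthSystem b).step s hs w
  exact T_mul (by rw [hs.2]; omega)

lemma T_mul_simple {s w : ExtWeyl R} (hs : IsSimpleReflection b s)
    (h : length b w < length b (w * s)) : T b w * T b s = T b (w * s) := by
  have := (lengthSystem b).step_right hs w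
  exact T_mul (by rw [hs.2]; omega)

lemma T_simple_sq {s : ExtWeyl R} (hs : IsSimpleReflection b s) :
    T b s * T b s = (q - q⁻¹) • T b s + 1 := by
  rw [T_quad hs (by rw [hs.mul_self, length_one, hs.2]; exact one_pos), hs.mul_self, T_one]

lemma T_mul_quad {s w : ExtWeyl R} (hs : IsSimpleReflection b s)
    (h : length b (w * s) < length b w) :
    T b w * T b s = (q - q⁻¹) • T b w + T b (w * s) := by
  have hw : w * s * s = w := (lengthSystem b).mul_mul_cancel_right hs w
  have h1 := T_mul_simple (w := w * s) hs (by rwa [hw])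
  rw [hw] at h1
  rw [← h1, mul_assoc, T_simple_sq hs, mul_add, mul_one, mul_smul_comm]

lemma T_zero_mul {o : ExtWeyl R} (ho : length b o = 0) (w : ExtWeyl R) :
    T b o * T b w = T b (o * w) :=
  T_mul (by rw [(lengthSystem b).zero_mul o ho, ho, zero_add])

lemma T_mul_zero {o : ExtWeyl R} (ho : length b o = 0) (w : ExtWeyl R) :
    T b w * T b o = T b (w * o) :=
  T_mul (by rw [(lengthSystem b).mul_zero ho, ho, add_zero])

lemma T_simple_inv_mul {s : ExtWeyl R} (hs : IsSimpleReflection b s) :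
    (T b s + (q⁻¹ - q) • (1 : Hecke b)) * T b s = 1 := by
  rw [add_mul, T_simple_sq hs, smul_mul_assoc, one_mul, add_right_comm, ← add_smul,
    sub_add_sub_cancel, sub_self, zero_smul, zero_add]

lemma T_simple_mul_inv {s : ExtWeyl R} (hs : IsSimpleReflection b s) :
    T b s * (T b s + (q⁻¹ - q) • (1 : Hecke b)) = 1 := by
  refine Eq.trans ?_ (T_simple_inv_mul hs)
  rw [mul_add, add_mul, mul_smul_comm, smul_mul_assoc, mul_one, one_mul]

/-- An induction principle for the extended affine Weyl group along left descents. -/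
lemma length_induction {P : ExtWeyl R → Prop} (zero : ∀ o, length b o = 0 → P o)
    (step : ∀ s w, IsSimpleReflection b s → length b (s * w) = length b w + 1 → P w → P (s * w))
    (w : ExtWeyl R) : P w := by
  induction hn : length b w generalizing w with
  | zero => exact zero w hn
  | succ n ih =>
    obtain ⟨s, hs, hlt⟩ := (lengthSystem b).descent w (by omega)
    have h1 := ((lengthSystem b).lt_iff hs w).1 hlt
    have h2 := (lengthSystem b).mul_mul_cancel hs w
    have := step s (s * w) hs (by rw [h2]; omega) (ih (s * w) (by omega))
    rwa [h2] at this

lemma isUnit_T_simple {s : ExtWeyl R} (hs : IsSimpleReflection b s) : IsUnit (T b s) :=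
  ⟨⟨_, _, T_simple_mul_inv hs, T_simple_inv_mul hs⟩, rfl⟩

lemma T_zero_mul_inv {o : ExtWeyl R} (ho : length b o = 0) : T b o * T b o⁻¹ = 1 := by
  rw [T_zero_mul ho, mul_inv_cancel, T_one]

lemma T_zero_inv_mul {o : ExtWeyl R} (ho : length b o = 0) : T b o⁻¹ * T b o = 1 := by
  rw [T_mul_zero ho, inv_mul_cancel, T_one]

variable (b) in
-- `Ring.inverse` is zero on nonunits; invertibility of T_w makes the inverses in `heckeX` and in
-- the bar involution genuine.
lemma isUnit_T (w : ExtWeyl R) : IsUnit (T b w) := by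
  induction w using length_induction (b := b) with
  | zero o ho => exact ⟨⟨_, _, T_zero_mul_inv ho, T_zero_inv_mul ho⟩, rfl⟩
  | step s w hs h ih =>
    rw [← T_simple_mul hs (by omega)]
    exact (isUnit_T_simple hs).mul ih

variable (b)

/-- The span of the `T_w`. -/
abbrev heckeSpan : Submodule Coeff (Hecke b) := Submodule.span Coeff (Set.range (T b))

lemma T_mem_heckeSpan (w : ExtWeyl R) : T b w ∈ heckeSpan b :=
  Submodule.subset_span ⟨w, rfl⟩

lemma T_simple_mul_mem {s : ExtWeyl R} (hs : IsSimpleReflection b s) {x : Hecke b}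
    (hx : x ∈ heckeSpan b) : T b s * x ∈ heckeSpan b := by
  induction hx using Submodule.span_induction with
  | mem x hx =>
    obtain ⟨w, rfl⟩ := hx
    by_cases h : length b (s * w) < length b w
    · rw [T_quad hs h]
      exact add_mem (Submodule.smul_mem _ _ (T_mem_heckeSpan b w)) (T_mem_heckeSpan b _)
    · have := ((lengthSystem b).not_lt_iff hs w).1 h
      rw [T_simple_mul hs (by omega)]
      exact T_mem_heckeSpan b _
  | zero => rw [mul_zero]; exact zero_mem _
  | add x y _ _ hx hy => rw [mul_add]; exact add_mem hx hy
  | smul c x _ hx => rw [mul_smul_comm]; exact Submodule.smul_mem _ _ hx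

lemma T_mul_mem (u : ExtWeyl R) {x : Hecke b} (hx : x ∈ heckeSpan b) :
    T b u * x ∈ heckeSpan b := by
  induction u using length_induction (b := b) with
  | zero o ho =>
    induction hx using Submodule.span_induction with
    | mem x hx =>
      obtain ⟨w, rfl⟩ := hx
      rw [T_zero_mul ho]
      exact T_mem_heckeSpan b _
    | zero => rw [mul_zero]; exact zero_mem _
    | add x y _ _ hx hy => rw [mul_add]; exact add_mem hx hy
    | smul c x _ hx => rw [mul_smul_comm]; exact Submodule.smul_mem _ _ hx
  | step s w hs h ih =>
    rw [← T_simple_mul hs (by omega), mul_assoc]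
    exact T_simple_mul_mem b hs ih

lemma heckeSpan_eq_top : heckeSpan b = ⊤ := by
  rw [eq_top_iff]
  rintro x -
  obtain ⟨f, rfl⟩ := RingQuot.mkAlgHom_surjective Coeff (HeckeRel b) x
  induction f using FreeAlgebra.induction with
  | grade0 c =>
    rw [AlgHom.commutes, Algebra.algebraMap_eq_smul_one, ← T_one b]
    exact Submodule.smul_mem _ _ (T_mem_heckeSpan b 1)
  | grade1 w => exact T_mem_heckeSpan b w
  | mul f g hf hg =>
    rw [map_mul]
    generalize RingQuot.mkAlgHom Coeff (HeckeRel b) f = x at hf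
    induction hf using Submodule.span_induction with
    | mem x hx =>
      obtain ⟨w, rfl⟩ := hx
      exact T_mul_mem b w hg
    | zero => rw [zero_mul]; exact zero_mem _
    | add x y _ _ hx hy => rw [add_mul]; exact add_mem hx hy
    | smul c x _ hx => rw [smul_mul_assoc]; exact Submodule.smul_mem _ _ hx
  | add f g hf hg => rw [map_add]; exact add_mem hf hg

/-- Let the algebra act on the basis vector at 1 of the regular representation: T_w goes to the
basis vector at w. Linear independence of the T_w follows. -/
lemma exists_coord : ∃ c : Hecke b →ₗ[Coeff] (ExtWeyl R →₀ Coeff),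
    ∀ w, c (T b w) = Finsupp.single w 1 := by
  obtain ⟨L, h1, hone, hmul, hquad⟩ := (lengthSystem b).exists_regular (K := Coeff) (q - q⁻¹)
  let φ : Hecke b →ₐ[Coeff] Module.End Coeff (ExtWeyl R →₀ Coeff) :=
    RingQuot.liftAlgHom Coeff ⟨FreeAlgebra.lift Coeff L, by
      intro x y hxy
      induction hxy with
      | one => simp [hone]
      | mul u v h => simp [hmul u v h]
      | quad s w hs h => simp [hquad s hs w h]⟩
  have hφ : ∀ w, φ (T b w) = L w := by
    intro w
    simp [φ, T]
  exact ⟨(LinearMap.applyₗ (Finsupp.single 1 1)).comp φ.toLinearMap, fun w => by simp [hφ, h1]⟩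

lemma linearIndependent_T : LinearIndependent Coeff (T b) := by
  obtain ⟨c, hc⟩ := exists_coord b
  refine LinearIndependent.of_comp c ?_
  have : (c ∘ T b) = fun w => Finsupp.single w (1 : Coeff) := funext hc
  rw [this]
  exact Finsupp.linearIndependent_single_one Coeff _

/-- The basis of the affine Hecke algebra formed by the `T_w`. -/
def heckeBasis : Module.Basis (ExtWeyl R) Coeff (Hecke b) :=
  Module.Basis.mk (linearIndependent_T b) (heckeSpan_eq_top b).ge

@[simp] lemma heckeBasis_apply (w : ExtWeyl R) : heckeBasis b w = T b w := by
  rw [heckeBasis, Module.Basis.mk_apply]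

lemma heckeBasis_repr_T (w : ExtWeyl R) : (heckeBasis b).repr (T b w) = Finsupp.single w 1 := by
  rw [← heckeBasis_apply, Module.Basis.repr_self]

lemma hecke_induction {P : Hecke b → Prop} (T : ∀ w, P (T b w)) (zero : P 0)
    (add : ∀ x y, P x → P y → P (x + y)) (smul : ∀ (c : Coeff) x, P x → P (c • x))
    (x : Hecke b) : P x := by
  have hx : x ∈ heckeSpan b := by rw [heckeSpan_eq_top]; trivial
  induction hx using Submodule.span_induction with
  | mem x hx =>
    obtain ⟨w, rfl⟩ := hx
    exact T w
  | zero => exact zero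
  | add x y _ _ hx hy => exact add x y hx hy
  | smul c x _ hx => exact smul c x hx

end HeckeBasis

/-! ### Laurent polynomials in q, their degree filtration, and the bar involution on them. -/

section Coefficients

lemma q_ne_zero : q ≠ 0 := by
  intro h
  have h1 : (algebraMap ℤ[T;T⁻¹] Coeff) (LaurentPolynomial.T 1)
      = algebraMap ℤ[T;T⁻¹] Coeff 0 := by rw [map_zero]; exact h
  have h2 := IsFractionRing.injective ℤ[T;T⁻¹] Coeff h1
  have h3 := (LaurentPolynomial.isUnit_T (R := ℤ) 1).ne_zero
  exact h3 h2

lemma coeffBar_q : coeffBar q = q⁻¹ := by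
  have h : coeffBar q = algebraMap ℤ[T;T⁻¹] Coeff (LaurentPolynomial.T (-1)) := by
    rw [coeffBar, q, IsFractionRing.ringEquivOfRingEquiv_algebraMap]
    simp
  rw [h]
  refine eq_inv_of_mul_eq_one_left ?_
  rw [q, ← map_mul, ← LaurentPolynomial.T_add]
  simp

lemma coeffBar_q_inv : coeffBar q⁻¹ = q := by
  rw [map_inv₀, coeffBar_q, inv_inv]

lemma coeffBar_coeffBar (c : Coeff) : coeffBar (coeffBar c) = c := by
  have h : (coeffBar.toRingHom.comp coeffBar.toRingHom) = RingHom.id Coeff := by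
    refine IsLocalization.ringHom_ext (nonZeroDivisors ℤ[T;T⁻¹]) ?_
    refine RingHom.ext fun x => ?_
    change coeffBar (coeffBar (algebraMap ℤ[T;T⁻¹] Coeff x)) = algebraMap ℤ[T;T⁻¹] Coeff x
    rw [coeffBar, IsFractionRing.ringEquivOfRingEquiv_algebraMap,
      IsFractionRing.ringEquivOfRingEquiv_algebraMap]
    congr 1
    exact LaurentPolynomial.invert.symm_apply_apply x
  exact RingHom.congr_fun h c

lemma aeval_q_injective : Function.Injective (Polynomial.aeval (R := ℤ) q) := by
  have h : ∀ p : Polynomial ℤ, Polynomial.aeval q p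
      = algebraMap ℤ[T;T⁻¹] Coeff (Polynomial.toLaurent p) := by
    intro p
    induction p using Polynomial.induction_on' with
    | add p r hp hr => rw [map_add, map_add, map_add, hp, hr]
    | monomial n c =>
      rw [Polynomial.aeval_monomial, ← Polynomial.C_mul_X_pow_eq_monomial,
        Polynomial.toLaurent_C_mul_X_pow, map_mul, q, ← map_pow, LaurentPolynomial.T_pow]
      simp
  intro p r hpr
  rw [h, h] at hpr
  exact Polynomial.toLaurent_injective (IsFractionRing.injective ℤ[T;T⁻¹] Coeff hpr)

lemma coeffBar_aeval (p : Polynomial ℤ) (x : Coeff) :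
    coeffBar (Polynomial.aeval x p) = Polynomial.aeval (coeffBar x) p := by
  rw [Polynomial.aeval_def, Polynomial.aeval_def]
  refine (Polynomial.hom_eval₂ p _ (coeffBar : Coeff →+* Coeff) x).trans ?_
  congr 1
  exact Subsingleton.elim _ _

/-- The Laurent polynomials in `q` of degree at most `d`, that is, `q^d ℤ[q⁻¹]`. -/
def degLE (d : ℤ) : AddSubgroup Coeff where
  carrier := {c | ∃ p : Polynomial ℤ, c = q ^ d * Polynomial.aeval q⁻¹ p}
  zero_mem' := ⟨0, by simp⟩
  add_mem' := by
    rintro _ _ ⟨p, rfl⟩ ⟨r, rfl⟩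
    exact ⟨p + r, by rw [map_add, mul_add]⟩
  neg_mem' := by
    rintro _ ⟨p, rfl⟩
    exact ⟨-p, by rw [map_neg, mul_neg]⟩

lemma mem_degLE {d : ℤ} {c : Coeff} :
    c ∈ degLE d ↔ ∃ p : Polynomial ℤ, c = q ^ d * Polynomial.aeval q⁻¹ p := Iff.rfl

lemma mem_negativePart_iff {c : Coeff} : c ∈ negativePart ↔ c ∈ degLE (-1) := by
  rw [mem_degLE, zpow_neg_one]
  rfl

lemma degLE_mono {d e : ℤ} (h : d ≤ e) : degLE d ≤ degLE e := by
  rintro _ ⟨p, rfl⟩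
  refine ⟨Polynomial.X ^ (e - d).toNat * p, ?_⟩
  rw [map_mul, map_pow, Polynomial.aeval_X, ← mul_assoc]
  congr 1
  rw [inv_pow, ← zpow_natCast, Int.toNat_of_nonneg (by omega), ← zpow_neg, ← zpow_add₀ q_ne_zero]
  congr 1
  ring

lemma mul_mem_degLE {d e : ℤ} {x y : Coeff} (hx : x ∈ degLE d) (hy : y ∈ degLE e) :
    x * y ∈ degLE (d + e) := by
  obtain ⟨p, rfl⟩ := hx
  obtain ⟨r, rfl⟩ := hy
  refine ⟨p * r, ?_⟩
  rw [map_mul, zpow_add₀ q_ne_zero]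
  ring

lemma zpow_mem_degLE (d : ℤ) : q ^ d ∈ degLE d := ⟨1, by simp⟩

lemma intCast_mem_degLE (n : ℤ) : (n : Coeff) ∈ degLE 0 := ⟨Polynomial.C n, by simp⟩

lemma one_mem_degLE : (1 : Coeff) ∈ degLE 0 := by
  simpa using intCast_mem_degLE 1

lemma exists_intCast_sub_mem_degLE {d : ℤ} {c : Coeff} (hc : c ∈ degLE d) :
    ∃ n : ℤ, c - n * q ^ d ∈ degLE (d - 1) := by
  obtain ⟨p, rfl⟩ := hc
  refine ⟨p.coeff 0, p.divX, ?_⟩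
  conv_lhs => rw [← Polynomial.divX_mul_X_add p]
  rw [map_add, map_mul, Polynomial.aeval_X, Polynomial.aeval_C, zpow_sub_one₀ q_ne_zero]
  simp
  ring

/-- The subring `ℤ[q, q⁻¹]` of the coefficient field. -/
def laurentPart : Subring Coeff where
  carrier := {c | ∃ d, c ∈ degLE d}
  zero_mem' := ⟨0, zero_mem _⟩
  one_mem' := ⟨0, one_mem_degLE⟩
  add_mem' := by
    rintro x y ⟨d, hx⟩ ⟨e, hy⟩
    exact ⟨max d e, add_mem (degLE_mono (le_max_left d e) hx) (degLE_mono (le_max_right d e) hy)⟩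
  mul_mem' := by
    rintro x y ⟨d, hx⟩ ⟨e, hy⟩
    exact ⟨d + e, mul_mem_degLE hx hy⟩
  neg_mem' := by
    rintro x ⟨d, hx⟩
    exact ⟨d, neg_mem hx⟩

lemma mem_laurentPart {c : Coeff} : c ∈ laurentPart ↔ ∃ d, c ∈ degLE d := Iff.rfl

lemma zpow_mem_laurentPart (d : ℤ) : q ^ d ∈ laurentPart := ⟨d, zpow_mem_degLE d⟩

lemma q_mem_laurentPart : q ∈ laurentPart := by
  simpa using zpow_mem_laurentPart 1

lemma q_inv_mem_laurentPart : q⁻¹ ∈ laurentPart := by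
  simpa using zpow_mem_laurentPart (-1)

/-- The sets q⁻¹ℤ[q⁻¹] and qℤ[q] meet only in 0. An equality q⁻¹p(q⁻¹) = q p(q), multiplied by
q^{deg p + 1}, says that the reverse of p equals X^{deg p + 2}·p, which degrees exclude for p ≠ 0.
-/
lemma eq_zero_of_coeffBar_eq {c : Coeff} (hc : c ∈ degLE (-1)) (hbar : coeffBar c = c) :
    c = 0 := by
  obtain ⟨p, rfl⟩ := hc
  rw [map_mul, map_zpow₀, coeffBar_q, coeffBar_aeval, coeffBar_q_inv, inv_zpow', neg_neg,
    zpow_one, zpow_neg_one] at hbar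
  have hrev : Polynomial.aeval q p.reverse * q⁻¹ ^ p.natDegree = Polynomial.aeval q⁻¹ p := by
    let _ := invertibleOfNonzero (inv_ne_zero q_ne_zero)
    have := Polynomial.eval₂_reverse_mul_pow (algebraMap ℤ Coeff) q⁻¹ p
    rwa [invOf_eq_inv, inv_inv] at this
  have h1 : Polynomial.aeval q p.reverse
      = Polynomial.aeval q (Polynomial.X ^ (p.natDegree + 2) * p) := by
    rw [map_mul, map_pow, Polynomial.aeval_X]
    have hq := q_ne_zero
    have h2 : q⁻¹ ^ p.natDegree * q ^ p.natDegree = 1 := by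
      rw [← mul_pow, inv_mul_cancel₀ hq, one_pow]
    calc Polynomial.aeval q p.reverse
        = Polynomial.aeval q p.reverse * (q⁻¹ ^ p.natDegree * q ^ p.natDegree) := by
          rw [h2, mul_one]
      _ = q * (q⁻¹ * Polynomial.aeval q⁻¹ p) * q ^ p.natDegree := by
          rw [← mul_assoc, hrev, mul_inv_cancel_left₀ hq]; 
      _ = q ^ (p.natDegree + 2) * Polynomial.aeval q p := by rw [← hbar]; ring
  have h2 := aeval_q_injective h1
  have hp : p = 0 := by
    by_contra hp
    have h3 := congrArg Polynomial.natDegree h2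
    rw [Polynomial.natDegree_mul (pow_ne_zero _ Polynomial.X_ne_zero) hp,
      Polynomial.natDegree_X_pow] at h3
    have := Polynomial.reverse_natDegree_le p
    omega
  rw [hp, map_zero, mul_zero]

/-- Remove the top term k qⁿ by subtracting the bar invariant k(qⁿ + q⁻ⁿ), and lower n. The constant
term is treated apart, because the symmetric expression would count it twice. -/
lemma exists_coeffBar_eq {c : Coeff} (hc : c ∈ laurentPart) :
    ∃ e ∈ laurentPart, coeffBar e = e ∧ c - e ∈ degLE (-1) := by
  obtain ⟨d, hc⟩ := hc
  obtain ⟨n, hn⟩ : ∃ n : ℕ, d ≤ n - 1 := ⟨(d + 1).toNat, by omega⟩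
  replace hc := degLE_mono hn hc
  clear hn
  induction n generalizing c with
  | zero => exact ⟨0, zero_mem _, map_zero _, by simpa using hc⟩
  | succ n ih =>
    obtain ⟨k, hk⟩ := exists_intCast_sub_mem_degLE hc
    by_cases hn : n = 0
    · subst hn
      refine ⟨k, intCast_mem _ k, map_intCast _ k, ?_⟩
      simpa using hk
    · have h1 : c - k * (q ^ (n : ℤ) + q ^ (-(n : ℤ))) ∈ degLE ((n : ℤ) - 1) := by
        have h2 : (k : Coeff) * q ^ (-(n : ℤ)) ∈ degLE ((n : ℤ) - 1) := by
          have := mul_mem_degLE (intCast_mem_degLE k) (zpow_mem_degLE (-(n : ℤ)))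
          exact degLE_mono (by omega) this
        have h3 := sub_mem (degLE_mono (by push_cast; omega) hk : _ ∈ degLE ((n : ℤ) - 1)) h2
        convert h3 using 1
        push_cast
        rw [add_sub_cancel_right]
        ring
      obtain ⟨e, he, hbar, hce⟩ := ih h1
      refine ⟨e + k * (q ^ (n : ℤ) + q ^ (-(n : ℤ))), ?_, ?_, ?_⟩
      · exact add_mem he (mul_mem (intCast_mem _ k)
          (add_mem (zpow_mem_laurentPart _) (zpow_mem_laurentPart _)))
      · rw [map_add, hbar, map_mul, map_intCast, map_add, map_zpow₀, map_zpow₀, coeffBar_q,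
          inv_zpow', inv_zpow', neg_neg, add_comm (q ^ (-(n : ℤ)))]
      · convert hce using 1
        ring

end Coefficients

/-! ### Construction and uniqueness of the bar involution. -/

section Bar

variable {ι V N : Type*} [AddCommGroup V] [Module ℝ V] [AddCommGroup N] [Module ℝ N]
  {R : RootPairing ι ℝ V N} [R.IsCrystallographic] {b : R.Base}

lemma IsBarInvolution.apply_smul {bar : Hecke b ≃+* Hecke b} (hb : IsBarInvolution b bar)
    (c : Coeff) (x : Hecke b) : bar (c • x) = coeffBar c • bar x := by
  rw [Algebra.smul_def, map_mul, hb.map_coeff, ← Algebra.smul_def]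

variable [Fintype ι] [R.IsReduced]

/-- The ring homomorphism from the free algebra underlying the bar involution. -/
lemma exists_free_bar (b : R.Base) : ∃ f : FreeAlgebra Coeff (ExtWeyl R) →+* Hecke b,
    (∀ c, f (algebraMap _ _ c) = algebraMap _ _ (coeffBar c)) ∧
    ∀ w, f (FreeAlgebra.ι Coeff w) = Ring.inverse (T b w⁻¹) := by
  -- With scalars acting through `coeffBar`, an algebra homomorphism is exactly a semilinear ring
  -- homomorphism.
  let A : Algebra Coeff (Hecke b) :=
    ((algebraMap Coeff (Hecke b)).comp (coeffBar : Coeff →+* Coeff)).toAlgebra'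
      fun c x => Algebra.commutes (coeffBar c) x
  refine ⟨(@FreeAlgebra.lift Coeff (ExtWeyl R) _ (Hecke b) _ A
    (fun w => Ring.inverse (T b w⁻¹))).toRingHom, fun c => ?_, fun w => ?_⟩
  · exact @AlgHom.commutes _ _ _ _ _ _ _ A _ c
  · exact @FreeAlgebra.lift_ι_apply Coeff (ExtWeyl R) _ (Hecke b) _ A _ w

lemma T_inverse_simple {s : ExtWeyl R} (hs : IsSimpleReflection b s) :
    Ring.inverse (T b s) = T b s + (q⁻¹ - q) • (1 : Hecke b) :=
  Ring.inverse_unit ⟨_, _, T_simple_mul_inv hs, T_simple_inv_mul hs⟩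

lemma T_inverse_mul (w : ExtWeyl R) : Ring.inverse (T b w) * T b w = 1 :=
  Ring.inverse_mul_cancel _ (isUnit_T b w)

lemma T_mul_inverse (w : ExtWeyl R) : T b w * Ring.inverse (T b w) = 1 :=
  Ring.mul_inverse_cancel _ (isUnit_T b w)

lemma T_inverse_mul_rev {u v : ExtWeyl R} (h : length b (u * v) = length b u + length b v) :
    Ring.inverse (T b v) * Ring.inverse (T b u) = Ring.inverse (T b (u * v)) := by
  rw [← T_mul h]
  refine ((isUnit_T b u).mul (isUnit_T b v)).mul_right_cancel ?_
  rw [Ring.inverse_mul_cancel _ ((isUnit_T b u).mul (isUnit_T b v)), mul_assoc,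
    ← mul_assoc _ (T b u), T_inverse_mul, one_mul, T_inverse_mul]

/-- The bar homomorphism. -/
lemma exists_barHom (b : R.Base) : ∃ f : Hecke b →+* Hecke b,
    (∀ c, f (algebraMap _ _ c) = algebraMap _ _ (coeffBar c)) ∧
    ∀ w, f (T b w) = Ring.inverse (T b w⁻¹) := by
  obtain ⟨f, hf1, hf2⟩ := exists_free_bar b
  have hsmul : ∀ (c : Coeff) x, f (c • x) = coeffBar c • f x := by
    intro c x
    rw [Algebra.smul_def, map_mul, hf1, ← Algebra.smul_def]
  have hrel : ∀ ⦃x y⦄, HeckeRel b x y → f x = f y := by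
    intro x y hxy
    induction hxy with
    | one => rw [hf2, inv_one, T_one, Ring.inverse_one, map_one]
    | mul u v h =>
      rw [map_mul, hf2, hf2, hf2, mul_inv_rev]
      refine T_inverse_mul_rev ?_
      rw [← mul_inv_rev, length_inv, length_inv, length_inv, h, add_comm]
    | quad s w hs h =>
      have hsi : s⁻¹ = s := (lengthSystem b).inv_eq hs
      rw [map_mul, map_add, hsmul, hf2, hf2, hf2, mul_inv_rev, hsi, map_sub, coeffBar_q,
        coeffBar_q_inv]
      have h1 := (lengthSystem b).mul_mul_cancel_right hs w⁻¹
      have h2 : length b (w⁻¹ * s) + 1 = length b w⁻¹ := by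
        have := ((lengthSystem b).lt_iff hs w).1 h
        rw [(lengthSystem b).length_mul_simple hs, inv_inv, length_inv]
        exact this
      have h3 := T_inverse_mul_rev (b := b) (u := w⁻¹ * s) (v := s) (by rw [h1, hs.2, h2])
      rw [h1] at h3
      rw [← h3, ← mul_assoc, T_inverse_simple hs]
      -- The inverse of T_s satisfies the quadratic relation with q and q⁻¹ interchanged, as
      -- semilinearity requires.
      have h4 : (T b s + (q⁻¹ - q) • (1 : Hecke b)) * (T b s + (q⁻¹ - q) • (1 : Hecke b))
          = 1 + (q⁻¹ - q) • (T b s + (q⁻¹ - q) • (1 : Hecke b)) := by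
        conv_lhs => rw [mul_add]
        rw [T_simple_inv_mul hs, mul_smul_comm, mul_one]
      rw [h4, add_mul, one_mul, smul_mul_assoc, add_comm]
  refine ⟨RingQuot.lift ⟨f, hrel⟩, fun c => ?_, fun w => ?_⟩
  · rw [← hf1, ← (RingQuot.mkAlgHom Coeff (HeckeRel b)).commutes]
    rw [← AlgHom.coe_toRingHom, RingQuot.mkAlgHom_coe, RingQuot.lift_mkRingHom_apply]
  · rw [← hf2, T, ← AlgHom.coe_toRingHom, RingQuot.mkAlgHom_coe, RingQuot.lift_mkRingHom_apply]

theorem exists_isBarInvolution (b : R.Base) :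
    ∃ bar : Hecke b ≃+* Hecke b, IsBarInvolution b bar := by
  obtain ⟨f, hf1, hf2⟩ := exists_barHom b
  have hsmul : ∀ (c : Coeff) x, f (c • x) = coeffBar c • f x := by
    intro c x
    rw [Algebra.smul_def, map_mul, hf1, ← Algebra.smul_def]
  have hT : ∀ w, f (f (T b w)) = T b w := by
    intro w
    have h1 : f (f (T b w)) * f (T b w⁻¹) = 1 := by
      rw [← map_mul, hf2, T_inverse_mul, map_one]
    have h2 : f (T b w⁻¹) * T b w = 1 := by
      rw [hf2, inv_inv, T_inverse_mul]
    calc f (f (T b w)) = f (f (T b w)) * (f (T b w⁻¹) * T b w) := by rw [h2, mul_one]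
      _ = T b w := by rw [← mul_assoc, h1, one_mul]
  have hff : ∀ x, f (f x) = x := by
    intro x
    induction x using hecke_induction b with
    | T w => exact hT w
    | zero => rw [map_zero, map_zero]
    | add x y hx hy => rw [map_add, map_add, hx, hy]
    | smul c x hx => rw [hsmul, hsmul, coeffBar_coeffBar, hx]
  refine ⟨RingEquiv.ofRingHom f f (RingHom.ext hff) (RingHom.ext hff), hf1, fun w => ?_, fun w => ?_⟩
  · change f (T b w) * T b w⁻¹ = 1
    rw [hf2, T_inverse_mul]
  · change T b w⁻¹ * f (T b w) = 1
    rw [hf2, T_mul_inverse]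

namespace IsBarInvolution

variable {bar : Hecke b ≃+* Hecke b} (hb : IsBarInvolution b bar)
include hb

lemma map_T (w : ExtWeyl R) : bar (T b w) = Ring.inverse (T b w⁻¹) := by
  refine (isUnit_T b w⁻¹).mul_right_cancel ?_
  rw [hb.map_T_mul, T_inverse_mul]

lemma map_T_simple {s : ExtWeyl R} (hs : IsSimpleReflection b s) :
    bar (T b s) = T b s + (q⁻¹ - q) • (1 : Hecke b) := by
  rw [hb.map_T, (lengthSystem b).inv_eq hs, T_inverse_simple hs]

lemma map_T_zero {o : ExtWeyl R} (ho : length b o = 0) : bar (T b o) = T b o := by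
  refine (isUnit_T b o⁻¹).mul_right_cancel ?_
  rw [hb.map_T_mul, T_zero_mul_inv ho]

lemma unique {bar' : Hecke b ≃+* Hecke b} (hb' : IsBarInvolution b bar') (x : Hecke b) :
    bar x = bar' x := by
  induction x using hecke_induction b with
  | T w => rw [hb.map_T, hb'.map_T]
  | zero => rw [map_zero, map_zero]
  | add x y hx hy => rw [map_add, map_add, hx, hy]
  | smul c x hx => rw [hb.apply_smul, hb'.apply_smul, hx]

end IsBarInvolution

end Bar

/-! ### Triangularity of the bar involution. -/

section Lattice

variable {ι V N : Type*} [AddCommGroup V] [Module ℝ V] [AddCommGroup N] [Module ℝ N]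
  {R : RootPairing ι ℝ V N} [R.IsCrystallographic] [Fintype ι] [R.IsReduced] (b : R.Base)

/-- The `ℤ[q, q⁻¹]`-combinations of the `T_y` with `y` in a given set. -/
def heckeLattice (P : Set (ExtWeyl R)) : AddSubgroup (Hecke b) where
  carrier := {x | ∀ y, (heckeBasis b).repr x y ∈ laurentPart ∧
    ((heckeBasis b).repr x y ≠ 0 → y ∈ P)}
  zero_mem' := fun y => by simp [zero_mem]
  add_mem' := by
    intro x z hx hz y
    rw [map_add, Finsupp.add_apply]
    refine ⟨add_mem (hx y).1 (hz y).1, fun h => ?_⟩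
    by_cases h1 : (heckeBasis b).repr x y = 0
    · rw [h1, zero_add] at h
      exact (hz y).2 h
    · exact (hx y).2 h1
  neg_mem' := by
    intro x hx y
    rw [map_neg, Finsupp.neg_apply, neg_ne_zero]
    exact ⟨neg_mem (hx y).1, (hx y).2⟩

variable {b}

lemma smul_mem_heckeLattice {P : Set (ExtWeyl R)} {c : Coeff} (hc : c ∈ laurentPart)
    {x : Hecke b} (hx : x ∈ heckeLattice b P) : c • x ∈ heckeLattice b P := by
  intro y
  rw [map_smul, Finsupp.smul_apply, smul_eq_mul]
  exact ⟨mul_mem hc (hx y).1, fun h => (hx y).2 (right_ne_zero_of_mul h)⟩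

lemma T_mem_heckeLattice {P : Set (ExtWeyl R)} {y : ExtWeyl R} (hy : y ∈ P) :
    T b y ∈ heckeLattice b P := by
  classical
  intro z
  rw [heckeBasis_repr_T, Finsupp.single_apply]
  split_ifs with h
  · exact ⟨one_mem _, fun _ => h ▸ hy⟩
  · exact ⟨zero_mem _, fun h => absurd rfl h⟩

lemma heckeLattice_mono {P P' : Set (ExtWeyl R)} (h : P ⊆ P') {x : Hecke b}
    (hx : x ∈ heckeLattice b P) : x ∈ heckeLattice b P' :=
  fun y => ⟨(hx y).1, fun hy => h ((hx y).2 hy)⟩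

variable (b) in
lemma sum_repr (x : Hecke b) : ((heckeBasis b).repr x).sum (fun y c => c • T b y) = x := by
  have := (heckeBasis b).linearCombination_repr x
  rw [Finsupp.linearCombination_apply] at this
  simpa using this

lemma map_mem_heckeLattice {P P' : Set (ExtWeyl R)} (f : Hecke b →ₗ[Coeff] Hecke b)
    (hf : ∀ y ∈ P, f (T b y) ∈ heckeLattice b P') {x : Hecke b} (hx : x ∈ heckeLattice b P) :
    f x ∈ heckeLattice b P' := by
  rw [← sum_repr b x, Finsupp.sum, map_sum]
  refine sum_mem fun y hy => ?_
  rw [map_smul]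
  exact smul_mem_heckeLattice (hx y).1 (hf y ((hx y).2 (Finsupp.mem_support_iff.1 hy)))

lemma q_sub_mem_laurentPart : q - q⁻¹ ∈ laurentPart :=
  sub_mem q_mem_laurentPart q_inv_mem_laurentPart

lemma T_simple_mul_mem_heckeLattice {P P' : Set (ExtWeyl R)} {s : ExtWeyl R}
    (hs : IsSimpleReflection b s) (h1 : ∀ y ∈ P, y ∈ P') (h2 : ∀ y ∈ P, s * y ∈ P')
    {x : Hecke b} (hx : x ∈ heckeLattice b P) : T b s * x ∈ heckeLattice b P' := by
  refine map_mem_heckeLattice (LinearMap.mulLeft Coeff (T b s)) (fun y hy => ?_) hx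
  rw [LinearMap.mulLeft_apply]
  by_cases h : length b (s * y) < length b y
  · rw [T_quad hs h]
    exact add_mem (smul_mem_heckeLattice q_sub_mem_laurentPart (T_mem_heckeLattice (h1 y hy)))
      (T_mem_heckeLattice (h2 y hy))
  · have := ((lengthSystem b).not_lt_iff hs y).1 h
    rw [T_simple_mul hs (by omega)]
    exact T_mem_heckeLattice (h2 y hy)

lemma repr_of_add {P : Set (ExtWeyl R)} {w y : ExtWeyl R} {r : Hecke b}
    (hr : r ∈ heckeLattice b P) (hy : y ∉ P) :
    (heckeBasis b).repr (T b w + r) y = Finsupp.single w 1 y := by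
  rw [map_add, Finsupp.add_apply, heckeBasis_repr_T]
  have : (heckeBasis b).repr r y = 0 := by
    by_contra h
    exact hy ((hr y).2 h)
  rw [this, add_zero]

lemma IsBarInvolution.map_T_triangular {bar : Hecke b ≃+* Hecke b} (hb : IsBarInvolution b bar)
    (w : ExtWeyl R) : ∃ r ∈ heckeLattice b {y | length b y < length b w},
      bar (T b w) = T b w + r := by
  induction w using length_induction (b := b) with
  | zero o ho => exact ⟨0, zero_mem _, by rw [hb.map_T_zero ho, add_zero]⟩
  | step s w hs h ih =>
    obtain ⟨r, hr, hw⟩ := ih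
    have hξ : q⁻¹ - q ∈ laurentPart := sub_mem q_inv_mem_laurentPart q_mem_laurentPart
    refine ⟨T b s * r + (q⁻¹ - q) • (T b w + r), ?_, ?_⟩
    · refine add_mem (T_simple_mul_mem_heckeLattice hs ?_ ?_ hr) (smul_mem_heckeLattice hξ
        (add_mem (T_mem_heckeLattice ?_) (heckeLattice_mono ?_ hr)))
      · intro y hy
        change length b y < _
        change length b y < _ at hy
        omega
      · intro y hy
        change length b (s * y) < _
        change length b y < _ at hy
        have := (lengthSystem b).step s hs y
        omega
      · change length b w < _
        omega
      · intro y hy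
        change length b y < _
        change length b y < _ at hy
        omega
    · rw [← T_simple_mul hs (by omega), map_mul, hb.map_T_simple hs, hw, add_mul, mul_add,
        smul_mul_assoc, one_mul, add_assoc]

/-- At a longest y in the support, triangularity makes the coefficient bar invariant. Being in
q⁻¹ℤ[q⁻¹], it vanishes. This is the uniqueness principle behind every identification of a
Kazhdan–Lusztig element. -/
lemma IsBarInvolution.eq_zero {bar : Hecke b ≃+* Hecke b} (hb : IsBarInvolution b bar)
    {x : Hecke b} (hx : bar x = x) (hneg : ∀ y, (heckeBasis b).repr x y ∈ degLE (-1)) :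
    x = 0 := by
  classical
  by_contra hne
  have hsupp : ((heckeBasis b).repr x).support.Nonempty := by
    rw [Finsupp.support_nonempty_iff]
    simpa using hne
  obtain ⟨y, hy, hmax⟩ := Finset.exists_max_image _ (length b) hsupp
  apply Finsupp.mem_support_iff.1 hy
  refine eq_zero_of_coeffBar_eq (hneg y) ?_
  have h1 : (heckeBasis b).repr (bar x) y = coeffBar ((heckeBasis b).repr x y) := by
    conv_lhs => rw [← sum_repr b x]
    rw [Finsupp.sum, map_sum, map_sum, Finsupp.finsetSum_apply, Finset.sum_eq_single y]
    · obtain ⟨r, hr, hw⟩ := hb.map_T_triangular y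
      rw [hb.apply_smul, hw, map_smul, Finsupp.smul_apply, repr_of_add hr (by simp)]
      simp
    · intro z hz hzy
      obtain ⟨r, hr, hw⟩ := hb.map_T_triangular z
      rw [hb.apply_smul, hw, map_smul, Finsupp.smul_apply,
        repr_of_add hr (by simpa using hmax z hz), Finsupp.single_apply, if_neg hzy, smul_zero]
    · intro h
      exact absurd hy h
  rw [← h1, hx]

end Lattice

/-! ### Existence and uniqueness of the Kazhdan–Lusztig elements. -/

section KazhdanLusztig

variable {ι V N : Type*} [AddCommGroup V] [Module ℝ V] [AddCommGroup N] [Module ℝ N]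
  {R : RootPairing ι ℝ V N} [R.IsCrystallographic] [Fintype ι] [R.IsReduced] {b : R.Base}

/-- The elements `s_{i_1} ⋯ s_{i_k} o` for the subwords of a word `s_1 ⋯ s_p`. -/
def subwords (l : List (ExtWeyl R)) (o : ExtWeyl R) : Set (ExtWeyl R) :=
  {y | ∃ l' : List (ExtWeyl R), l'.Sublist l ∧ y = l'.prod * o}

/-- The product of the elements `T_s + q⁻¹` along a word. -/
def wordProd (b : R.Base) (l : List (ExtWeyl R)) (o : ExtWeyl R) : Hecke b :=
  (l.map fun s => T b s + q⁻¹ • (1 : Hecke b)).prod * T b o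

/-- Each factor T_s + q⁻¹ is fixed: bar turns T_s into T_s + q⁻¹ − q and q⁻¹ into q. -/
lemma IsBarInvolution.map_wordProd {bar : Hecke b ≃+* Hecke b} (hb : IsBarInvolution b bar)
    {l : List (ExtWeyl R)} (hl : ∀ s ∈ l, IsSimpleReflection b s) {o : ExtWeyl R}
    (ho : length b o = 0) : bar (wordProd b l o) = wordProd b l o := by
  rw [wordProd, map_mul, hb.map_T_zero ho, map_list_prod, List.map_map]
  congr 2
  refine List.map_congr_left fun s hs => ?_
  rw [Function.comp_apply, map_add, hb.map_T_simple (hl s hs), hb.apply_smul, map_one,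
    coeffBar_q_inv, add_assoc, ← add_smul, sub_add_cancel]

lemma exists_wordProd_eq {l : List (ExtWeyl R)} (hl : ∀ s ∈ l, IsSimpleReflection b s)
    {o : ExtWeyl R} (ho : length b o = 0) (hred : length b l.prod = l.length) :
    ∃ r ∈ heckeLattice b {y | y ∈ subwords l o ∧ length b y < l.length},
      wordProd b l o = T b (l.prod * o) + r := by
  induction l with
  | nil => exact ⟨0, zero_mem _, by simp [wordProd]⟩
  | cons s l ih =>
    have hs := hl s List.mem_cons_self
    have hl' : ∀ s ∈ l, IsSimpleReflection b s := fun t ht => hl t (List.mem_cons_of_mem _ ht)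
    have h1 := (lengthSystem b).length_prod_le hl'
    have h2 := (lengthSystem b).step s hs l.prod
    rw [List.prod_cons, List.length_cons] at hred
    obtain ⟨r, hr, hw⟩ := ih hl' (by omega)
    have hcons : ∀ y ∈ subwords l o, y ∈ subwords (s :: l) o := by
      rintro y ⟨l', hl', rfl⟩
      exact ⟨l', hl'.cons s, rfl⟩
    have hlen : length b (l.prod * o) = l.length := by
      rw [(lengthSystem b).mul_zero ho]; omega
    refine ⟨T b s * r + q⁻¹ • (T b (l.prod * o) + r), add_mem
      (T_simple_mul_mem_heckeLattice hs ?_ ?_ hr) (smul_mem_heckeLattice q_inv_mem_laurentPart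
        (add_mem (T_mem_heckeLattice ?_) (heckeLattice_mono ?_ hr))), ?_⟩
    · rintro y ⟨hy, hy'⟩
      exact ⟨hcons y hy, by rw [List.length_cons]; omega⟩
    · rintro y ⟨⟨l', hl', rfl⟩, hy'⟩
      refine ⟨⟨s :: l', hl'.cons_cons s, by rw [List.prod_cons, mul_assoc]⟩, ?_⟩
      have := (lengthSystem b).step s hs (l'.prod * o)
      rw [List.length_cons]
      omega
    · exact ⟨⟨l, List.sublist_cons_self s l, rfl⟩, by rw [List.length_cons]; omega⟩
    · rintro y ⟨hy, hy'⟩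
      exact ⟨hcons y hy, by rw [List.length_cons]; omega⟩
    · have h3 : wordProd b (s :: l) o = (T b s + q⁻¹ • (1 : Hecke b)) * wordProd b l o := by
        rw [wordProd, List.map_cons, List.prod_cons, mul_assoc, wordProd]
      rw [h3, hw, add_mul, mul_add, smul_mul_assoc, one_mul, List.prod_cons, mul_assoc s,
        ← T_simple_mul (w := l.prod * o) hs, add_assoc]
      rw [hlen, ← mul_assoc, (lengthSystem b).mul_zero ho]
      omega

lemma bruhatLE_of_mem_subwords {l : List (ExtWeyl R)} {o w y : ExtWeyl R}
    (hw : IsReducedWord b w l o) (hy : y ∈ subwords l o) : BruhatLE b y w := by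
  obtain ⟨hl, ho, he, hlen⟩ := hw
  obtain ⟨l', hsub, rfl⟩ := hy
  have hl' : ∀ s ∈ l', IsSimpleReflection b s := fun s hs => hl s (hsub.subset hs)
  obtain ⟨l'', hsub', hp, hlen'⟩ := (lengthSystem b).exists_reduced_sublist hl'
  refine ⟨l'', l, o, ⟨fun s hs => hl' s (hsub'.subset hs), ho, by rw [hp], ?_⟩,
    ⟨hl, ho, he, hlen⟩, hsub'.trans hsub⟩
  rw [hlen', (lengthSystem b).mul_zero ho]

/-- These are the correction terms for the Kazhdan–Lusztig algorithm. Keeping them inside the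
subwords of one fixed word preserves the Bruhat condition. -/
lemma exists_bar_invariant_of_mem_subwords {bar : Hecke b ≃+* Hecke b}
    (hb : IsBarInvolution b bar) {l : List (ExtWeyl R)} {o y : ExtWeyl R}
    (hl : ∀ s ∈ l, IsSimpleReflection b s) (ho : length b o = 0) (hy : y ∈ subwords l o) :
    ∃ r ∈ heckeLattice b {z | z ∈ subwords l o ∧ length b z < length b y},
      bar (T b y + r) = T b y + r := by
  obtain ⟨l', hsub, rfl⟩ := hy
  have hl' : ∀ s ∈ l', IsSimpleReflection b s := fun s hs => hl s (hsub.subset hs)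
  obtain ⟨l'', hsub', hp, hlen'⟩ := (lengthSystem b).exists_reduced_sublist hl'
  have hl'' : ∀ s ∈ l'', IsSimpleReflection b s := fun s hs => hl' s (hsub'.subset hs)
  obtain ⟨r, hr, hw⟩ := exists_wordProd_eq hl'' ho (by rw [hp, hlen'])
  have hbar := hb.map_wordProd hl'' ho
  rw [hw, hp] at hbar
  refine ⟨r, heckeLattice_mono ?_ hr, hbar⟩
  rintro z ⟨⟨m, hm, rfl⟩, hz⟩
  refine ⟨⟨m, hm.trans (hsub'.trans hsub), rfl⟩, ?_⟩
  rw [(lengthSystem b).mul_zero ho l'.prod, ← hlen']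
  exact hz

/-- Coefficients are corrected downwards in length. The step treats the y of length ℓ(n) − j − 1: it
subtracts the bar invariant part of the coefficient at y times a bar invariant element with leading
term T_y, which leaves the coefficients at other elements of at least that length unchanged. -/
lemma exists_partial_kl {bar : Hecke b ≃+* Hecke b} (hb : IsBarInvolution b bar)
    {l : List (ExtWeyl R)} {o n : ExtWeyl R} (hn : IsReducedWord b n l o) (j : ℕ) :
    ∃ r ∈ heckeLattice b {y | y ∈ subwords l o ∧ length b y < length b n},
      bar (T b n + r) = T b n + r ∧
      ∀ y, length b n ≤ length b y + j → (heckeBasis b).repr r y ∈ degLE (-1) := by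
  classical
  obtain ⟨hl, ho, he, hlen⟩ := hn
  induction j with
  | zero =>
    obtain ⟨r, hr, hbar⟩ := exists_bar_invariant_of_mem_subwords hb hl ho
      (y := n) ⟨l, List.Sublist.refl _, he⟩
    refine ⟨r, hr, hbar, fun y hy => ?_⟩
    have : (heckeBasis b).repr r y = 0 := by
      by_contra h
      have := ((hr y).2 h).2
      omega
    rw [this]
    exact zero_mem _
  | succ j ih =>
    obtain ⟨r, hr, hbar, hneg⟩ := ih
    have key : ∀ y ∈ subwords l o, ∃ c ∈ heckeLattice b {z | z ∈ subwords l o ∧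
        length b z < length b y}, bar (T b y + c) = T b y + c := fun y hy =>
      exists_bar_invariant_of_mem_subwords hb hl ho hy
    choose! c hc hcbar using key
    choose e he1 he2 he3 using fun y => exists_coeffBar_eq (hr y).1
    set F := ((heckeBasis b).repr r).support.filter fun y => length b y + j + 1 = length b n with hF
    have hFmem : ∀ y ∈ F, y ∈ subwords l o ∧ length b y + j + 1 = length b n := by
      intro y hy
      rw [hF, Finset.mem_filter, Finsupp.mem_support_iff] at hy
      exact ⟨((hr y).2 hy.1).1, hy.2⟩
    refine ⟨r + ∑ y ∈ F, (-e y) • (T b y + c y), add_mem hr (sum_mem fun y hy => ?_), ?_, ?_⟩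
    · obtain ⟨h1, h2⟩ := hFmem y hy
      refine smul_mem_heckeLattice (neg_mem (he1 y)) (add_mem (T_mem_heckeLattice ⟨h1, by omega⟩)
        (heckeLattice_mono ?_ (hc y h1)))
      rintro z ⟨hz1, hz2⟩
      exact ⟨hz1, by omega⟩
    · rw [← add_assoc, map_add, hbar, map_sum]
      congr 1
      refine Finset.sum_congr rfl fun y hy => ?_
      rw [hb.apply_smul, hcbar y (hFmem y hy).1, map_neg, he2]
    · intro z hz
      rw [map_add, Finsupp.add_apply, map_sum, Finsupp.finsetSum_apply]
      have hterm : ∀ y ∈ F, (heckeBasis b).repr ((-e y) • (T b y + c y)) z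
          = if y = z then -e y else 0 := by
        intro y hy
        obtain ⟨h1, h2⟩ := hFmem y hy
        rw [map_smul, Finsupp.smul_apply, repr_of_add (hc y h1) (by
          rintro ⟨_, h3⟩
          omega), Finsupp.single_apply]
        split_ifs <;> simp
      rw [Finset.sum_congr rfl hterm, Finset.sum_ite_eq']
      split_ifs with h
      · rw [← sub_eq_add_neg]
        exact he3 z
      · rw [add_zero]
        by_cases h0 : (heckeBasis b).repr r z = 0
        · rw [h0]; exact zero_mem _
        · refine hneg z ?_
          by_contra h3
          apply h
          rw [hF, Finset.mem_filter, Finsupp.mem_support_iff]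
          exact ⟨h0, by omega⟩

theorem exists_isKazhdanLusztig (b : R.Base) (n : ExtWeyl R) : ∃ C, IsKazhdanLusztig b n C := by
  obtain ⟨bar, hb⟩ := exists_isBarInvolution b
  obtain ⟨l, o, hl, ho, he, hlen⟩ := (lengthSystem b).exists_word n
  have hn : IsReducedWord b n l o := ⟨hl, ho, he, hlen⟩
  obtain ⟨r, hr, hbar, hneg⟩ := exists_partial_kl hb hn (length b n)
  refine ⟨T b n + r, ⟨bar, hb, hbar⟩, (heckeBasis b).repr (T b n + r), (sum_repr b _).symm, ?_, ?_⟩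
  · rw [repr_of_add hr (fun h => lt_irrefl _ h.2), Finsupp.single_eq_same]
  · intro y hy hyn
    have h1 : (heckeBasis b).repr (T b n + r) y = (heckeBasis b).repr r y := by
      rw [map_add, Finsupp.add_apply, heckeBasis_repr_T, Finsupp.single_eq_of_ne hyn, zero_add]
    rw [h1] at hy ⊢
    exact ⟨bruhatLE_of_mem_subwords hn ((hr y).2 hy).1,
      mem_negativePart_iff.2 (hneg y (by omega))⟩

lemma IsKazhdanLusztig.repr_mem {n : ExtWeyl R} {C : Hecke b} (hC : IsKazhdanLusztig b n C) :
    (heckeBasis b).repr C n = 1 ∧ ∀ y, y ≠ n → (heckeBasis b).repr C y ∈ degLE (-1) := by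
  obtain ⟨-, p, rfl, h1, h2⟩ := hC
  have hp : (heckeBasis b).repr (p.sum fun y c => c • T b y) = p := by
    rw [Finsupp.sum, map_sum]
    simp_rw [map_smul, heckeBasis_repr_T, Finsupp.smul_single, smul_eq_mul, mul_one]
    exact Finsupp.sum_single p
  rw [hp]
  refine ⟨h1, fun y hy => ?_⟩
  by_cases h0 : p y = 0
  · rw [h0]; exact zero_mem _
  · exact mem_negativePart_iff.1 (h2 y h0 hy).2

lemma eq_of_bar_eq {bar : Hecke b ≃+* Hecke b} (hb : IsBarInvolution b bar) {n : ExtWeyl R}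
    {C C' : Hecke b} (hC : bar C = C) (hC' : bar C' = C')
    (h : (heckeBasis b).repr C n = 1 ∧ ∀ y, y ≠ n → (heckeBasis b).repr C y ∈ degLE (-1))
    (h' : (heckeBasis b).repr C' n = 1 ∧ ∀ y, y ≠ n → (heckeBasis b).repr C' y ∈ degLE (-1)) :
    C = C' := by
  have hz : C + (-1 : Coeff) • C' = 0 := by
    refine hb.eq_zero ?_ fun y => ?_
    · rw [map_add, hb.apply_smul, hC, hC', map_neg, map_one]
    · rw [map_add, Finsupp.add_apply, map_smul, Finsupp.smul_apply, smul_eq_mul, neg_one_mul]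
      by_cases hy : y = n
      · rw [hy, h.1, h'.1, add_neg_cancel]
        exact zero_mem _
      · exact add_mem (h.2 y hy) (neg_mem (h'.2 y hy))
  calc C = C + (-1 : Coeff) • C' + (1 : Coeff) • C' := by
        rw [add_assoc, ← add_smul, neg_add_cancel, zero_smul, add_zero]
    _ = C' := by rw [hz, zero_add, one_smul]

/-- Bar invariance and the degree condition on the coefficients determine `C'_n`, the
condition on the support being automatic. -/
theorem isKazhdanLusztig_iff {bar : Hecke b ≃+* Hecke b} (hb : IsBarInvolution b bar)
    {n : ExtWeyl R} {C' : Hecke b} (hC' : bar C' = C')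
    (h' : (heckeBasis b).repr C' n = 1 ∧ ∀ y, y ≠ n → (heckeBasis b).repr C' y ∈ degLE (-1))
    (C : Hecke b) : IsKazhdanLusztig b n C ↔ C = C' := by
  have key : ∀ C, IsKazhdanLusztig b n C → C = C' := by
    intro C hC
    obtain ⟨bar', hb', hbar'⟩ := hC.1
    rw [← hb.unique hb'] at hbar'
    exact eq_of_bar_eq hb hbar' hC' hC.repr_mem h'
  refine ⟨key C, ?_⟩
  rintro rfl
  obtain ⟨C, hC⟩ := exists_isKazhdanLusztig b n
  rwa [← key C hC]

end KazhdanLusztig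

/-! ### The finite Weyl group inside the extended affine one. -/

section WeylGroup

variable {ι V N : Type*} [AddCommGroup V] [Module ℝ V] [AddCommGroup N] [Module ℝ N]
  {R : RootPairing ι ℝ V N}

/-- The action of the Weyl group on the indices of the roots. -/
abbrev wIdx (w : R.weylGroup) (i : ι) : ι := R.weylGroupToPerm w i

/-- The reflection in the `i`-th root. -/
abbrev sRefl (R : RootPairing ι ℝ V N) (i : ι) : R.weylGroup := RootPairing.weylGroup.ofIdx R i

lemma wIdx_mul (u v : R.weylGroup) (i : ι) : wIdx (u * v) i = wIdx u (wIdx v i) := by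
  rw [wIdx, map_mul]; rfl

lemma wIdx_one (i : ι) : wIdx (1 : R.weylGroup) i = i := by
  rw [wIdx, map_one]; rfl

lemma wIdx_apply_inv (u : R.weylGroup) (i : ι) : wIdx u (wIdx u⁻¹ i) = i := by
  rw [← wIdx_mul, mul_inv_cancel, wIdx_one]

lemma wIdx_sRefl (i j : ι) : wIdx (sRefl R i) j = R.reflectionPerm i j := by
  simp [wIdx, sRefl, RootPairing.weylGroup.ofIdx]

variable [R.IsCrystallographic]

lemma ofWeyl_injective : Function.Injective (ofWeyl : R.weylGroup → ExtWeyl R) :=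
  SemidirectProduct.inr_injective

lemma ofWeyl_mul (u v : R.weylGroup) : ofWeyl (u * v) = ofWeyl u * ofWeyl v :=
  map_mul _ _ _

lemma ofWeyl_one : ofWeyl (1 : R.weylGroup) = 1 := map_one _

lemma ofWeyl_inv (u : R.weylGroup) : ofWeyl u⁻¹ = (ofWeyl u)⁻¹ := map_inv _ _

lemma translation_add (lam mu : weightLattice R) :
    translation (lam + mu) = translation lam * translation mu := by
  rw [translation, ofAdd_add, map_mul]; rfl

lemma translation_zero : translation (0 : weightLattice R) = 1 := map_one _

lemma ofWeyl_mul_translation (w : R.weylGroup) (lam : weightLattice R) :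
    ofWeyl w * translation lam = translation (w • lam) * ofWeyl w := by
  apply affAct_injective
  funext x
  rw [affAct_mul, affAct_mul, affAct_translation, affAct_translation, affAct_ofWeyl, affAct_ofWeyl,
    smul_add]
  rfl

lemma translation_mul_ofWeyl_left (lam : weightLattice R) (w : R.weylGroup) :
    (translation lam * ofWeyl w).left = Multiplicative.ofAdd lam := by
  simp [translation, ofWeyl]

lemma translation_mul_ofWeyl_right (lam : weightLattice R) (w : R.weylGroup) :
    (translation lam * ofWeyl w).right = w := by
  simp [translation, ofWeyl]

lemma translation_mul_ofWeyl_injective {lam mu : weightLattice R} {u w : R.weylGroup}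
    (h : translation lam * ofWeyl u = translation mu * ofWeyl w) : lam = mu ∧ u = w := by
  have h1 := congrArg SemidirectProduct.left h
  have h2 := congrArg SemidirectProduct.right h
  rw [translation_mul_ofWeyl_left, translation_mul_ofWeyl_left] at h1
  rw [translation_mul_ofWeyl_right, translation_mul_ofWeyl_right] at h2
  exact ⟨Multiplicative.ofAdd.injective h1, h2⟩

lemma affRootAct_ofWeyl (w : R.weylGroup) (p : ι × ℤ) :
    affRootAct (ofWeyl w) p = (wIdx w p.1, p.2) := by
  apply affEval_injective R
  funext x
  rw [affEval_act', ← ofWeyl_inv, affAct_ofWeyl, affEval, affEval,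
    ← coroot'_weyl_smul w p.1 (w⁻¹ • x), smul_inv_smul]

lemma affReflection_zero (i : ι) : affReflection R i 0 = ofWeyl (sRefl R i) := by
  rw [affReflection, zero_smul, translation_zero, one_mul]

lemma sRefl_wIdx (w : R.weylGroup) (i : ι) : sRefl R (wIdx w i) = w * sRefl R i * w⁻¹ := by
  apply ofWeyl_injective
  have := affReflection_act (ofWeyl w) (i, (0 : ℤ))
  rw [affRootAct_ofWeyl, affReflection_zero, affReflection_zero] at this
  rw [this, ofWeyl_mul, ofWeyl_mul, ofWeyl_inv]

lemma sRefl_mul_self (i : ι) : sRefl R i * sRefl R i = 1 := by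
  apply ofWeyl_injective
  rw [ofWeyl_mul, ← affReflection_zero, affReflection_mul_self (i, (0 : ℤ)), ofWeyl_one]

lemma sRefl_inv (i : ι) : (sRefl R i)⁻¹ = sRefl R i :=
  inv_eq_of_mul_eq_one_right (sRefl_mul_self i)

lemma sRefl_smul (i : ι) (lam : weightLattice R) :
    sRefl R i • lam = lam - zpair lam i • rootWeight R i := by
  apply Subtype.ext
  rw [coe_weyl_smul, RootPairing.weylGroup.ofIdx_smul, RootPairing.Equiv.reflection_smul,
    RootPairing.reflection_apply, AddSubgroup.coe_sub, AddSubgroup.coe_zsmul, ← coe_zpair,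
    Int.cast_smul_eq_zsmul]
  rfl

lemma zpair_rootWeight_self (i : ι) : zpair (rootWeight R i) i = 2 := by
  have : ((zpair (rootWeight R i) i : ℤ) : ℝ) = ((2 : ℤ) : ℝ) := by
    rw [coe_zpair, rootWeight, R.root_coroot'_eq_pairing, R.pairing_same]
    norm_num
  exact_mod_cast this

variable [Fintype ι] [R.IsReduced] (b : R.Base)

lemma affPos_zero (i : ι) : AffPos b (i, (0 : ℤ)) ↔ b.IsPos i := by
  simp [AffPos]

variable {b}

lemma affSimple_of_mem_support {i : ι} (hi : i ∈ b.support) : AffSimple b (i, (0 : ℤ)) := by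
  refine ⟨(affPos_zero b i).2 (b.isPos_of_mem_support hi), ?_⟩
  rintro ⟨j, k⟩ hp hne
  rw [affReflection_zero, affRootAct_ofWeyl]
  rcases hp with ⟨h1, h2⟩ | ⟨h1, h2⟩
  · by_cases hk : k < 0
    · by_cases hj : b.IsPos (wIdx (sRefl R i) j)
      · exact Or.inl ⟨hj, h2⟩
      · exact Or.inr ⟨hj, hk⟩
    · have hk0 : k = 0 := by
        have : k ≤ 0 := h2
        omega
      subst hk0
      refine Or.inl ⟨?_, le_refl _⟩
      change b.IsPos (wIdx (sRefl R i) j)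
      rw [wIdx_sRefl]
      exact h1.reflectionPerm hi fun h => hne (Prod.ext h rfl)
  · by_cases hj : b.IsPos (wIdx (sRefl R i) j)
    · exact Or.inl ⟨hj, h2.le⟩
    · exact Or.inr ⟨hj, h2⟩

lemma isSimpleReflection_sRefl {i : ι} (hi : i ∈ b.support) :
    IsSimpleReflection b (ofWeyl (sRefl R i)) := by
  rw [← affReflection_zero]
  exact (affSimple_of_mem_support hi).isSimpleReflection

lemma length_sRefl_mul_lt_iff {i : ι} (hi : i ∈ b.support) (g : ExtWeyl R) :
    length b (ofWeyl (sRefl R i) * g) < length b g ↔ ¬ AffPos b (affRootAct g⁻¹ (i, 0)) := by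
  rw [← affReflection_zero]
  exact (affSimple_of_mem_support hi).length_mul_lt_iff g

variable (b)

/-- Every root is obtained from a simple one by simple reflections, and the reflection in s_j(α) is
s_j s_α s_j; so simple reflections generate W. -/
lemma exists_simple_word (w : R.weylGroup) : ∃ l : List ι, (∀ i ∈ l, i ∈ b.support) ∧
    w = (l.map (sRefl R)).prod := by
  have key : ∀ i, ∃ l : List ι, (∀ i ∈ l, i ∈ b.support) ∧
      sRefl R i = (l.map (sRefl R)).prod := by
    intro i
    refine RootPairing.Base.induction_reflect (b := b) i (p := fun i => ∃ l : List ι,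
      (∀ i ∈ l, i ∈ b.support) ∧ sRefl R i = (l.map (sRefl R)).prod) ?_ ?_ ?_
    · rintro i ⟨l, hl, h⟩
      refine ⟨l, hl, ?_⟩
      rw [← h, ← wIdx_sRefl, sRefl_wIdx, mul_inv_cancel_right]
    · intro i hi
      exact ⟨[i], by simpa using hi, by simp⟩
    · rintro i j ⟨l, hl, h⟩ hj
      refine ⟨j :: l ++ [j], ?_, ?_⟩
      · intro k hk
        simp only [List.mem_append, List.mem_cons, List.not_mem_nil, or_false] at hk
        rcases hk with (rfl | hk) | rfl
        · exact hj
        · exact hl k hk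
        · exact hj
      · rw [← wIdx_sRefl, sRefl_wIdx, h, sRefl_inv]
        simp [mul_assoc]
  obtain ⟨g, hg⟩ := w
  induction hg using RootPairing.weylGroup.induction with
  | mem i => exact key i
  | one => exact ⟨[], by simp, by simp⟩
  | mul x y hx hy ihx ihy =>
    obtain ⟨l, hl, h⟩ := ihx
    obtain ⟨l', hl', h'⟩ := ihy
    refine ⟨l ++ l', ?_, ?_⟩
    · intro i hi
      rcases List.mem_append.1 hi with hi | hi
      · exact hl i hi
      · exact hl' i hi
    · rw [List.map_append, List.prod_append, ← h, ← h']
      rfl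

/-- The deletion property only removes letters, so a reduced word found by it still consists of
finite simple reflections. Thus affine length restricted to W is the usual length. -/
lemma exists_reduced_simple_word (w : R.weylGroup) : ∃ l : List ι, (∀ i ∈ l, i ∈ b.support) ∧
    w = (l.map (sRefl R)).prod ∧ l.length = length b (ofWeyl w) := by
  obtain ⟨l, hl, h⟩ := exists_simple_word b w
  have hprod : ∀ l : List ι, ofWeyl (l.map (sRefl R)).prod
      = (l.map fun i => ofWeyl (sRefl R i)).prod := by
    intro l
    induction l with
    | nil => simp [ofWeyl_one]
    | cons i l ih => simp [ofWeyl_mul, ih]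
  have hS : ∀ s ∈ l.map (fun i => ofWeyl (sRefl R i)), s ∈ {s | IsSimpleReflection b s} := by
    intro s hs
    obtain ⟨i, hi, rfl⟩ := List.mem_map.1 hs
    exact isSimpleReflection_sRefl (hl i hi)
  obtain ⟨m, hsub, hp, hlen⟩ := (lengthSystem b).exists_reduced_sublist hS
  obtain ⟨l', hsub', rfl⟩ := List.sublist_map_iff.1 hsub
  refine ⟨l', fun i hi => hl i (hsub'.subset hi), ?_, ?_⟩
  · apply ofWeyl_injective
    rw [hprod, hp, h, hprod]
  · rw [List.length_map] at hlen
    rw [hlen, h, hprod]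

lemma exists_left_descent {w : R.weylGroup} (hw : w ≠ 1) :
    ∃ i ∈ b.support, length b (ofWeyl (sRefl R i * w)) + 1 = length b (ofWeyl w) := by
  obtain ⟨l, hl, h, hlen⟩ := exists_reduced_simple_word b w
  cases l with
  | nil => simp at h; exact absurd h hw
  | cons i l =>
    have hi := hl i List.mem_cons_self
    refine ⟨i, hi, ?_⟩
    rw [ofWeyl_mul]
    refine ((lengthSystem b).lt_iff (isSimpleReflection_sRefl hi) _).1 ?_
    have h1 : sRefl R i * w = (l.map (sRefl R)).prod := by
      rw [h, List.map_cons, List.prod_cons, ← mul_assoc, sRefl_mul_self, one_mul]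
    rw [← ofWeyl_mul, h1, ← hlen, List.length_cons, Nat.lt_succ_iff]
    clear h1 h hlen
    have hl' : ∀ j ∈ l, j ∈ b.support := fun j hj => hl j (List.mem_cons_of_mem _ hj)
    clear hl
    induction l with
    | nil => simp [ofWeyl_one, length_one]
    | cons j l ih =>
      have h2 := ih fun k hk => hl' k (List.mem_cons_of_mem _ hk)
      rw [List.map_cons, List.prod_cons, ofWeyl_mul, List.length_cons]
      have := (lengthSystem b).step _ (isSimpleReflection_sRefl (hl' j List.mem_cons_self))
        (ofWeyl (l.map (sRefl R)).prod)
      omega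

lemma exists_right_descent {w : R.weylGroup} (hw : w ≠ 1) :
    ∃ i ∈ b.support, length b (ofWeyl (w * sRefl R i)) + 1 = length b (ofWeyl w) := by
  obtain ⟨i, hi, h⟩ := exists_left_descent b (w := w⁻¹) (by simpa using hw)
  refine ⟨i, hi, ?_⟩
  rw [ofWeyl_inv, length_inv, ← length_inv, ← ofWeyl_inv, mul_inv_rev, inv_inv, sRefl_inv] at h
  exact h

/-- Induction over the Weyl group along left multiplication by simple reflections. -/
lemma weyl_induction {P : R.weylGroup → Prop} (one : P 1)
    (step : ∀ i w, i ∈ b.support →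
      length b (ofWeyl (sRefl R i * w)) = length b (ofWeyl w) + 1 → P w → P (sRefl R i * w))
    (w : R.weylGroup) : P w := by
  induction hn : length b (ofWeyl w) using Nat.strong_induction_on generalizing w with
  | _ n ih =>
    by_cases hw : w = 1
    · rw [hw]; exact one
    · obtain ⟨i, hi, h⟩ := exists_left_descent b hw
      have h1 : sRefl R i * (sRefl R i * w) = w := by
        rw [← mul_assoc, sRefl_mul_self, one_mul]
      have := step i (sRefl R i * w) hi (by rw [h1, h]) (ih _ (by omega) _ rfl)
      rwa [h1] at this

lemma length_ofWeyl_eq_zero_iff {w : R.weylGroup} : length b (ofWeyl w) = 0 ↔ w = 1 := by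
  constructor
  · intro h
    by_contra hw
    obtain ⟨i, hi, h'⟩ := exists_left_descent b hw
    omega
  · rintro rfl
    rw [ofWeyl_one, length_one]

lemma length_sRefl_mul_ofWeyl_lt_iff {i : ι} (hi : i ∈ b.support) (w : R.weylGroup) :
    length b (ofWeyl (sRefl R i * w)) < length b (ofWeyl w) ↔ ¬ b.IsPos (wIdx w⁻¹ i) := by
  rw [ofWeyl_mul, length_sRefl_mul_lt_iff hi, ← ofWeyl_inv, affRootAct_ofWeyl, affPos_zero]

lemma length_ofWeyl_mul_sRefl_lt_iff {i : ι} (hi : i ∈ b.support) (w : R.weylGroup) :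
    length b (ofWeyl (w * sRefl R i)) < length b (ofWeyl w) ↔ ¬ b.IsPos (wIdx w i) := by
  have := length_sRefl_mul_ofWeyl_lt_iff b hi w⁻¹
  rwa [inv_inv, ofWeyl_inv w, length_inv, ← length_inv, ← ofWeyl_inv, mul_inv_rev, inv_inv,
    sRefl_inv] at this

/-! ### The Iwahori–Matsumoto length formula. -/

section LengthFormula

open Classical in
lemma length_eq_sum_aux (g : ExtWeyl R) : length b g = ∑ i ∈ posRoots b,
    (zpair (Multiplicative.toAdd g.left) (wIdx g.right i) +
      if b.IsPos (wIdx g.right i) then 0 else 1).natAbs := by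
  set m : ι → ℤ := fun i => -(zpair (Multiplicative.toAdd g.left) (wIdx g.right i) +
      if b.IsPos (wIdx g.right i) then 0 else 1) with hm
  -- For a fixed positive root the separating k form a half-open interval between 0 and m i. The
  -- shift by 1 in m i occurs when the root becomes negative, because level 0 is then no longer
  -- positive.
  have hset : inversions b g = ((posRoots b).sigma fun i =>
      Finset.Ioc (min 0 (m i)) (max 0 (m i))).map
        ((Equiv.sigmaEquivProd ι ℤ).toEmbedding) := by
    ext ⟨i, k⟩
    rw [mem_inversions_iff]
    simp only [Finset.coe_map, Set.mem_image, Finset.mem_coe, Finset.mem_sigma, mem_posRoots,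
      Equiv.coe_toEmbedding, Sigma.exists, Equiv.sigmaEquivProd_apply, Prod.mk.injEq,
      exists_eq_right_right, Finset.mem_Ioc]
    have h1 : b.IsPos i → ((AffPos b (i, k) ↔ ¬ AffPos b (affRootAct g (i, k))) ↔
        (min 0 (m i) < k ∧ k ≤ max 0 (m i))) := by
      intro hi
      have hg : affRootAct g (i, k) = (wIdx g.right i,
        k + zpair (Multiplicative.toAdd g.left) (wIdx g.right i)) := rfl
      simp only [AffPos, hg, hi, hm, true_and, not_true, false_and, or_false]
      by_cases h : b.IsPos (wIdx g.right i)
      · simp only [h, true_and, not_true, false_and, or_false, if_true]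
        omega
      · simp only [h, false_and, not_false_iff, true_and, false_or, if_false]
        omega
    constructor
    · rintro ⟨hi, h⟩
      exact ⟨i, ⟨hi, (h1 hi).1 h⟩, rfl⟩
    · rintro ⟨j, ⟨hj, h⟩, rfl⟩
      exact ⟨hj, (h1 hj).2 h⟩
  rw [length, hset, Set.ncard_coe_finset, Finset.card_map, Finset.card_sigma]
  refine Finset.sum_congr rfl fun i _ => ?_
  rw [Int.card_Ioc]
  simp only [hm]
  omega

open Classical in
/-- The length of `t_λ w`. -/
lemma length_translation_mul (lam : weightLattice R) (w : R.weylGroup) :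
    length b (translation lam * ofWeyl w) = ∑ i ∈ posRoots b,
      (zpair lam i - if b.IsPos (wIdx w⁻¹ i) then 0 else 1).natAbs := by
  have hinv : (translation lam * ofWeyl w)⁻¹ = translation (w⁻¹ • (-lam)) * ofWeyl w⁻¹ := by
    rw [mul_inv_rev, ← ofWeyl_inv, ← ofWeyl_mul_translation]
    congr 1
    rw [inv_eq_iff_mul_eq_one, ← translation_add, add_neg_cancel, translation_zero]
  rw [← length_inv, hinv, length_eq_sum_aux]
  refine Finset.sum_congr rfl fun i _ => ?_
  rw [translation_mul_ofWeyl_left, translation_mul_ofWeyl_right, toAdd_ofAdd, zpair_smul,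
    zpair_neg]
  split_ifs <;> omega

end LengthFormula

end WeylGroup

/-! ### Dominant weights, fundamental weights and the height function. -/

section Dominance

variable {ι V N : Type*} [AddCommGroup V] [Module ℝ V] [AddCommGroup N] [Module ℝ N]
  {R : RootPairing ι ℝ V N} {b : R.Base}

lemma isDominant_iff {lam : weightLattice R} :
    IsDominant b lam ↔ ∀ i, b.IsPos i → 0 ≤ zpair lam i := by
  refine forall₂_congr fun i _ => ?_
  rw [← coe_zpair]
  exact_mod_cast Iff.rfl

lemma zpair_reflectionPerm_self (lam : weightLattice R) (i : ι) :
    zpair lam (R.reflectionPerm i i) = -zpair lam i := by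
  have : ((zpair lam (R.reflectionPerm i i) : ℤ) : ℝ) = ((-zpair lam i : ℤ) : ℝ) := by
    push_cast
    rw [coe_zpair, coe_zpair, coroot'_reflectionPerm_self]
  exact_mod_cast this

lemma zpair_nsmul (n : ℕ) (lam : weightLattice R) (i : ι) : zpair (n • lam) i = n * zpair lam i := by
  induction n with
  | zero => simp
  | succ n ih => rw [succ_nsmul, zpair_add, ih]; push_cast; ring

lemma zpair_zsmul (n : ℤ) (lam : weightLattice R) (i : ι) : zpair (n • lam) i = n * zpair lam i := by
  rcases Int.eq_nat_or_neg n with ⟨m, rfl | rfl⟩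
  · rw [natCast_zsmul, zpair_nsmul]
  · rw [neg_smul, zpair_neg, natCast_zsmul, zpair_nsmul]; ring

variable [Fintype ι] [R.IsCrystallographic] [R.IsReduced]

lemma coroot_mem_closure {i : ι} (hi : b.IsPos i) :
    R.coroot i ∈ AddSubmonoid.closure (R.coroot '' b.support) := by
  rcases b.coroot_mem_or_neg_mem i with h | h
  · exact h
  · exfalso
    have key : ∀ y ∈ AddSubmonoid.closure (R.coroot '' b.support),
        0 ≤ R.toLinearMap (rhoVec b) y := by
      intro y hy
      induction hy using AddSubmonoid.closure_induction with
      | mem x hx =>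
        obtain ⟨j, hj, rfl⟩ := hx
        have : R.toLinearMap (rhoVec b) (R.coroot j) = 1 := coroot_rhoVec_of_simple b hj
        rw [this]
        exact zero_le_one
      | zero => rw [map_zero]
      | add x y _ _ hx hy => rw [map_add]; exact add_nonneg hx hy
    have h1 := key _ h
    have h2 : 0 < R.toLinearMap (rhoVec b) (R.coroot i) := coroot_rhoVec_pos b hi
    rw [map_neg] at h1
    linarith

lemma isDominant_of_simple {lam : weightLattice R} (h : ∀ i ∈ b.support, 0 ≤ zpair lam i) :
    IsDominant b lam := by
  intro i hi
  change 0 ≤ R.toLinearMap (lam : V) (R.coroot i)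
  have hmem := coroot_mem_closure hi
  generalize R.coroot i = y at hmem
  induction hmem using AddSubmonoid.closure_induction with
  | mem x hx =>
    obtain ⟨j, hj, rfl⟩ := hx
    change 0 ≤ R.coroot' j (lam : V)
    rw [← coe_zpair]
    exact_mod_cast h j hj
  | zero => rw [map_zero]
  | add x y _ _ hx hy => rw [map_add]; exact add_nonneg hx hy

lemma mem_weightLattice_of_simple (b : R.Base) {v : V}
    (h : ∀ j ∈ b.support, ∃ n : ℤ, R.coroot' j v = n) : v ∈ weightLattice R := by
  have key : ∀ y ∈ AddSubmonoid.closure (R.coroot '' b.support),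
      ∃ n : ℤ, R.toLinearMap v y = n := by
    intro y hy
    induction hy using AddSubmonoid.closure_induction with
    | mem x hx =>
      obtain ⟨j, hj, rfl⟩ := hx
      exact h j hj
    | zero => exact ⟨0, by simp⟩
    | add x y _ _ hx hy =>
      obtain ⟨m, hm⟩ := hx
      obtain ⟨n, hn⟩ := hy
      exact ⟨m + n, by rw [map_add, hm, hn]; push_cast; ring⟩
  intro i
  rcases b.coroot_mem_or_neg_mem i with hi | hi
  · exact key _ hi
  · obtain ⟨n, hn⟩ := key _ hi
    refine ⟨-n, ?_⟩
    rw [map_neg] at hn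
    change R.toLinearMap v (R.coroot i) = _
    push_cast
    linarith

/-- Fundamental weights exist. -/
lemma exists_fundamental [R.IsRootSystem] (b : R.Base) {i : ι} (hi : i ∈ b.support) :
    ∃ om : weightLattice R, zpair om i = 1 ∧ ∀ j ∈ b.support, j ≠ i → zpair om j = 0 := by
  classical
  set v : V := R.toPerfPair.symm (b.toCoweightBasis.coord ⟨i, hi⟩) with hv
  have hval : ∀ j (hj : j ∈ b.support), R.coroot' j v = if j = i then 1 else 0 := by
    intro j hj
    have h1 : R.coroot' j v = R.toPerfPair v (R.coroot j) := rfl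
    have h2 : R.coroot j = b.toCoweightBasis ⟨j, hj⟩ := by simp
    rw [h1, hv, LinearEquiv.apply_symm_apply, h2, Module.Basis.coord_apply,
      Module.Basis.repr_self, Finsupp.single_apply]
    simp
  have hmem : v ∈ weightLattice R := mem_weightLattice_of_simple b fun j hj => by
    rw [hval j hj]
    split_ifs
    · exact ⟨1, by simp⟩
    · exact ⟨0, by simp⟩
  refine ⟨⟨v, hmem⟩, ?_, fun j hj hji => ?_⟩
  · simp [zpair, hval i hi]
  · simp [zpair, hval j hj, hji]

variable (b)

lemma zpair_rho {i : ι} (hi : i ∈ b.support) : zpair (rho b) i = 1 := by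
  have : ((zpair (rho b) i : ℤ) : ℝ) = ((1 : ℤ) : ℝ) := by
    rw [coe_zpair]
    simpa [rho] using coroot_rhoVec_of_simple b hi
  exact_mod_cast this

lemma zpair_rho_pos {i : ι} (hi : b.IsPos i) : 0 < zpair (rho b) i := by
  have : (0 : ℝ) < (zpair (rho b) i : ℝ) := by
    rw [coe_zpair]
    exact coroot_rhoVec_pos b hi
  exact_mod_cast this

/-- The pairing of a weight with the sum of the positive coroots. -/
def ht : weightLattice R →+ ℤ where
  toFun lam := ∑ i ∈ posRoots b, zpair lam i
  map_zero' := by simp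
  map_add' x y := by simp only [zpair_add, Finset.sum_add_distrib]

lemma ht_apply (lam : weightLattice R) : ht b lam = ∑ i ∈ posRoots b, zpair lam i := rfl

lemma zpair_sRefl_wIdx (lam : weightLattice R) (i j : ι) :
    zpair (sRefl R i • lam) j = zpair lam (R.reflectionPerm i j) := by
  rw [zpair_smul', sRefl_inv]
  congr 1

lemma reflectionPerm_mem_erase [DecidableEq ι] {i : ι} (hi : i ∈ b.support) {j : ι}
    (hj : j ∈ (posRoots b).erase i) : R.reflectionPerm i j ∈ (posRoots b).erase i := by
  rw [Finset.mem_erase, mem_posRoots] at hj ⊢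
  refine ⟨?_, hj.2.reflectionPerm hi hj.1⟩
  intro h
  have h' := congrArg (R.reflectionPerm i) h
  rw [R.reflectionPerm_self] at h'
  have h3 := hj.2
  rw [h', isPos_reflectionPerm_self] at h3
  exact h3 (b.isPos_of_mem_support hi)

lemma sum_posRoots_erase_reflectionPerm [DecidableEq ι] {M : Type*} [AddCommMonoid M] {i : ι}
    (hi : i ∈ b.support) (f : ι → M) :
    ∑ j ∈ (posRoots b).erase i, f (R.reflectionPerm i j) = ∑ j ∈ (posRoots b).erase i, f j := by
  refine Finset.sum_bij (fun j _ => R.reflectionPerm i j)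
    (fun j hj => reflectionPerm_mem_erase b hi hj) ?_ ?_ (fun _ _ => rfl)
  · intro x _ y _ hxy
    exact (R.reflectionPerm i).injective hxy
  · intro y hy
    exact ⟨R.reflectionPerm i y, reflectionPerm_mem_erase b hi hy, by simp⟩

/-- The simple reflection s_i permutes the positive roots other than α_i and negates α_i. -/
lemma ht_sRefl {i : ι} (hi : i ∈ b.support) (lam : weightLattice R) :
    ht b (sRefl R i • lam) = ht b lam - 2 * zpair lam i := by
  classical
  have hip : i ∈ posRoots b := (mem_posRoots b i).2 (b.isPos_of_mem_support hi)
  rw [ht_apply, ht_apply, ← Finset.add_sum_erase _ _ hip, ← Finset.add_sum_erase _ _ hip]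
  simp_rw [zpair_sRefl_wIdx]
  rw [zpair_reflectionPerm_self, sum_posRoots_erase_reflectionPerm b hi (zpair lam)]
  ring

lemma ht_rootWeight_simple {i : ι} (hi : i ∈ b.support) : ht b (rootWeight R i) = 2 := by
  have h := ht_sRefl b hi (rootWeight R i)
  rw [sRefl_smul, map_sub, map_zsmul, zpair_rootWeight_self, smul_eq_mul] at h
  linarith

lemma ht_rootWeight_pos {i : ι} (hi : b.IsPos i) : 0 < ht b (rootWeight R i) := by
  refine hi.induction_on_add (p := fun k => 0 < ht b (rootWeight R k)) ?_ ?_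
  · intro i hi
    rw [ht_rootWeight_simple b hi]
    norm_num
  · intro i j k hk hi hj
    have : rootWeight R k = rootWeight R i + rootWeight R j := Subtype.ext hk
    rw [this, map_add, ht_rootWeight_simple b hj]
    linarith

/-- Take a point of the orbit of greatest height: a negative pairing with a simple coroot would let
that reflection raise the height. -/
lemma exists_isDominant_smul [R.IsRootSystem] (lam : weightLattice R) :
    ∃ w : R.weylGroup, IsDominant b (w • lam) := by
  obtain ⟨w, -, hw⟩ := Finset.exists_max_image (Finset.univ : Finset R.weylGroup)
    (fun w => ht b (w • lam)) ⟨1, Finset.mem_univ _⟩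
  refine ⟨w, isDominant_of_simple fun i hi => ?_⟩
  have h := hw (sRefl R i * w) (Finset.mem_univ _)
  rw [mul_smul, ht_sRefl b hi] at h
  linarith

variable {b}

/-- For a right descent i of w the root wα_i is negative, so dominance of λ and of wλ forces ⟨λ,
α_i^∨⟩ = 0. Then s_i fixes λ and w can be replaced by the shorter ws_i. -/
lemma smul_eq_of_isDominant {lam : weightLattice R} (h : IsDominant b lam) {w : R.weylGroup}
    (hw : IsDominant b (w • lam)) : w • lam = lam := by
  induction hn : length b (ofWeyl w) using Nat.strong_induction_on generalizing w with
  | _ n ih =>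
    by_cases hw1 : w = 1
    · rw [hw1, one_smul]
    · obtain ⟨i, hi, hlen⟩ := exists_right_descent b hw1
      have hneg : ¬ b.IsPos (wIdx w i) :=
        (length_ofWeyl_mul_sRefl_lt_iff b hi w).1 (by omega)
      have h1 : 0 ≤ zpair lam i := isDominant_iff.1 h i (b.isPos_of_mem_support hi)
      have h2 : 0 ≤ zpair (w • lam) (R.reflectionPerm (wIdx w i) (wIdx w i)) :=
        isDominant_iff.1 hw _ ((isPos_reflectionPerm_self b _).2 hneg)
      rw [zpair_reflectionPerm_self, zpair_smul] at h2
      have h0 : zpair lam i = 0 := by omega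
      have hs : sRefl R i • lam = lam := by rw [sRefl_smul, h0, zero_smul, sub_zero]
      have hws : (w * sRefl R i) • lam = w • lam := by rw [mul_smul, hs]
      rw [← hws]
      exact ih _ (by omega) (by rw [hws]; exact hw) rfl

lemma eq_one_of_isDominant {lam : weightLattice R} (h : ∀ i ∈ b.support, 0 < zpair lam i)
    {w : R.weylGroup} (hw : IsDominant b (w • lam)) : w = 1 := by
  by_contra hw1
  obtain ⟨i, hi, hlen⟩ := exists_right_descent b hw1
  have hneg : ¬ b.IsPos (wIdx w i) := (length_ofWeyl_mul_sRefl_lt_iff b hi w).1 (by omega)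
  have h2 : 0 ≤ zpair (w • lam) (R.reflectionPerm (wIdx w i) (wIdx w i)) :=
    isDominant_iff.1 hw _ ((isPos_reflectionPerm_self b _).2 hneg)
  rw [zpair_reflectionPerm_self, zpair_smul] at h2
  have := h i hi
  omega

lemma sum_univ_eq_two_nsmul {M : Type*} [AddCommMonoid M] (b : R.Base) {f : ι → M}
    (hf : ∀ i, f (R.reflectionPerm i i) = f i) : ∑ i, f i = 2 • ∑ i ∈ posRoots b, f i := by
  classical
  rw [← Finset.sum_filter_add_sum_filter_not Finset.univ (fun i => b.IsPos i), two_nsmul]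
  have h1 : Finset.univ.filter (fun i => b.IsPos i) = posRoots b := by
    ext i; simp [mem_posRoots]
  rw [h1]
  congr 1
  have hinv : ∀ i : ι, R.reflectionPerm (R.reflectionPerm i i) (R.reflectionPerm i i) = i :=
    fun i => by
      have := affNeg_affNeg (R := R) (i, 0)
      exact congrArg Prod.fst this
  refine Finset.sum_bij (fun i _ => R.reflectionPerm i i) ?_ ?_ ?_ ?_
  · intro i hi
    rw [mem_posRoots, isPos_reflectionPerm_self]
    exact (Finset.mem_filter.1 hi).2
  · intro i _ j _ hij
    rw [← hinv i, hij, hinv]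
  · intro i hi
    refine ⟨R.reflectionPerm i i, ?_, hinv i⟩
    rw [Finset.mem_filter, isPos_reflectionPerm_self, not_not]
    exact ⟨Finset.mem_univ _, (mem_posRoots b i).1 hi⟩
  · intro i _
    exact (hf i).symm

lemma sum_posRoots_wIdx (b : R.Base) {f : ι → ℤ}
    (hf : ∀ i, f (R.reflectionPerm i i) = f i) (w : R.weylGroup) :
    ∑ i ∈ posRoots b, f (wIdx w i) = ∑ i ∈ posRoots b, f i := by
  have h1 := sum_univ_eq_two_nsmul b hf
  have h2 := sum_univ_eq_two_nsmul b (f := fun i => f (wIdx w i)) (fun i => by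
    have : wIdx w (R.reflectionPerm i i) = R.reflectionPerm (wIdx w i) (wIdx w i) := by
      rw [← wIdx_sRefl, ← wIdx_mul, ← wIdx_sRefl, sRefl_wIdx, ← wIdx_mul]
      congr 1
      group
    rw [this, hf])
  rw [Equiv.sum_comp (R.weylGroupToPerm w) f, h1] at h2
  simp only [two_nsmul] at h2
  linarith

lemma sum_abs_zpair_smul (b : R.Base) (w : R.weylGroup) (lam : weightLattice R) :
    ∑ i ∈ posRoots b, |zpair (w • lam) i| = ∑ i ∈ posRoots b, |zpair lam i| := by
  simp_rw [zpair_smul']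
  exact sum_posRoots_wIdx b (f := fun i => |zpair lam i|)
    (fun i => by rw [zpair_reflectionPerm_self, abs_neg]) w⁻¹

lemma sum_abs_zpair_of_isDominant {lam : weightLattice R} (h : IsDominant b lam) :
    ∑ i ∈ posRoots b, |zpair lam i| = ht b lam :=
  Finset.sum_congr rfl fun i hi =>
    abs_of_nonneg (isDominant_iff.1 h i ((mem_posRoots b i).1 hi))

/-- The sum of |⟨λ, α^∨⟩| over positive roots is W-invariant. It bounds the height, and for dominant
λ it equals the height. -/
lemma ht_smul_le {lam : weightLattice R} (h : IsDominant b lam) (w : R.weylGroup) :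
    ht b (w • lam) ≤ ht b lam := by
  rw [← sum_abs_zpair_of_isDominant h, ← sum_abs_zpair_smul b w]
  exact Finset.sum_le_sum fun i _ => le_abs_self _

lemma smul_eq_of_ht_eq {lam : weightLattice R} (h : IsDominant b lam) {w : R.weylGroup}
    (hw : ht b (w • lam) = ht b lam) : w • lam = lam := by
  refine smul_eq_of_isDominant h (isDominant_iff.2 fun i hi => ?_)
  rw [← sum_abs_zpair_of_isDominant h, ← sum_abs_zpair_smul b w] at hw
  have := (Finset.sum_eq_sum_iff_of_le fun i _ => le_abs_self (zpair (w • lam) i)).1 hw i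
    ((mem_posRoots b i).2 hi)
  rw [this]
  exact abs_nonneg _

end Dominance

/-! ### The longest element of the finite Weyl group. -/

section Longest

variable {ι V N : Type*} [AddCommGroup V] [Module ℝ V] [AddCommGroup N] [Module ℝ N]
  {R : RootPairing ι ℝ V N} [Fintype ι] [R.IsCrystallographic] [R.IsReduced] (b : R.Base)

open Classical in
lemma length_ofWeyl (w : R.weylGroup) :
    length b (ofWeyl w) = ((posRoots b).filter fun i => ¬ b.IsPos (wIdx w i)).card := by
  rw [length_eq_sum_aux, Finset.card_filter]
  refine Finset.sum_congr rfl fun i _ => ?_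
  have h1 : (ofWeyl w).right = w := rfl
  have h2 : Multiplicative.toAdd (ofWeyl w).left = 0 := rfl
  rw [h1, h2, zpair_zero]
  split_ifs <;> simp_all

lemma isPos_of_forall_simple {w : R.weylGroup}
    (h : ∀ i ∈ b.support, ¬ b.IsPos (wIdx w i)) {i : ι} (hi : b.IsPos i) :
    ¬ b.IsPos (wIdx w i) := by
  have key : ∀ i, ht b (rootWeight R i) < 0 → ¬ b.IsPos i := fun i h1 h2 => by
    have := ht_rootWeight_pos b h2
    omega
  have key' : ∀ i, ¬ b.IsPos i → ht b (rootWeight R i) < 0 := fun i h1 => by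
    have h2 := ht_rootWeight_pos b ((isPos_reflectionPerm_self b i).2 h1)
    have h3 : rootWeight R (R.reflectionPerm i i) = -rootWeight R i :=
      Subtype.ext (by simp [rootWeight])
    rw [h3, map_neg] at h2
    omega
  have hw : ∀ i, rootWeight R (wIdx w i) = w • rootWeight R i := fun i =>
    Subtype.ext (R.weylGroup_apply_root w i).symm
  apply key
  refine hi.induction_on_add (p := fun k => ht b (rootWeight R (wIdx w k)) < 0) ?_ ?_
  · intro j hj
    exact key' _ (h j hj)
  · intro i j k hk hi hj
    have h1 : rootWeight R k = rootWeight R i + rootWeight R j := Subtype.ext hk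
    rw [hw, h1, smul_add, map_add, ← hw, ← hw]
    have := key' _ (h j hj)
    omega

/-- An element of maximal length has all simple reflections as right descents, so it makes all
simple roots, and hence all positive roots, negative. -/
lemma exists_longest [R.IsRootSystem] :
    ∃ w : R.weylGroup, ∀ i, b.IsPos (wIdx w i) ↔ ¬ b.IsPos i := by
  obtain ⟨w, -, hw⟩ := Finset.exists_max_image (Finset.univ : Finset R.weylGroup)
    (fun w => length b (ofWeyl w)) ⟨1, Finset.mem_univ _⟩
  have h1 : ∀ i ∈ b.support, ¬ b.IsPos (wIdx w i) := by
    intro i hi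
    rw [← length_ofWeyl_mul_sRefl_lt_iff b hi]
    have h2 := hw (w * sRefl R i) (Finset.mem_univ _)
    have h3 := (lengthSystem b).step_right (isSimpleReflection_sRefl hi) (ofWeyl w)
    rw [← ofWeyl_mul] at h3
    omega
  refine ⟨w, fun i => ⟨fun h hi => isPos_of_forall_simple b h1 hi h, fun hi => ?_⟩⟩
  have := isPos_of_forall_simple b h1 ((isPos_reflectionPerm_self b i).2 hi)
  rw [← wIdx_sRefl, ← wIdx_mul] at this
  have h2 : w * sRefl R i = sRefl R (wIdx w i) * w := by
    rw [sRefl_wIdx, inv_mul_cancel_right]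
  rw [h2, wIdx_mul, wIdx_sRefl, isPos_reflectionPerm_self, not_not] at this
  exact this

variable [R.IsRootSystem]

/-- The longest element of the Weyl group. -/
def longest : R.weylGroup := (exists_longest b).choose

lemma isPos_longest (i : ι) : b.IsPos (wIdx (longest b) i) ↔ ¬ b.IsPos i :=
  (exists_longest b).choose_spec i

lemma eq_of_isPos_iff {u v : R.weylGroup}
    (h : ∀ i, b.IsPos (wIdx u i) ↔ b.IsPos (wIdx v i)) : u = v := by
  classical
  have h1 : length b (ofWeyl (u * v⁻¹)) = 0 := by
    rw [length_ofWeyl, Finset.card_eq_zero, Finset.filter_eq_empty_iff]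
    intro i hi
    rw [not_not, wIdx_mul, h, wIdx_apply_inv]
    exact (mem_posRoots b i).1 hi
  rw [length_ofWeyl_eq_zero_iff, mul_inv_eq_one] at h1
  exact h1

lemma isPos_longest_inv (i : ι) : b.IsPos (wIdx (longest b)⁻¹ i) ↔ ¬ b.IsPos i := by
  have := isPos_longest b (wIdx (longest b)⁻¹ i)
  rw [wIdx_apply_inv] at this
  tauto

lemma longest_inv : (longest b)⁻¹ = longest b :=
  eq_of_isPos_iff b fun i => by rw [isPos_longest, isPos_longest_inv]

lemma longest_mul_self : longest b * longest b = 1 := by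
  conv_lhs => enter [1]; rw [← longest_inv b]
  exact inv_mul_cancel _

lemma length_longest_mul (w : R.weylGroup) :
    length b (ofWeyl (longest b * w)) + length b (ofWeyl w) = (posRoots b).card := by
  classical
  rw [length_ofWeyl, length_ofWeyl,
    ← Finset.card_filter_add_card_filter_not (s := posRoots b) (fun i => b.IsPos (wIdx w i))]
  congr 2
  ext i
  simp only [Finset.mem_filter, and_congr_right_iff]
  intro _
  rw [wIdx_mul, isPos_longest, not_not]

lemma length_longest : length b (ofWeyl (longest b)) = (posRoots b).card := by
  have := length_longest_mul b 1
  rwa [mul_one, ofWeyl_one, length_one, add_zero] at this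

lemma length_lt_of_ne_longest {w : R.weylGroup} (hw : w ≠ longest b) :
    length b (ofWeyl w) < (posRoots b).card := by
  have h1 := length_longest_mul b w
  have h2 : longest b * w ≠ 1 := by
    intro h
    apply hw
    rw [← longest_inv, eq_comm, inv_eq_iff_mul_eq_one]
    exact h
  have h3 := (length_ofWeyl_eq_zero_iff b).not.2 h2
  omega

lemma isLongest_longest : IsLongest b (Set.range ofWeyl) (ofWeyl (longest b)) := by
  refine ⟨⟨_, rfl⟩, ?_⟩
  rintro _ ⟨w, rfl⟩ hw
  rw [length_longest]
  exact length_lt_of_ne_longest b fun h => hw (by rw [h])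

end Longest

/-! ### Monomials in the group algebra of the weight lattice. -/

section Monomials

variable {ι V N : Type*} [AddCommGroup V] [Module ℝ V] [AddCommGroup N] [Module ℝ N]
  {R : RootPairing ι ℝ V N}

lemma mono_add (lam mu : weightLattice R) :
    (mono (lam + mu) : LatticeAlg R) = mono lam * mono mu := by
  rw [mono, mono, mono, AddMonoidAlgebra.single_mul_single, one_mul]

lemma mono_zero : (mono (0 : weightLattice R) : LatticeAlg R) = 1 := rfl

lemma latticeAlg_induction {P : LatticeAlg R → Prop} (mono : ∀ lam, P (mono lam))
    (add : ∀ f g, P f → P g → P (f + g)) (smul : ∀ (c : Coeff) f, P f → P (c • f))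
    (f : LatticeAlg R) : P f := by
  induction f using AddMonoidAlgebra.induction_on with
  | of lam => exact mono lam
  | add f g hf hg => exact add f g hf hg
  | smul c f hf => exact smul c f hf

lemma mono_nsmul (n : ℕ) (lam : weightLattice R) :
    (mono (n • lam) : LatticeAlg R) = mono lam ^ n := by
  rw [mono, mono, AddMonoidAlgebra.single_pow, one_pow]

lemma mono_mul_mono_neg (lam : weightLattice R) :
    (mono lam * mono (-lam) : LatticeAlg R) = 1 := by
  rw [← mono_add, add_neg_cancel, mono_zero]

lemma weylAct_mono [R.IsCrystallographic] (w : R.weylGroup) (lam : weightLattice R) :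
    weylAct w (mono lam) = mono (w • lam) := by
  rw [weylAct, mono, AddMonoidAlgebra.domCongr_single]
  rfl

end Monomials

/-! ### Lengths of products with dominant translations. -/

section Lengths

variable {ι V N : Type*} [AddCommGroup V] [Module ℝ V] [AddCommGroup N] [Module ℝ N]
  {R : RootPairing ι ℝ V N} [Fintype ι] [R.IsCrystallographic] [R.IsReduced] {b : R.Base}

/-- A positive root α contributes ⟨μ, α^∨⟩, plus 1 if uα is negative. Dominance of μ excludes
cancellation, so the lengths of u and t_μ add. -/
lemma length_ofWeyl_mul_translation (u : R.weylGroup) {mu : weightLattice R}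
    (hmu : IsDominant b mu) :
    (length b (ofWeyl u * translation mu) : ℤ) = length b (ofWeyl u) + ht b mu := by
  classical
  rw [ofWeyl_mul_translation, length_eq_sum_aux, translation_mul_ofWeyl_left,
    translation_mul_ofWeyl_right, toAdd_ofAdd, length_ofWeyl, Finset.card_filter, ht_apply]
  push_cast
  rw [← Finset.sum_add_distrib]
  refine Finset.sum_congr rfl fun i hi => ?_
  rw [zpair_smul]
  have := isDominant_iff.1 hmu i ((mem_posRoots b i).1 hi)
  by_cases h : b.IsPos (wIdx u i) <;> simp [h] <;>
    first | omega | (rw [abs_of_nonneg (by omega)]; omega)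

lemma length_translation {mu : weightLattice R} (hmu : IsDominant b mu) :
    (length b (translation mu) : ℤ) = ht b mu := by
  have := length_ofWeyl_mul_translation 1 hmu
  rwa [ofWeyl_one, one_mul, length_one, Nat.cast_zero, zero_add] at this

lemma length_mul_sRefl_lt_iff {i : ι} (hi : i ∈ b.support) (g : ExtWeyl R) :
    length b (g * ofWeyl (sRefl R i)) < length b g ↔ ¬ AffPos b (affRootAct g (i, 0)) := by
  have := length_sRefl_mul_lt_iff hi g⁻¹
  rw [inv_inv, length_inv] at this
  rw [(lengthSystem b).length_mul_simple (isSimpleReflection_sRefl hi)]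
  exact this

lemma affRootAct_translation (lam : weightLattice R) (p : ι × ℤ) :
    affRootAct (translation lam) p = (p.1, p.2 + zpair lam p.1) := by
  have h : (translation lam).right = (1 : R.weylGroup) := rfl
  have h2 : Multiplicative.toAdd (translation lam).left = lam := rfl
  rw [affRootAct, h, h2]
  change (wIdx 1 p.1, p.2 + zpair lam (wIdx 1 p.1)) = _
  rw [wIdx_one]

lemma length_translation_mul_sRefl_lt_iff {i : ι} (hi : i ∈ b.support) (lam : weightLattice R) :
    length b (translation lam * ofWeyl (sRefl R i)) < length b (translation lam)
      ↔ 0 < zpair lam i := by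
  rw [length_mul_sRefl_lt_iff hi, affRootAct_translation]
  simp [AffPos, b.isPos_of_mem_support hi]

end Lengths

/-! ### The commutative subalgebra of the elements x^λ. -/

section Lattice

variable {ι V N : Type*} [AddCommGroup V] [Module ℝ V] [AddCommGroup N] [Module ℝ N]
  {R : RootPairing ι ℝ V N} [Fintype ι] [R.IsCrystallographic] [R.IsReduced] {b : R.Base}

lemma IsDominant.add {mu nu : weightLattice R} (hmu : IsDominant b mu) (hnu : IsDominant b nu) :
    IsDominant b (mu + nu) := by
  rw [isDominant_iff] at *
  intro i hi
  rw [zpair_add]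
  exact add_nonneg (hmu i hi) (hnu i hi)

lemma T_translation_mul {mu nu : weightLattice R} (hmu : IsDominant b mu)
    (hnu : IsDominant b nu) :
    T b (translation mu) * T b (translation nu) = T b (translation (mu + nu)) := by
  rw [translation_add]
  refine T_mul ?_
  rw [← translation_add]
  zify
  rw [length_translation (hmu.add hnu), length_translation hmu, length_translation hnu, map_add]

lemma T_translation_commute {mu nu : weightLattice R} (hmu : IsDominant b mu)
    (hnu : IsDominant b nu) : Commute (T b (translation mu)) (T b (translation nu)) := by
  rw [Commute, SemiconjBy, T_translation_mul hmu hnu, T_translation_mul hnu hmu, add_comm]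

/-- The definition of x^λ chooses one way of writing λ as a difference of dominant weights; any
other gives the same element, since dominant translations multiply additively. -/
lemma heckeX_spec {lam mu nu : weightLattice R} (hmu : IsDominant b mu) (hnu : IsDominant b nu)
    (h : lam = mu - nu) : heckeX b lam * T b (translation nu) = T b (translation mu) := by
  obtain ⟨hmu', hnu', h'⟩ := (exists_dominant_sub b lam).choose_spec
  set mu' := (exists_dominant_sub b lam).choose.1
  set nu' := (exists_dominant_sub b lam).choose.2
  have hX : heckeX b lam = T b (translation mu') * Ring.inverse (T b (translation nu')) := rfl
  refine (isUnit_T b (translation nu')).mul_right_cancel ?_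
  rw [hX, mul_assoc, (T_translation_commute hnu hnu').eq, mul_assoc,
    ← mul_assoc (Ring.inverse _), T_inverse_mul, one_mul, T_translation_mul hmu' hnu,
    T_translation_mul hmu hnu']
  congr 2
  rw [h] at h'
  have : mu = mu' - nu' + nu := by rw [← h', sub_add_cancel]
  rw [this]
  abel

lemma heckeX_of_isDominant {lam : weightLattice R} (h : IsDominant b lam) :
    heckeX b lam = T b (translation lam) := by
  have h0 : IsDominant b (0 : weightLattice R) := isDominant_iff.2 fun i _ => by simp
  have := heckeX_spec (b := b) (lam := lam) h h0 (sub_zero lam).symm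
  rwa [translation_zero, T_one, mul_one] at this

lemma heckeX_zero : heckeX b (0 : weightLattice R) = 1 := by
  rw [heckeX_of_isDominant (isDominant_iff.2 fun i _ => by simp), translation_zero, T_one]

lemma heckeX_add (lam mu : weightLattice R) :
    heckeX b (lam + mu) = heckeX b lam * heckeX b mu := by
  obtain ⟨⟨p, r⟩, hp, hr, rfl⟩ := exists_dominant_sub b lam
  obtain ⟨⟨p', r'⟩, hp', hr', rfl⟩ := exists_dominant_sub b mu
  dsimp only at *
  have h1 := heckeX_spec (b := b) hp hr rfl
  have h2 := heckeX_spec (b := b) hp' hr' rfl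
  have h3 := heckeX_spec (b := b) (lam := p - r + (p' - r')) (hp.add hp') (hr.add hr') (by abel)
  refine (isUnit_T b (translation (r + r'))).mul_right_cancel ?_
  rw [h3]
  have h4 : heckeX b (p' - r') * T b (translation (r + r'))
      = T b (translation r) * T b (translation p') := by
    rw [add_comm r, ← T_translation_mul hr' hr, ← mul_assoc, h2,
      (T_translation_commute hp' hr).eq]
  rw [mul_assoc, h4, ← mul_assoc, h1, T_translation_mul hp hp']

variable (b)

/-- The homomorphism from the group algebra of the weight lattice to the Hecke algebra. -/
def latHom : LatticeAlg R →ₐ[Coeff] Hecke b :=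
  AddMonoidAlgebra.lift Coeff (Hecke b) (weightLattice R)
    { toFun := fun lam => heckeX b (Multiplicative.toAdd lam)
      map_one' := heckeX_zero
      map_mul' := fun _ _ => heckeX_add _ _ }

lemma latHom_eq (f : LatticeAlg R) : latticeToHecke b f = latHom b f := by
  rw [latHom, AddMonoidAlgebra.lift_apply]
  rfl

lemma latHom_mono (lam : weightLattice R) : latHom b (mono lam) = heckeX b lam := by
  rw [latHom, mono, AddMonoidAlgebra.lift_single, one_smul]
  rfl

end Lattice

/-! ### The Bernstein relation. -/

section Bernstein

variable {ι V N : Type*} [AddCommGroup V] [Module ℝ V] [AddCommGroup N] [Module ℝ N]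
  {R : RootPairing ι ℝ V N} [Fintype ι] [R.IsCrystallographic] [R.IsReduced] {b : R.Base}

/-- `d` is the divided difference `(f - s_i f) / (1 - x^{-α_i})`, and the Bernstein relation
between `f` and `T_{s_i}` holds. -/
def IsBernstein (b : R.Base) (i : ι) (f d : LatticeAlg R) : Prop :=
  (1 - mono (-rootWeight R i)) * d = f - weylAct (sRefl R i) f ∧
  T b (ofWeyl (sRefl R i)) * latHom b f =
    latHom b (weylAct (sRefl R i) f) * T b (ofWeyl (sRefl R i)) + (q - q⁻¹) • latHom b d

variable {i : ι}

lemma IsBernstein.add {f g d e : LatticeAlg R} (hf : IsBernstein b i f d)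
    (hg : IsBernstein b i g e) : IsBernstein b i (f + g) (d + e) := by
  refine ⟨?_, ?_⟩
  · rw [mul_add, hf.1, hg.1, map_add]
    ring
  · rw [map_add, mul_add, hf.2, hg.2, map_add, map_add, map_add, add_mul, smul_add]
    abel

lemma IsBernstein.smul {f d : LatticeAlg R} (c : Coeff) (hf : IsBernstein b i f d) :
    IsBernstein b i (c • f) (c • d) := by
  refine ⟨?_, ?_⟩
  · rw [mul_smul_comm, hf.1, map_smul, smul_sub]
  · rw [map_smul, mul_smul_comm, hf.2, map_smul, map_smul, map_smul, smul_add, smul_mul_assoc,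
      smul_comm c]

/-- The divided difference obeys the twisted Leibniz rule d(fg) = d(f)g + s(f)d(g). With the rule
for inverses, this reduces the Bernstein relation to weights pairing to 0 or 1 with α_i^∨. -/
lemma IsBernstein.mul {f g d e : LatticeAlg R} (hf : IsBernstein b i f d)
    (hg : IsBernstein b i g e) :
    IsBernstein b i (f * g) (d * g + weylAct (sRefl R i) f * e) := by
  refine ⟨?_, ?_⟩
  · rw [mul_add, ← mul_assoc, hf.1, mul_left_comm, hg.1, map_mul]
    ring
  · rw [map_mul, ← mul_assoc, hf.2, add_mul, mul_assoc, hg.2, mul_add, map_mul, map_mul, map_add,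
      map_mul, map_mul, smul_add, mul_smul_comm, smul_mul_assoc, ← mul_assoc]
    abel

lemma IsBernstein.inv {f g d : LatticeAlg R} (hf : IsBernstein b i f d) (hfg : f * g = 1) :
    IsBernstein b i g (-(weylAct (sRefl R i) g * d * g)) := by
  have hs : weylAct (sRefl R i) g * weylAct (sRefl R i) f = 1 := by
    rw [← map_mul, mul_comm, hfg, map_one]
  refine ⟨?_, ?_⟩
  · have : (1 - mono (-rootWeight R i)) * -(weylAct (sRefl R i) g * d * g)
        = -(weylAct (sRefl R i) g * ((1 - mono (-rootWeight R i)) * d) * g) := by ring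
    rw [this, hf.1]
    linear_combination g * hs - weylAct (sRefl R i) g * hfg
  · have h1 : latHom b (weylAct (sRefl R i) g) * (T b (ofWeyl (sRefl R i)) * latHom b f)
        * latHom b g = latHom b (weylAct (sRefl R i) g) * T b (ofWeyl (sRefl R i)) := by
      rw [mul_assoc, mul_assoc, ← map_mul, hfg, map_one, mul_one]
    rw [hf.2, mul_add, add_mul, ← mul_assoc, ← map_mul, hs, map_one, one_mul, mul_smul_comm,
      smul_mul_assoc, ← map_mul, ← map_mul] at h1
    rw [← h1, map_neg, add_assoc, ← smul_add, add_neg_cancel, smul_zero, add_zero]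

lemma isBernstein_of_zpair_eq_zero (hi : i ∈ b.support) {lam : weightLattice R}
    (hlam : IsDominant b lam) (h0 : zpair lam i = 0) : IsBernstein b i (mono lam) 0 := by
  have hs : sRefl R i • lam = lam := by rw [sRefl_smul, h0, zero_smul, sub_zero]
  refine ⟨by rw [weylAct_mono, hs, mul_zero, sub_self], ?_⟩
  rw [weylAct_mono, hs, map_zero, smul_zero, add_zero, latHom_mono, heckeX_of_isDominant hlam]
  have hS := isSimpleReflection_sRefl hi
  have h1 : ofWeyl (sRefl R i) * translation lam = translation lam * ofWeyl (sRefl R i) := by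
    rw [ofWeyl_mul_translation, hs]
  have h2 := (length_translation_mul_sRefl_lt_iff hi lam).not.2 (by omega)
  have h3 := (lengthSystem b).step_right hS (translation lam)
  rw [T_mul_simple hS (by omega), ← h1, T_simple_mul hS (by rw [h1]; omega)]

/-- Put g = t_ω s. Then T_g T_s = T_{t_ω}, and g t_ω = t_{ω+sω} s with lengths adding because ω + sω
is dominant. Cancelling T_g leaves x^ω = T_s x^{sω} T_s, and multiplying by T_s⁻¹ gives the
relation. -/
lemma isBernstein_of_zpair_eq_one (hi : i ∈ b.support) {om : weightLattice R}
    (hom : IsDominant b om) (h1 : zpair om i = 1) : IsBernstein b i (mono om) (mono om) := by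
  have hS := isSimpleReflection_sRefl hi
  set s := ofWeyl (sRefl R i) with hs
  have hsom : sRefl R i • om = om - rootWeight R i := by rw [sRefl_smul, h1, one_smul]
  set mu := om + sRefl R i • om with hmu
  have hmui : zpair mu i = 0 := by
    rw [hmu, hsom, sub_eq_add_neg, zpair_add, zpair_add, zpair_neg, zpair_rootWeight_self]
    omega
  have hmud : IsDominant b mu := by
    refine isDominant_of_simple fun j hj => ?_
    by_cases hji : j = i
    · rw [hji, hmui]
    · rw [hmu, hsom, sub_eq_add_neg, zpair_add, zpair_add, zpair_neg]
      -- Off-diagonal Cartan integers are nonpositive, so subtracting α_i preserves nonnegativity at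
      -- the other simple coroots.
      have h2 : zpair (rootWeight R i) j ≤ 0 := by
        have h3 := b.pairingIn_le_zero_of_ne (i := i) (j := j) (fun h => hji h.symm) hi hj
        have h4 : ((zpair (rootWeight R i) j : ℤ) : ℝ) = ((R.pairingIn ℤ i j : ℤ) : ℝ) := by
          rw [coe_zpair, rootWeight, R.root_coroot'_eq_pairing, ← R.algebraMap_pairingIn ℤ i j]
          rfl
        have h5 : zpair (rootWeight R i) j = R.pairingIn ℤ i j := by exact_mod_cast h4
        rw [h5]
        exact h3
      have h3 := isDominant_iff.1 hom j (b.isPos_of_mem_support hj)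
      omega
  set g := translation om * s with hg
  have hgs : g * s = translation om := (lengthSystem b).mul_mul_cancel_right hS _
  have hglt := (length_translation_mul_sRefl_lt_iff hi om).2 (by omega)
  have hglen : length b g + 1 = length b (translation om) := by
    have := (lengthSystem b).step_right hS (translation om)
    rw [← hs, ← hg] at hglt
    rw [← hg] at this
    omega
  have e1 : T b g * T b s = T b (translation om) := by
    rw [T_mul_simple hS (by rw [hgs]; omega), hgs]
  have hgt : g * translation om = translation mu * s := by
    rw [hg, mul_assoc, hs, ofWeyl_mul_translation, ← mul_assoc, ← translation_add]
  have hmulen : length b (translation mu * s) = length b (translation mu) + 1 := by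
    have h2 := (length_translation_mul_sRefl_lt_iff hi mu).not.2 (by omega)
    have h3 := (lengthSystem b).step_right hS (translation mu)
    rw [← hs] at h2
    omega
  have hlen : length b (g * translation om) = length b g + length b (translation om) := by
    rw [hgt, hmulen]
    have h2 := length_translation hmud
    have h3 := length_translation hom
    have h4 : ht b mu = ht b om + (ht b om - 2 * 1) := by
      rw [hmu, map_add, ht_sRefl b hi, h1]
    omega
  have e2 : T b g * T b (translation om) = T b (translation mu) * T b s := by
    rw [T_mul hlen, hgt, T_mul_simple hS (by omega)]
  rw [← heckeX_of_isDominant hmud, ← heckeX_of_isDominant hom, hmu, heckeX_add,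
    heckeX_of_isDominant hom, mul_assoc, ← e1, mul_assoc] at e2
  have e3 := (isUnit_T b g).mul_left_cancel e2
  rw [e1] at e3
  refine ⟨?_, ?_⟩
  · rw [weylAct_mono, hsom, sub_mul, one_mul, ← mono_add, neg_add_eq_sub]
  · rw [weylAct_mono, latHom_mono, latHom_mono, heckeX_of_isDominant hom, ← hs]
    have e4 := congrArg ((T b s + (q⁻¹ - q) • (1 : Hecke b)) * ·) e3
    rw [← mul_assoc, T_simple_inv_mul hS, one_mul, add_mul, smul_mul_assoc, one_mul] at e4
    rw [← e4, add_assoc, ← add_smul, sub_add_sub_cancel, sub_self, zero_smul, add_zero]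

lemma IsBernstein.pow {f d : LatticeAlg R} (hf : IsBernstein b i f d) (n : ℕ) :
    ∃ e, IsBernstein b i (f ^ n) e := by
  induction n with
  | zero => exact ⟨0, by simp [IsBernstein]⟩
  | succ n ih =>
    obtain ⟨e, he⟩ := ih
    exact ⟨_, pow_succ f n ▸ he.mul hf⟩

lemma exists_isBernstein_zsmul {lam : weightLattice R} {d : LatticeAlg R}
    (h : IsBernstein b i (mono lam) d) (n : ℤ) : ∃ e, IsBernstein b i (mono (n • lam)) e := by
  obtain ⟨e, he⟩ := h.pow n.natAbs
  rw [← mono_nsmul] at he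
  rcases Int.natAbs_eq n with hn | hn
  · exact ⟨e, by rw [hn, natCast_zsmul]; exact he⟩
  · rw [hn, neg_smul, natCast_zsmul]
    exact ⟨_, he.inv (mono_mul_mono_neg _)⟩

/-- The Bernstein relation. -/
theorem exists_isBernstein [R.IsRootSystem] (hi : i ∈ b.support) (f : LatticeAlg R) :
    ∃ d, IsBernstein b i f d := by
  refine latticeAlg_induction (P := fun f => ∃ d, IsBernstein b i f d) (fun lam => ?_)
    (fun f g hf hg => ?_) (fun c f hf => ?_) f
  · obtain ⟨om, hom, hom'⟩ := exists_fundamental b hi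
    have homd : IsDominant b om := isDominant_of_simple fun j hj => by
      by_cases h : j = i
      · rw [h, hom]; norm_num
      · rw [hom' j hj h]
    obtain ⟨d1, h1⟩ := exists_isBernstein_zsmul (isBernstein_of_zpair_eq_one hi homd hom)
      (zpair lam i)
    set lam' := lam + -(zpair lam i • om) with hlam'
    have h0 : zpair lam' i = 0 := by
      rw [hlam', zpair_add, zpair_neg, zpair_zsmul, hom]; ring
    -- The weight ρ − ω is zero on α_i^∨ and one on the other simple coroots. A large multiple makes
    -- λ' dominant without changing its pairing with α_i^∨, so λ is a sum of weights already treated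
    -- and their multiples.
    have hsi : zpair (rho b + -om) i = 0 := by
      rw [zpair_add, zpair_neg, hom, zpair_rho b hi]; ring
    have hsj : ∀ j ∈ b.support, j ≠ i → zpair (rho b + -om) j = 1 := fun j hj hji => by
      rw [zpair_add, zpair_neg, hom' j hj hji, zpair_rho b hj]; ring
    have hsd : IsDominant b (rho b + -om) := isDominant_of_simple fun j hj => by
      by_cases h : j = i
      · rw [h, hsi]
      · rw [hsj j hj h]; norm_num
    set k : ℤ := ∑ j, |zpair lam' j| with hk
    have hkj : ∀ j, |zpair lam' j| ≤ k := fun j =>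
      Finset.single_le_sum (f := fun j => |zpair lam' j|) (fun _ _ => abs_nonneg _)
        (Finset.mem_univ j)
    have hti : zpair (lam' + k • (rho b + -om)) i = 0 := by
      rw [zpair_add, zpair_zsmul, hsi, h0]; ring
    have htd : IsDominant b (lam' + k • (rho b + -om)) := isDominant_of_simple fun j hj => by
      by_cases h : j = i
      · rw [h, hti]
      · rw [zpair_add, zpair_zsmul, hsj j hj h]
        have := neg_le_of_abs_le (hkj j)
        omega
    obtain ⟨d2, h2⟩ := exists_isBernstein_zsmul (isBernstein_of_zpair_eq_zero hi hsd hsi) (-k)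
    have h3 := (h1.mul (isBernstein_of_zpair_eq_zero hi htd hti)).mul h2
    rw [← mono_add, ← mono_add] at h3
    have e : zpair lam i • om + (lam' + k • (rho b + -om)) + -k • (rho b + -om) = lam := by
      rw [hlam', neg_smul]; abel
    rw [e] at h3
    exact ⟨_, h3⟩
  · obtain ⟨d, hd⟩ := hf
    obtain ⟨e, he⟩ := hg
    exact ⟨_, hd.add he⟩
  · obtain ⟨d, hd⟩ := hf
    exact ⟨_, hd.smul c⟩

end Bernstein

/-! ### Poincaré polynomials. -/

section Poincare

lemma one_not_mem_degLE : (1 : Coeff) ∉ degLE (-1) := fun h =>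
  one_ne_zero (eq_zero_of_coeffBar_eq h (map_one _))

lemma one_add_ne_zero {c : Coeff} (hc : c ∈ degLE (-1)) : 1 + c ≠ 0 := fun h => by
  refine one_not_mem_degLE ?_
  rw [eq_neg_of_add_eq_zero_left h]
  exact neg_mem hc

lemma q_inv_pow_mem_degLE {n : ℕ} (hn : 0 < n) : (q⁻¹) ^ n ∈ degLE (-1) := by
  have h : (q⁻¹) ^ n = q ^ (-(n : ℤ)) := by rw [inv_pow, zpow_neg, zpow_natCast]
  rw [h]
  exact degLE_mono (by omega) (zpow_mem_degLE _)

variable {ι V N : Type*} [AddCommGroup V] [Module ℝ V] [AddCommGroup N] [Module ℝ N]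
  {R : RootPairing ι ℝ V N} [Fintype ι] [R.IsRootSystem] [R.IsCrystallographic]

lemma poincare_zero (b : R.Base) (t : Coeff) :
    poincare b 0 t = ∑ w : R.weylGroup, t ^ length b (ofWeyl w) := by
  classical
  rw [poincare]
  refine Finset.sum_congr ?_ fun _ _ => rfl
  ext w
  simp

variable [R.IsReduced] (b : R.Base)

/-- The identity contributes 1 and every other element of the stabilizer a term in q⁻¹ℤ[q⁻¹]. -/
lemma poincare_inv_ne_zero (mu : weightLattice R) : poincare b mu (q⁻¹ ^ 2) ≠ 0 := by
  classical
  rw [poincare, ← Finset.add_sum_erase _ _ (a := 1) (by simp), ofWeyl_one, length_one, pow_zero]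
  refine one_add_ne_zero (sum_mem fun w hw => ?_)
  rw [← pow_mul]
  refine q_inv_pow_mem_degLE ?_
  have : length b (ofWeyl w) ≠ 0 := fun h =>
    (Finset.mem_erase.1 hw).1 ((length_ofWeyl_eq_zero_iff b).1 h)
  omega

/-- Substitute w₀w for w and use ℓ(w₀w) = ℓ(w₀) − ℓ(w). -/
lemma poincare_zero_eq :
    poincare b 0 (q ^ 2) = q ^ (2 * (posRoots b).card) * poincare b 0 (q⁻¹ ^ 2) := by
  rw [poincare_zero, poincare_zero, Finset.mul_sum,
    ← Equiv.sum_comp (Equiv.mulLeft (longest b)) fun w : R.weylGroup => (q ^ 2) ^ length b (ofWeyl w)]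
  refine Finset.sum_congr rfl fun w _ => ?_
  rw [Equiv.coe_mulLeft, ← length_longest_mul b w, ← pow_mul, ← pow_mul, inv_pow, mul_add, pow_add,
    mul_assoc, mul_inv_cancel₀ (pow_ne_zero _ q_ne_zero), mul_one]

lemma poincare_ne_zero : poincare b 0 (q ^ 2) ≠ 0 := by
  rw [poincare_zero_eq]
  exact mul_ne_zero (pow_ne_zero _ q_ne_zero) (poincare_inv_ne_zero b 0)

end Poincare

/-! ### The unnormalized symmetrizer and the faithfulness of f ↦ f·1₀. -/

section Spherical

variable {ι V N : Type*} [AddCommGroup V] [Module ℝ V] [AddCommGroup N] [Module ℝ N]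
  {R : RootPairing ι ℝ V N} [Fintype ι] [R.IsRootSystem] [R.IsCrystallographic] [R.IsReduced]
  (b : R.Base)

/-- The sum `∑ q^{ℓ(w)} T_w` over the finite Weyl group. -/
def sphSum : Hecke b := ∑ w : R.weylGroup, q ^ length b (ofWeyl w) • T b (ofWeyl w)

lemma one₀_eq : one₀ b = (poincare b 0 (q ^ 2))⁻¹ • sphSum b := rfl

variable {b}

/-- The terms for w and s_i w combine: the quadratic relation adds the missing (q − q⁻¹) at the
longer of the two. -/
lemma T_sRefl_mul_sphSum {i : ι} (hi : i ∈ b.support) :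
    T b (ofWeyl (sRefl R i)) * sphSum b = q • sphSum b := by
  classical
  have hS := isSimpleReflection_sRefl hi
  have h1 : ∀ w : R.weylGroup, T b (ofWeyl (sRefl R i)) * T b (ofWeyl w)
      = T b (ofWeyl (sRefl R i * w)) +
        (if length b (ofWeyl (sRefl R i * w)) < length b (ofWeyl w) then q - q⁻¹ else 0) •
          T b (ofWeyl w) := by
    intro w
    have h2 := (lengthSystem b).step _ hS (ofWeyl w)
    rw [ofWeyl_mul]
    split_ifs with h
    · rw [T_quad hS h, add_comm]
    · rw [T_simple_mul hS (by omega), zero_smul, add_zero]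
  rw [sphSum, Finset.mul_sum, Finset.smul_sum]
  simp_rw [mul_smul_comm, h1, smul_add]
  rw [Finset.sum_add_distrib,
    ← Equiv.sum_comp (Equiv.mulLeft (sRefl R i)) fun w : R.weylGroup =>
      q ^ length b (ofWeyl w) • T b (ofWeyl (sRefl R i * w)), ← Finset.sum_add_distrib]
  refine Finset.sum_congr rfl fun w _ => ?_
  rw [Equiv.coe_mulLeft, ← mul_assoc, sRefl_mul_self, one_mul, smul_smul, smul_smul, ← add_smul]
  congr 1
  have h2 := (lengthSystem b).step _ hS (ofWeyl w)
  rw [← ofWeyl_mul] at h2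
  have hq := q_ne_zero
  split_ifs with h
  · obtain h2 | h2 := h2
    · omega
    · rw [← h2, pow_succ]
      field_simp
      ring
  · obtain h2 | h2 := h2
    · rw [h2, pow_succ]
      ring
    · omega

lemma sphSum_mul_T_sRefl {i : ι} (hi : i ∈ b.support) :
    sphSum b * T b (ofWeyl (sRefl R i)) = q • sphSum b := by
  classical
  have hS := isSimpleReflection_sRefl hi
  have h1 : ∀ w : R.weylGroup, T b (ofWeyl w) * T b (ofWeyl (sRefl R i))
      = T b (ofWeyl (w * sRefl R i)) +
        (if length b (ofWeyl (w * sRefl R i)) < length b (ofWeyl w) then q - q⁻¹ else 0) •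
          T b (ofWeyl w) := by
    intro w
    have h2 := (lengthSystem b).step_right hS (ofWeyl w)
    rw [ofWeyl_mul]
    split_ifs with h
    · rw [T_mul_quad hS h, add_comm]
    · rw [T_mul_simple hS (by omega), zero_smul, add_zero]
  rw [sphSum, Finset.sum_mul, Finset.smul_sum]
  simp_rw [smul_mul_assoc, h1, smul_add]
  rw [Finset.sum_add_distrib,
    ← Equiv.sum_comp (Equiv.mulRight (sRefl R i)) fun w : R.weylGroup =>
      q ^ length b (ofWeyl w) • T b (ofWeyl (w * sRefl R i)), ← Finset.sum_add_distrib]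
  refine Finset.sum_congr rfl fun w _ => ?_
  rw [Equiv.coe_mulRight, mul_assoc, sRefl_mul_self, mul_one, smul_smul, smul_smul, ← add_smul]
  congr 1
  have h2 := (lengthSystem b).step_right hS (ofWeyl w)
  rw [← ofWeyl_mul] at h2
  have hq := q_ne_zero
  split_ifs with h
  · obtain h2 | h2 := h2
    · omega
    · rw [← h2, pow_succ]
      field_simp
      ring
  · obtain h2 | h2 := h2
    · rw [h2, pow_succ]
      ring
    · omega

lemma T_ofWeyl_mul_of_eigen {x : Hecke b}
    (hx : ∀ i ∈ b.support, T b (ofWeyl (sRefl R i)) * x = q • x) (w : R.weylGroup) :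
    T b (ofWeyl w) * x = q ^ length b (ofWeyl w) • x := by
  refine weyl_induction b (P := fun w => T b (ofWeyl w) * x = q ^ length b (ofWeyl w) • x)
    ?_ (fun i w hi hlen ih => ?_) w
  · rw [ofWeyl_one, T_one, one_mul, length_one, pow_zero, one_smul]
  · rw [hlen, ofWeyl_mul, ← T_simple_mul (isSimpleReflection_sRefl hi)
      (by rw [← ofWeyl_mul]; omega), mul_assoc, ih, mul_smul_comm, hx i hi, smul_smul, pow_succ]

lemma T_ofWeyl_mul_sphSum (w : R.weylGroup) :
    T b (ofWeyl w) * sphSum b = q ^ length b (ofWeyl w) • sphSum b :=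
  T_ofWeyl_mul_of_eigen (fun _ hi => T_sRefl_mul_sphSum hi) w

lemma sphSum_mul_of_eigen {x : Hecke b}
    (hx : ∀ i ∈ b.support, T b (ofWeyl (sRefl R i)) * x = q • x) :
    sphSum b * x = poincare b 0 (q ^ 2) • x := by
  rw [sphSum, Finset.sum_mul, poincare_zero, Finset.sum_smul]
  refine Finset.sum_congr rfl fun w _ => ?_
  rw [smul_mul_assoc, T_ofWeyl_mul_of_eigen hx, smul_smul, ← mul_pow, ← sq]

lemma sphSum_mul_self : sphSum b * sphSum b = poincare b 0 (q ^ 2) • sphSum b :=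
  sphSum_mul_of_eigen fun _ hi => T_sRefl_mul_sphSum hi

lemma length_translation_mul_of_regular {lam : weightLattice R}
    (h : ∀ i, b.IsPos i → 0 < zpair lam i) (w : R.weylGroup) :
    (length b (translation lam * ofWeyl w) : ℤ) + length b (ofWeyl w) = ht b lam := by
  classical
  rw [length_translation_mul, ← length_inv b (ofWeyl w), ← ofWeyl_inv, length_ofWeyl,
    Finset.card_filter, ht_apply]
  push_cast
  rw [← Finset.sum_add_distrib]
  refine Finset.sum_congr rfl fun i hi => ?_
  have := h i ((mem_posRoots b i).1 hi)
  by_cases h : b.IsPos (wIdx w⁻¹ i) <;> simp [h] <;>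
    first | omega | (rw [abs_of_nonneg (by omega)]; omega)

/-- For regular dominant λ, multiplication by w on the right shortens t_λ by ℓ(w). Factor T_{t_λ}
through T_{w₀}, which acts on `sphSum` by q^N; then x^λ·`sphSum` is supported on the coset t_λW. -/
lemma heckeX_mul_sphSum {lam : weightLattice R} (h : ∀ i, b.IsPos i → 0 < zpair lam i) :
    heckeX b lam * sphSum b = q ^ (posRoots b).card •
      ∑ w : R.weylGroup, q ^ length b (ofWeyl w) •
        T b (translation lam * ofWeyl (longest b * w)) := by
  have hd : IsDominant b lam := isDominant_iff.2 fun i hi => (h i hi).le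
  have hl := length_translation_mul_of_regular h (longest b)
  have h0 := length_longest b
  have h1 : T b (translation lam) =
      T b (translation lam * ofWeyl (longest b)) * T b (ofWeyl (longest b)) := by
    have e : translation lam * ofWeyl (longest b) * ofWeyl (longest b) = translation lam := by
      rw [mul_assoc, ← ofWeyl_mul, longest_mul_self, ofWeyl_one, mul_one]
    rw [T_mul, e]
    rw [e]
    have := length_translation hd
    omega
  rw [heckeX_of_isDominant hd, h1, mul_assoc, T_ofWeyl_mul_sphSum, mul_smul_comm, h0, sphSum,
    Finset.mul_sum]
  congr 1
  refine Finset.sum_congr rfl fun w _ => ?_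
  rw [mul_smul_comm, ofWeyl_mul, ← mul_assoc, T_mul]
  rw [mul_assoc, ← ofWeyl_mul]
  have h2 := length_translation_mul_of_regular h (longest b * w)
  have h3 := length_longest_mul b w
  omega

lemma repr_heckeX_mul_sphSum {lam mu : weightLattice R} (h : ∀ i, b.IsPos i → 0 < zpair lam i) :
    (heckeBasis b).repr (heckeX b lam * sphSum b) (translation mu) =
      q ^ (2 * (posRoots b).card) * Finsupp.single lam 1 mu := by
  classical
  rw [heckeX_mul_sphSum h, map_smul, map_sum, Finsupp.smul_apply, Finsupp.finsetSum_apply,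
    Finset.sum_eq_single (longest b), map_smul, heckeBasis_repr_T, longest_mul_self, ofWeyl_one,
    mul_one, Finsupp.smul_apply, length_longest, smul_eq_mul, smul_eq_mul, ← mul_assoc, ← pow_add,
    ← two_mul]
  · congr 1
    by_cases hlm : lam = mu
    · rw [hlm, Finsupp.single_eq_same, Finsupp.single_eq_same]
    · rw [Finsupp.single_eq_of_ne, Finsupp.single_eq_of_ne (Ne.symm hlm)]
      intro h
      have := translation_mul_ofWeyl_injective (lam := mu) (mu := lam) (u := 1) (w := 1) (by rw [h])
      exact hlm this.1.symm
  · intro w _ hw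
    rw [map_smul, heckeBasis_repr_T, Finsupp.smul_apply, Finsupp.single_eq_of_ne, smul_zero]
    intro h
    have := translation_mul_ofWeyl_injective (lam := mu) (mu := lam) (u := 1)
      (w := longest b * w) (by rw [← h, ofWeyl_one, mul_one])
    refine hw ?_
    rw [← mul_one (longest b), this.2, ← mul_assoc, longest_mul_self, one_mul]
  · intro h
    exact absurd (Finset.mem_univ _) h

/-- The map `f ↦ f 1₀` is injective on the group algebra. -/
theorem eq_zero_of_latHom_mul_sphSum {f : LatticeAlg R} (hf : latHom b f * sphSum b = 0) :
    f = 0 := by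
  classical
  -- A multiple kρ with k larger than every pairing that occurs moves all exponents of f into the
  -- regular dominant range. There the products x^λ·`sphSum` have disjoint supports.
  set k : ℕ := ∑ lam ∈ f.coeff.support, ∑ i, (zpair lam i).natAbs + 1 with hk
  have hreg : ∀ lam ∈ f.coeff.support, ∀ i, b.IsPos i → 0 < zpair (k • rho b + lam) i := by
    intro lam hlam i hi
    rw [zpair_add, zpair_nsmul]
    have h1 := zpair_rho_pos b hi
    have h2 : (zpair lam i).natAbs ≤ ∑ i, (zpair lam i).natAbs :=
      Finset.single_le_sum (f := fun i => (zpair lam i).natAbs) (fun _ _ => Nat.zero_le _)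
        (Finset.mem_univ i)
    have h3 : ∑ i, (zpair lam i).natAbs ≤ ∑ lam ∈ f.coeff.support, ∑ i, (zpair lam i).natAbs :=
      Finset.single_le_sum (f := fun lam => ∑ i, (zpair lam i).natAbs) (fun _ _ => Nat.zero_le _)
        hlam
    nlinarith [abs_nonneg (zpair lam i), neg_abs_le (zpair lam i), Int.natCast_natAbs (zpair lam i)]
  have h1 : ∑ lam ∈ f.coeff.support, f.coeff lam • (heckeX b (k • rho b + lam) * sphSum b) = 0 := by
    have h2 : heckeX b (k • rho b) * (latHom b f * sphSum b) = 0 := by rw [hf, mul_zero]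
    rw [← latHom_eq, latticeToHecke, Finsupp.sum, Finset.sum_mul, Finset.mul_sum] at h2
    rw [← h2]
    refine Finset.sum_congr rfl fun lam _ => ?_
    rw [heckeX_add, smul_mul_assoc, mul_smul_comm, mul_assoc]
  by_contra hne
  obtain ⟨mu, hmu⟩ := Finsupp.support_nonempty_iff.2 (AddMonoidAlgebra.coeff_eq_zero.not.2 hne)
  have h2 := congrArg (fun x => (heckeBasis b).repr x (translation (k • rho b + mu))) h1
  simp only [map_sum, Finsupp.finsetSum_apply, map_smul, Finsupp.smul_apply, map_zero,
    Finsupp.zero_apply] at h2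
  rw [Finset.sum_eq_single_of_mem mu hmu, repr_heckeX_mul_sphSum (hreg mu hmu),
    Finsupp.single_eq_same, mul_one, smul_eq_mul] at h2
  · exact (mul_ne_zero (Finsupp.mem_support_iff.1 hmu) (pow_ne_zero _ q_ne_zero)) h2
  · intro lam hlam hne
    rw [repr_heckeX_mul_sphSum (hreg lam hlam), Finsupp.single_eq_of_ne, mul_zero, smul_zero]
    intro h
    exact hne (add_left_cancel h).symm

lemma latHom_mul_sphSum_inj {f g : LatticeAlg R} (h : latHom b f * sphSum b = latHom b g * sphSum b) :
    f = g := by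
  have h1 : latHom b (f + (-1 : Coeff) • g) * sphSum b = 0 := by
    rw [map_add, map_smul, add_mul, smul_mul_assoc, h, ← one_smul Coeff (latHom b g * sphSum b),
      smul_smul, ← add_smul]
    simp
  have := eq_zero_of_latHom_mul_sphSum h1
  rw [neg_one_smul] at this
  exact eq_of_sub_eq_zero (by rw [sub_eq_add_neg, this])

end Spherical

/-! ### The Weyl group acting on rational functions, and Demazure–Lusztig coefficients. -/

section FractionField

variable {ι V N : Type*} [AddCommGroup V] [Module ℝ V] [AddCommGroup N] [Module ℝ N]
  {R : RootPairing ι ℝ V N}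

/-- The inclusion of the group algebra in its field of fractions. -/
abbrev toFrac (R : RootPairing ι ℝ V N) : LatticeAlg R →+* LatticeFrac R :=
  algebraMap (LatticeAlg R) (LatticeFrac R)

lemma toFrac_injective : Function.Injective (toFrac R) :=
  IsFractionRing.injective (LatticeAlg R) (LatticeFrac R)

lemma toFrac_smul (c : Coeff) (f : LatticeAlg R) : toFrac R (c • f) = c • toFrac R f := by
  rw [Algebra.smul_def, Algebra.smul_def, map_mul,
    IsScalarTower.algebraMap_apply Coeff (LatticeAlg R) (LatticeFrac R)]

lemma toFrac_mono (lam : weightLattice R) : toFrac R (mono lam) = fmono lam := rfl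

variable [R.IsCrystallographic]

lemma weylAct_mul (u v : R.weylGroup) (f : LatticeAlg R) :
    weylAct (u * v) f = weylAct u (weylAct v f) := by
  refine latticeAlg_induction (P := fun f => weylAct (u * v) f = weylAct u (weylAct v f))
    (fun lam => ?_) (fun f g hf hg => ?_) (fun c f hf => ?_) f
  · rw [weylAct_mono, weylAct_mono, weylAct_mono, mul_smul]
  · rw [map_add, map_add, map_add, hf, hg]
  · rw [map_smul, map_smul, map_smul, hf]

lemma weylAct_one (f : LatticeAlg R) : weylAct (1 : R.weylGroup) f = f := by
  refine latticeAlg_induction (P := fun f => weylAct (1 : R.weylGroup) f = f)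
    (fun lam => ?_) (fun f g hf hg => ?_) (fun c f hf => ?_) f
  · rw [weylAct_mono, one_smul]
  · rw [map_add, hf, hg]
  · rw [map_smul, hf]

lemma weylActFrac_toFrac (w : R.weylGroup) (f : LatticeAlg R) :
    weylActFrac w (toFrac R f) = toFrac R (weylAct w f) := by
  rw [weylActFrac]
  exact IsFractionRing.ringEquivOfRingEquiv_algebraMap _ f

lemma weylActFrac_fmono (w : R.weylGroup) (lam : weightLattice R) :
    weylActFrac w (fmono lam) = fmono (w • lam) := by
  rw [← toFrac_mono, weylActFrac_toFrac, weylAct_mono, toFrac_mono]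

lemma weylActFrac_smul (w : R.weylGroup) (c : Coeff) (x : LatticeFrac R) :
    weylActFrac w (c • x) = c • weylActFrac w x := by
  have h : ∀ y : LatticeFrac R, c • y = toFrac R (c • 1) * y := fun y => by
    rw [toFrac_smul, map_one, smul_mul_assoc, one_mul]
  rw [h, h, map_mul, weylActFrac_toFrac, map_smul, map_one]

lemma weylActFrac_mul (u v : R.weylGroup) (x : LatticeFrac R) :
    weylActFrac (u * v) x = weylActFrac u (weylActFrac v x) := by
  obtain ⟨f, g, _, rfl⟩ := IsFractionRing.div_surjective (LatticeAlg R) x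
  simp only [map_div₀]
  rw [weylActFrac_toFrac, weylActFrac_toFrac, weylActFrac_toFrac, weylActFrac_toFrac,
    weylActFrac_toFrac, weylActFrac_toFrac, weylAct_mul, weylAct_mul]

lemma weylActFrac_one (x : LatticeFrac R) : weylActFrac (1 : R.weylGroup) x = x := by
  obtain ⟨f, g, _, rfl⟩ := IsFractionRing.div_surjective (LatticeAlg R) x
  rw [map_div₀, weylActFrac_toFrac, weylActFrac_toFrac, weylAct_one, weylAct_one]

lemma smul_rootWeight (w : R.weylGroup) (i : ι) :
    w • rootWeight R i = rootWeight R (wIdx w i) :=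
  Subtype.ext (R.weylGroup_apply_root w i)

lemma fmono_add (lam mu : weightLattice R) :
    (fmono (lam + mu) : LatticeFrac R) = fmono lam * fmono mu := by
  rw [fmono, mono_add, map_mul]
  rfl

lemma fmono_zero : (fmono (0 : weightLattice R) : LatticeFrac R) = 1 := by
  rw [fmono, mono_zero, map_one]

lemma fmono_ne_zero (lam : weightLattice R) : (fmono lam : LatticeFrac R) ≠ 0 := fun h => by
  have h1 := fmono_add lam (-lam)
  rw [add_neg_cancel, fmono_zero, h, zero_mul] at h1
  exact one_ne_zero h1

lemma rootWeight_ne_zero (i : ι) : rootWeight R i ≠ 0 := fun h => by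
  have := zpair_rootWeight_self (R := R) i
  rw [h] at this
  simp [zpair] at this

lemma mono_injective : Function.Injective (mono : weightLattice R → LatticeAlg R) :=
  fun _ _ h => AddMonoidAlgebra.of_injective h

lemma fmono_ne_one {lam : weightLattice R} (h : lam ≠ 0) : (fmono lam : LatticeFrac R) ≠ 1 := by
  rw [← fmono_zero]
  exact fun h1 => h (mono_injective (toFrac_injective h1))

lemma one_sub_fmono_ne_zero {lam : weightLattice R} (h : lam ≠ 0) :
    (1 - fmono lam : LatticeFrac R) ≠ 0 :=
  sub_ne_zero.2 (fmono_ne_one h).symm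

/-- The coefficient of the reflection in the action of `T_{s_i}` on the polynomial
representation. -/
def reflCoeff (R : RootPairing ι ℝ V N) [R.IsCrystallographic] (i : ι) : LatticeFrac R :=
  (q • 1 - q⁻¹ • fmono (rootWeight R i)) / (1 - fmono (rootWeight R i))

lemma reflCoeff_ne_zero (i : ι) : reflCoeff R i ≠ 0 := by
  refine div_ne_zero (fun h => ?_) (one_sub_fmono_ne_zero (rootWeight_ne_zero i))
  have h1 : toFrac R (q • mono 0 - q⁻¹ • mono (rootWeight R i)) = toFrac R 0 := by
    rw [map_zero, ← h, map_sub, toFrac_smul, toFrac_smul, mono_zero, map_one, toFrac_mono]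
  have h2 := congrArg (fun f : LatticeAlg R => f.coeff 0) (toFrac_injective h1)
  simp [mono, Finsupp.single_eq_of_ne (rootWeight_ne_zero (R := R) i).symm, q_ne_zero] at h2

lemma weylActFrac_reflCoeff (w : R.weylGroup) (i : ι) :
    weylActFrac w (reflCoeff R i) = reflCoeff R (wIdx w i) := by
  rw [reflCoeff, map_div₀, map_sub, map_sub, weylActFrac_smul, weylActFrac_smul, map_one,
    weylActFrac_fmono, smul_rootWeight, reflCoeff]

/-- Substituting the divided difference d = (f − s_i f)/(1 − x^{−α_i}) into q s_i f + (q − q⁻¹)d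
gives the Demazure–Lusztig operator (q − c) + c s_i, with c = `reflCoeff`. -/
lemma toFrac_bernstein {i : ι} {f d : LatticeAlg R}
    (h : (1 - mono (-rootWeight R i)) * d = f - weylAct (sRefl R i) f) :
    toFrac R (q • weylAct (sRefl R i) f + (q - q⁻¹) • d) =
      (q • 1 - reflCoeff R i) * toFrac R f + reflCoeff R i * toFrac R (weylAct (sRefl R i) f) := by
  have h1 := congrArg (toFrac R) h
  rw [map_mul, map_sub, map_one, toFrac_mono, map_sub] at h1
  have h2 := one_sub_fmono_ne_zero (rootWeight_ne_zero (R := R) i)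
  have h3 : (fmono (rootWeight R i) : LatticeFrac R) * fmono (-rootWeight R i) = 1 := by
    rw [← fmono_add, add_neg_cancel, fmono_zero]
  rw [map_add, toFrac_smul, toFrac_smul, reflCoeff]
  simp only [Algebra.smul_def, mul_one, map_sub]
  set x : LatticeFrac R := fmono (rootWeight R i)
  set y : LatticeFrac R := fmono (-rootWeight R i)
  set a : LatticeFrac R := algebraMap Coeff _ q
  set c : LatticeFrac R := algebraMap Coeff _ q⁻¹
  set F := toFrac R f
  set G := toFrac R (weylAct (sRefl R i) f)
  set D := toFrac R d
  field_simp
  linear_combination (-(a - c) * x) * h1 - (a - c) * D * h3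

end FractionField

/-! ### Demazure–Lusztig operators and the symmetrization formula. -/

section Operators

variable {ι V N : Type*} [AddCommGroup V] [Module ℝ V] [AddCommGroup N] [Module ℝ N]
  {R : RootPairing ι ℝ V N} [Fintype ι] [R.IsRootSystem] [R.IsCrystallographic] [R.IsReduced]
  {b : R.Base}

lemma prod_posRoots_erase_reflectionPerm [DecidableEq ι] {M : Type*} [CommMonoid M] (b : R.Base)
    {i : ι} (hi : i ∈ b.support) (f : ι → M) :
    ∏ j ∈ (posRoots b).erase i, f (R.reflectionPerm i j) = ∏ j ∈ (posRoots b).erase i, f j :=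
  sum_posRoots_erase_reflectionPerm (M := Additive M) b hi f

lemma exists_simple_operator {i : ι} (hi : i ∈ b.support) :
    ∃ D : LatticeAlg R → LatticeAlg R, ∀ f,
      T b (ofWeyl (sRefl R i)) * (latHom b f * sphSum b) = latHom b (D f) * sphSum b ∧
      toFrac R (D f) = (q • 1 - reflCoeff R i) * toFrac R f +
        reflCoeff R i * toFrac R (weylAct (sRefl R i) f) := by
  choose d hd using fun f : LatticeAlg R => exists_isBernstein hi f
  refine ⟨fun f => q • weylAct (sRefl R i) f + (q - q⁻¹) • d f, fun f => ⟨?_, ?_⟩⟩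
  · rw [← mul_assoc, (hd f).2, add_mul, mul_assoc, T_sRefl_mul_sphSum hi, mul_smul_comm,
      map_add, map_smul, map_smul, add_mul, smul_mul_assoc, smul_mul_assoc]
  · exact toFrac_bernstein (hd f).1

/-- `F` is the operator `∑_v h_v v` on the group algebra. -/
def IsOperator (F : LatticeAlg R → LatticeAlg R) (h : R.weylGroup → LatticeFrac R) : Prop :=
  ∀ f, toFrac R (F f) = ∑ v, h v * toFrac R (weylAct v f)

lemma isOperator_comp {i : ι} {D F : LatticeAlg R → LatticeAlg R}
    {h : R.weylGroup → LatticeFrac R} (hF : IsOperator F h)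
    (hD : ∀ f, toFrac R (D f) = (q • 1 - reflCoeff R i) * toFrac R f +
        reflCoeff R i * toFrac R (weylAct (sRefl R i) f)) :
    IsOperator (fun f => D (F f)) fun v => (q • 1 - reflCoeff R i) * h v +
      reflCoeff R i * weylActFrac (sRefl R i) (h (sRefl R i * v)) := by
  intro f
  rw [hD, ← weylActFrac_toFrac, hF, map_sum, Finset.mul_sum, Finset.mul_sum]
  simp only [add_mul]
  rw [Finset.sum_add_distrib]
  congr 1
  · exact Finset.sum_congr rfl fun v _ => by rw [mul_assoc]
  · rw [← Equiv.sum_comp (Equiv.mulLeft (sRefl R i))]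
    refine Finset.sum_congr rfl fun v _ => ?_
    rw [Equiv.coe_mulLeft, map_mul, weylActFrac_toFrac, ← weylAct_mul, ← mul_assoc (sRefl R i),
      sRefl_mul_self, one_mul, mul_assoc]

lemma weylAct_injective (b : R.Base) {u v : R.weylGroup}
    (h : ∀ f : LatticeAlg R, weylAct u f = weylAct v f) : u = v := by
  have h1 := h (mono (rho b))
  rw [weylAct_mono, weylAct_mono] at h1
  have h2 := mono_injective h1
  have h3 : (v⁻¹ * u) • rho b = rho b := by rw [mul_smul, h2, inv_smul_smul]
  have h4 : v⁻¹ * u = 1 := by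
    refine eq_one_of_isDominant (b := b) (lam := rho b) (fun i hi => ?_) ?_
    · rw [zpair_rho b hi]; norm_num
    · rw [h3]
      exact isDominant_iff.2 fun i hi => (zpair_rho_pos b hi).le
  exact (inv_mul_eq_one.1 h4).symm

/-- Distinct elements of W act by distinct automorphisms, as ρ is regular, so Dedekind's
independence of characters applies. Hence an operator determines its coefficients. -/
lemma IsOperator.eq_zero (b : R.Base) {h : R.weylGroup → LatticeFrac R}
    (hh : IsOperator (fun _ => 0) h) (v : R.weylGroup) : h v = 0 := by
  let χ : R.weylGroup → (LatticeAlg R →* LatticeFrac R) := fun v =>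
    ((toFrac R : LatticeAlg R →* LatticeFrac R)).comp
      (weylAct v : LatticeAlg R →* LatticeAlg R)
  have hχ : Function.Injective χ := fun u v huv => by
    refine weylAct_injective b fun f => ?_
    exact toFrac_injective (DFunLike.congr_fun huv f)
  have hli := (linearIndependent_monoidHom (LatticeAlg R) (LatticeFrac R)).comp χ hχ
  refine (Fintype.linearIndependent_iff.1 hli) h ?_ v
  funext f
  have := hh f
  rw [map_zero] at this
  rw [Finset.sum_apply, Pi.zero_apply, this]
  rfl

lemma IsOperator.ext (b : R.Base) {F : LatticeAlg R → LatticeAlg R}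
    {h k : R.weylGroup → LatticeFrac R} (hh : IsOperator F h) (hk : IsOperator F k)
    (v : R.weylGroup) : h v = k v := by
  have : IsOperator (fun _ => 0) fun v => h v - k v := fun f => by
    simp only [sub_mul]
    rw [Finset.sum_sub_distrib, ← hh f, ← hk f, sub_self, map_zero]
  exact sub_eq_zero.1 (this.eq_zero b v)

/-- When s_i w is longer than w, the positive roots inverted by (s_i w)⁻¹ are α_i and the s_i-images
of those inverted by w⁻¹. -/
lemma prod_inversions_sRefl_mul {i : ι} (hi : i ∈ b.support) {w : R.weylGroup}
    (hlen : length b (ofWeyl (sRefl R i * w)) = length b (ofWeyl w) + 1) [DecidablePred b.IsPos] :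
    ∏ j ∈ (posRoots b).filter (fun j => ¬ b.IsPos (wIdx (sRefl R i * w)⁻¹ j)), reflCoeff R j =
      reflCoeff R i * weylActFrac (sRefl R i)
        (∏ j ∈ (posRoots b).filter (fun j => ¬ b.IsPos (wIdx w⁻¹ j)), reflCoeff R j) := by
  classical
  have hpos : b.IsPos (wIdx w⁻¹ i) := by
    have := (length_sRefl_mul_ofWeyl_lt_iff b hi w).not.1 (by omega)
    simpa using this
  have hinv : ∀ j, wIdx (sRefl R i * w)⁻¹ j = wIdx w⁻¹ (R.reflectionPerm i j) := fun j => by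
    rw [mul_inv_rev, sRefl_inv, wIdx_mul, wIdx_sRefl]
  have hip : i ∈ posRoots b := (mem_posRoots b i).2 (b.isPos_of_mem_support hi)
  have hneg : ¬ b.IsPos (wIdx w⁻¹ (R.reflectionPerm i i)) := by
    have h1 := length_sRefl_mul_ofWeyl_lt_iff b hi (sRefl R i * w)
    rw [hinv, ← mul_assoc, sRefl_mul_self, one_mul] at h1
    exact h1.1 (by omega)
  rw [Finset.prod_filter, Finset.prod_filter, ← Finset.mul_prod_erase _ _ hip,
    ← Finset.mul_prod_erase _ _ hip, hinv, if_pos hneg, if_neg (not_not.2 hpos), one_mul, map_prod]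
  congr 1
  rw [← prod_posRoots_erase_reflectionPerm b hi]
  refine Finset.prod_congr rfl fun j _ => ?_
  rw [hinv, R.reflectionPerm_self]
  split_ifs
  · rw [map_one]
  · rw [weylActFrac_reflCoeff, wIdx_sRefl]

/-- T_w acts by composing Demazure–Lusztig operators along a reduced word. Apart from w itself, only
v shorter than w can occur. To reach w every letter must contribute its reflection term, so the
coefficient there is the product of all the c_α over the inversions. -/
lemma exists_operator [DecidablePred b.IsPos] (w : R.weylGroup) :
    ∃ (D : LatticeAlg R → LatticeAlg R) (h : R.weylGroup → LatticeFrac R),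
      (∀ f, T b (ofWeyl w) * (latHom b f * sphSum b) = latHom b (D f) * sphSum b) ∧
      IsOperator D h ∧ (∀ v, v ≠ w → length b (ofWeyl w) ≤ length b (ofWeyl v) → h v = 0) ∧
      h w = ∏ j ∈ (posRoots b).filter (fun j => ¬ b.IsPos (wIdx w⁻¹ j)), reflCoeff R j := by
  classical
  refine weyl_induction b (P := fun w => ∃ (D : LatticeAlg R → LatticeAlg R)
      (h : R.weylGroup → LatticeFrac R),
      (∀ f, T b (ofWeyl w) * (latHom b f * sphSum b) = latHom b (D f) * sphSum b) ∧
      IsOperator D h ∧ (∀ v, v ≠ w → length b (ofWeyl w) ≤ length b (ofWeyl v) → h v = 0) ∧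
      h w = ∏ j ∈ (posRoots b).filter (fun j => ¬ b.IsPos (wIdx w⁻¹ j)), reflCoeff R j)
    ?_ (fun i w hi hlen ih => ?_) w
  · refine ⟨id, fun v => if v = 1 then 1 else 0, fun f => ?_, fun f => ?_, fun v hv _ => if_neg hv,
      ?_⟩
    · rw [ofWeyl_one, T_one, one_mul, id]
    · rw [Finset.sum_eq_single 1]
      · simp only [if_true, one_mul, weylAct_one, id]
      · intro v _ hv
        simp only [if_neg hv, zero_mul]
      · intro h
        exact absurd (Finset.mem_univ _) h
    · simp only [if_true]
      rw [Finset.filter_false_of_mem, Finset.prod_empty]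
      intro j hj
      rw [inv_one, wIdx_one, not_not]
      exact (mem_posRoots b j).1 hj
  · obtain ⟨D, h, h1, h2, h3, h4⟩ := ih
    obtain ⟨F, hF⟩ := exists_simple_operator hi
    refine ⟨_, _, fun f => ?_, isOperator_comp h2 fun f => (hF f).2, fun v hv hle => ?_, ?_⟩
    · rw [ofWeyl_mul, ← T_simple_mul (isSimpleReflection_sRefl hi)
        (by rw [← ofWeyl_mul]; omega), mul_assoc, h1, (hF _).1]
    · have hstep := (lengthSystem b).step _ (isSimpleReflection_sRefl hi) (ofWeyl v)
      rw [← ofWeyl_mul] at hstep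
      rw [h3 v (by rintro rfl; omega) (by omega),
        h3 (sRefl R i * v) (by rintro rfl; rw [← mul_assoc, sRefl_mul_self, one_mul] at hv; exact hv rfl)
          (by omega), map_zero, mul_zero, mul_zero, add_zero]
    · rw [prod_inversions_sRefl_mul hi hlen, ← h4, ← mul_assoc (sRefl R i), sRefl_mul_self,
        one_mul, h3 (sRefl R i * w) (by intro h; rw [h] at hlen; omega) (by omega), mul_zero,
        zero_add]

lemma neg_index_neg_index (i : ι) :
    R.reflectionPerm (R.reflectionPerm i i) (R.reflectionPerm i i) = i :=
  congrArg Prod.fst (affNeg_affNeg (R := R) (i, 0))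

lemma rootWeight_neg_index (i : ι) : rootWeight R (R.reflectionPerm i i) = -rootWeight R i := by
  refine Subtype.ext ?_
  change R.root (R.reflectionPerm i i) = -R.root i
  rw [R.root_reflectionPerm, R.reflection_apply_self]

/-- The map −w₀ permutes the positive roots. -/
lemma prod_posRoots_longest {M : Type*} [CommMonoid M] (b : R.Base) (f : ι → M) :
    ∏ j ∈ posRoots b, f (wIdx (longest b) j) = ∏ j ∈ posRoots b, f (R.reflectionPerm j j) := by
  refine Finset.prod_bij
    (fun j _ => R.reflectionPerm (wIdx (longest b) j) (wIdx (longest b) j)) ?_ ?_ ?_ ?_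
  · intro j hj
    rw [mem_posRoots] at hj ⊢
    rw [isPos_reflectionPerm_self, isPos_longest, not_not]
    exact hj
  · intro j _ k _ hjk
    refine (R.weylGroupToPerm (longest b)).injective ?_
    have := congrArg (fun i => R.reflectionPerm i i) hjk
    simpa only [neg_index_neg_index] using this
  · intro k hk
    refine ⟨wIdx (longest b) (R.reflectionPerm k k), ?_, ?_⟩
    · rw [mem_posRoots] at hk ⊢
      rw [isPos_longest, isPos_reflectionPerm_self, not_not]
      exact hk
    · rw [← wIdx_mul, longest_mul_self, wIdx_one, neg_index_neg_index]
  · intro j _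
    rw [neg_index_neg_index]

lemma reflCoeff_neg_index (i : ι) :
    reflCoeff R (R.reflectionPerm i i) =
      q • ((1 - (q⁻¹ ^ 2) • fmono (-rootWeight R i)) / (1 - fmono (-rootWeight R i))) := by
  rw [reflCoeff, rootWeight_neg_index, ← smul_div_assoc, smul_sub, smul_smul]
  congr 3
  have := q_ne_zero
  field_simp

/-- The factor `∏_{α > 0} (1 - t x^{-α}) / (1 - x^{-α})`. -/
def cFactor (b : R.Base) (t : Coeff) : LatticeFrac R :=
  ∏ i ∈ posRoots b, (1 - t • fmono (-rootWeight R i)) / (1 - fmono (-rootWeight R i))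

/-- The product `1₀ f 1₀` is a symmetrization of `f`. -/
theorem exists_symmetrization (b : R.Base) (f : LatticeAlg R) :
    ∃ g : LatticeAlg R, sphSum b * (latHom b f * sphSum b) = latHom b g * sphSum b ∧
      toFrac R g = q ^ (2 * (posRoots b).card) •
        ∑ w : R.weylGroup, weylActFrac w (toFrac R f * cFactor b (q⁻¹ ^ 2)) := by
  classical
  choose D h hD hop hzero htop using fun w : R.weylGroup => exists_operator (b := b) w
  set S : LatticeAlg R → LatticeAlg R := fun f => ∑ w, q ^ length b (ofWeyl w) • D w f with hS
  set H : R.weylGroup → LatticeFrac R := fun v => ∑ w, q ^ length b (ofWeyl w) • h w v with hH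
  have hSop : IsOperator S H := fun f => by
    rw [hS, map_sum, hH]
    simp only [Finset.sum_mul]
    rw [Finset.sum_comm]
    refine Finset.sum_congr rfl fun w _ => ?_
    rw [toFrac_smul, hop w f, Finset.smul_sum]
    exact Finset.sum_congr rfl fun v _ => (smul_mul_assoc _ _ _).symm
  have hSE : ∀ f, sphSum b * (latHom b f * sphSum b) = latHom b (S f) * sphSum b := fun f => by
    rw [hS, map_sum, Finset.sum_mul]
    conv_lhs => rw [sphSum, Finset.sum_mul]
    refine Finset.sum_congr rfl fun w _ => ?_
    rw [map_smul, smul_mul_assoc, smul_mul_assoc, ← hD w f, sphSum]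
  -- Since T_{s_i} multiplies `sphSum` by q, the operator of T_{s_i} composed with S is qS.
  -- Comparing coefficients at s_i v gives (q − c)H(s_i v) + c·s_i(H(v)) = qH(s_i v), and c is
  -- nonzero.
  have hsymm : ∀ i ∈ b.support, ∀ v, H (sRefl R i * v) = weylActFrac (sRefl R i) (H v) := by
    intro i hi v
    obtain ⟨F, hF⟩ := exists_simple_operator hi
    have h1 := isOperator_comp hSop fun f => (hF f).2
    have h2 : IsOperator (fun f => F (S f)) fun v => q • H v := fun f => by
      have e : F (S f) = q • S f := by
        refine latHom_mul_sphSum_inj (b := b) ?_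
        rw [← (hF _).1, ← hSE, ← mul_assoc, T_sRefl_mul_sphSum hi, smul_mul_assoc, hSE, map_smul,
          smul_mul_assoc]
      dsimp only
      rw [e, toFrac_smul, hSop f, Finset.smul_sum]
      exact Finset.sum_congr rfl fun v _ => (smul_mul_assoc _ _ _).symm
    have h3 := h1.ext b h2 (sRefl R i * v)
    rw [← mul_assoc (sRefl R i), sRefl_mul_self, one_mul, sub_mul, smul_mul_assoc, one_mul,
      sub_add, sub_eq_self, sub_eq_zero] at h3
    exact mul_left_cancel₀ (reflCoeff_ne_zero i) h3
  have hv : ∀ v, H v = weylActFrac v (H 1) := fun v => by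
    refine weyl_induction b (P := fun v => H v = weylActFrac v (H 1)) ?_
      (fun i w hi _ ih => ?_) v
    · rw [weylActFrac_one]
    · rw [hsymm i hi, ih, weylActFrac_mul]
  -- Only T_{w₀} has a nonzero coefficient at w₀, every other element of W being shorter.
  have hlong : H (longest b) = q ^ (posRoots b).card • ∏ j ∈ posRoots b, reflCoeff R j := by
    rw [hH]
    dsimp only
    rw [Finset.sum_eq_single (longest b), htop, length_longest, Finset.filter_true_of_mem]
    · intro j hj
      rw [isPos_longest_inv, not_not]
      exact (mem_posRoots b j).1 hj
    · intro w _ hw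
      rw [hzero w (longest b) (Ne.symm hw), smul_zero]
      have := length_lt_of_ne_longest b hw
      rw [length_longest]
      exact this.le
    · intro h
      exact absurd (Finset.mem_univ _) h
  -- Applying w₀ to H(w₀) recovers H(1) and turns each c_α into some c_{−β} with β positive, which
  -- is q(1 − q⁻²x^{−β})/(1 − x^{−β}).
  have hone : H 1 = q ^ (2 * (posRoots b).card) • cFactor b (q⁻¹ ^ 2) := by
    have h1 := congrArg (weylActFrac (longest b)) (hv (longest b))
    rw [← weylActFrac_mul, longest_mul_self, weylActFrac_one] at h1
    rw [← h1, hlong, weylActFrac_smul, map_prod]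
    simp only [weylActFrac_reflCoeff]
    rw [prod_posRoots_longest b (reflCoeff R)]
    simp only [reflCoeff_neg_index]
    rw [Finset.prod_smul, Finset.prod_const, smul_smul, ← pow_add, ← two_mul]
    rfl
  refine ⟨S f, hSE f, ?_⟩
  rw [hSop f, Finset.smul_sum]
  refine Finset.sum_congr rfl fun v _ => ?_
  rw [hv v, hone, weylActFrac_smul, smul_mul_assoc, map_mul, weylActFrac_toFrac,
    mul_comm (weylActFrac v _)]

end Operators

/-! ### Part (a): the spherical function and M_μ. -/

section SphericalFunction

variable {ι V N : Type*} [AddCommGroup V] [Module ℝ V] [AddCommGroup N] [Module ℝ N]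
  {R : RootPairing ι ℝ V N} [Fintype ι] [R.IsRootSystem] [R.IsCrystallographic] [R.IsReduced]

lemma sphericalP_eq (b : R.Base) (mu : weightLattice R) (t : Coeff) :
    sphericalP b mu t =
      (poincare b mu t)⁻¹ • ∑ w : R.weylGroup, weylActFrac w (fmono mu * cFactor b t) := rfl

/-- The symmetrization formula for f = x^μ; the remaining power of q is absorbed by W₀(q²) =
q^{2N}W₀(q⁻²). -/
theorem sphericalP_mul_one₀ (b : R.Base) (mu : weightLattice R) :
    ∃ P : LatticeAlg R, toFrac R P = sphericalP b mu (q⁻¹ ^ 2) ∧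
      (poincare b mu (q⁻¹ ^ 2) / poincare b 0 (q⁻¹ ^ 2)) • (latticeToHecke b P * one₀ b) =
        heckeM b mu := by
  obtain ⟨g, hg, hg'⟩ := exists_symmetrization b (mono mu)
  have h1 := poincare_inv_ne_zero b mu
  have h2 := poincare_inv_ne_zero b 0
  have h3 := poincare_zero_eq b
  have h4 : q ^ (2 * (posRoots b).card) ≠ 0 := pow_ne_zero _ q_ne_zero
  refine ⟨((poincare b mu (q⁻¹ ^ 2))⁻¹ * (q ^ (2 * (posRoots b).card))⁻¹) • g, ?_, ?_⟩
  · rw [toFrac_smul, hg', smul_smul, inv_mul_cancel_right₀ h4, sphericalP_eq, toFrac_mono]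
  · rw [latHom_eq, map_smul, one₀_eq, heckeM, one₀_eq, mul_smul_comm, smul_mul_assoc,
      smul_mul_assoc, smul_mul_assoc, mul_smul_comm, mul_assoc, ← latHom_mono, hg, smul_smul,
      smul_smul, smul_smul, h3]
    congr 1
    generalize poincare b mu (q⁻¹ ^ 2) = x at *
    generalize poincare b 0 (q⁻¹ ^ 2) = y at *
    generalize q ^ (2 * (posRoots b).card) = z at *
    field_simp

end SphericalFunction

/-! ### Weyl quotients with the product form of the denominator, and their straightening. -/

section Characters

lemma two_ne_zero_coeff : (2 : Coeff) ≠ 0 := fun h => by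
  have h1 := aeval_q_injective (a₁ := 2) (a₂ := 0) (by rw [map_ofNat, h, map_zero])
  exact two_ne_zero h1

variable {ι V N : Type*} [AddCommGroup V] [Module ℝ V] [AddCommGroup N] [Module ℝ N]
  {R : RootPairing ι ℝ V N} [Fintype ι] [R.IsRootSystem] [R.IsCrystallographic] [R.IsReduced]
  (b : R.Base)

/-- The product `∏_{α > 0} (1 - x^{-α})`. -/
def rootProd : LatticeAlg R := ∏ i ∈ posRoots b, (1 - mono (-rootWeight R i))

/-- The Weyl denominator `x^ρ ∏_{α > 0} (1 - x^{-α})`. -/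
def weylDenom : LatticeAlg R := mono (rho b) * rootProd b

lemma rootProd_ne_zero : rootProd b ≠ 0 := by
  refine Finset.prod_ne_zero_iff.2 fun i _ => sub_ne_zero.2 ?_
  rw [← mono_zero]
  exact fun h => rootWeight_ne_zero i (neg_eq_zero.1 (mono_injective h).symm)

lemma weylDenom_ne_zero : weylDenom b ≠ 0 := by
  refine mul_ne_zero (fun h => ?_) (rootProd_ne_zero b)
  exact fmono_ne_zero (rho b) (by rw [← toFrac_mono, h, map_zero])

/-- The reflection permutes all factors except the one of α_i, and x^ρ(1 − x^{−α_i}) = x^ρ −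
x^{s_iρ} changes sign. -/
lemma weylAct_sRefl_weylDenom {i : ι} (hi : i ∈ b.support) :
    weylAct (sRefl R i) (weylDenom b) = -weylDenom b := by
  classical
  have hip : i ∈ posRoots b := (mem_posRoots b i).2 (b.isPos_of_mem_support hi)
  have h1 : weylAct (sRefl R i) (∏ j ∈ (posRoots b).erase i, (1 - mono (-rootWeight R j))) =
      ∏ j ∈ (posRoots b).erase i, (1 - mono (-rootWeight R j) : LatticeAlg R) := by
    rw [map_prod, ← prod_posRoots_erase_reflectionPerm b hi
      fun j => (1 - mono (-rootWeight R j) : LatticeAlg R)]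
    refine Finset.prod_congr rfl fun j _ => ?_
    rw [map_sub, map_one, weylAct_mono, smul_neg, smul_rootWeight, wIdx_sRefl]
  have h2 : sRefl R i • rho b = rho b + -rootWeight R i := by
    rw [sRefl_smul, zpair_rho b hi, one_smul, sub_eq_add_neg]
  rw [weylDenom, rootProd, ← Finset.mul_prod_erase _ _ hip, map_mul, map_mul, h1, weylAct_mono,
    h2, map_sub, map_one, weylAct_mono, smul_neg, smul_rootWeight, wIdx_sRefl,
    rootWeight_neg_index, neg_neg, mono_add]
  have h3 := mono_mul_mono_neg (rootWeight R i)
  linear_combination (-mono (rho b) * ∏ j ∈ (posRoots b).erase i, (1 - mono (-rootWeight R j))) * h3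

lemma weylAct_weylDenom (w : R.weylGroup) :
    weylAct w (weylDenom b) = (-1) ^ length b (ofWeyl w) * weylDenom b := by
  refine weyl_induction b
    (P := fun w => weylAct w (weylDenom b) = (-1) ^ length b (ofWeyl w) * weylDenom b)
    ?_ (fun i w hi hlen ih => ?_) w
  · rw [weylAct_one, ofWeyl_one, length_one, pow_zero, one_mul]
  · rw [weylAct_mul, ih, map_mul, map_pow, map_neg, map_one, weylAct_sRefl_weylDenom b hi, hlen]
    ring

lemma altSum_sRefl_smul {i : ι} (hi : i ∈ b.support) (mu : weightLattice R) :
    altSum b (sRefl R i • mu) = -altSum b mu := by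
  rw [altSum, altSum, ← Finset.sum_neg_distrib,
    ← Equiv.sum_comp (Equiv.mulRight (sRefl R i)) fun w : R.weylGroup =>
      (-1) ^ length b (ofWeyl w) * weylAct w (mono (sRefl R i • mu) : LatticeAlg R)]
  refine Finset.sum_congr rfl fun w _ => ?_
  rw [Equiv.coe_mulRight, weylAct_mono, weylAct_mono, ← mul_smul, mul_assoc, sRefl_mul_self,
    mul_one, ofWeyl_mul]
  rcases (lengthSystem b).step_right (isSimpleReflection_sRefl hi) (ofWeyl w) with h | h
  · rw [h]
    ring
  · rw [← h]
    ring

lemma altSum_smul (w : R.weylGroup) (mu : weightLattice R) :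
    altSum b (w • mu) = (-1) ^ length b (ofWeyl w) * altSum b mu := by
  refine weyl_induction b
    (P := fun w => altSum b (w • mu) = (-1) ^ length b (ofWeyl w) * altSum b mu)
    ?_ (fun i w hi hlen ih => ?_) w
  · rw [one_smul, ofWeyl_one, length_one, pow_zero, one_mul]
  · rw [mul_smul, altSum_sRefl_smul b hi, ih, hlen]
    ring

/-- The symmetrization of `x^ν / ∏_{α > 0} (1 - x^{-α})`. -/
def charFrac (nu : weightLattice R) : LatticeFrac R :=
  ∑ w : R.weylGroup, weylActFrac w (fmono nu / toFrac R (rootProd b))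

/-- The summand is x^{ν+ρ} over the antisymmetric `weylDenom`, so symmetrizing it antisymmetrizes
the numerator. That `weylDenom` is the alternating sum of x^ρ is established only in `altSum_rho`.
-/
lemma charFrac_mul_weylDenom (nu : weightLattice R) :
    charFrac b nu * toFrac R (weylDenom b) = toFrac R (altSum b (nu + rho b)) := by
  have hD : toFrac R (weylDenom b) ≠ 0 := fun h =>
    weylDenom_ne_zero b (toFrac_injective (by rw [h, map_zero]))
  have h1 : (fmono nu / toFrac R (rootProd b) : LatticeFrac R) =
      fmono (nu + rho b) / toFrac R (weylDenom b) := by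
    rw [weylDenom, map_mul, toFrac_mono, fmono_add, mul_div_mul_comm,
      div_mul_div_cancel₀ (fmono_ne_zero _)]
  rw [charFrac, altSum, Finset.sum_mul, map_sum]
  refine Finset.sum_congr rfl fun w _ => ?_
  rw [h1, map_div₀, weylActFrac_toFrac, weylAct_weylDenom, weylActFrac_fmono, weylAct_mono,
    map_mul, map_mul, toFrac_mono, map_pow, map_neg, map_one]
  have h2 : ((-1 : LatticeFrac R) ^ length b (ofWeyl w)) * (-1) ^ length b (ofWeyl w) = 1 := by
    rw [← mul_pow]
    simp
  have h3 : ((-1 : LatticeFrac R) ^ length b (ofWeyl w)) ≠ 0 := left_ne_zero_of_mul_eq_one h2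
  field_simp
  linear_combination (-fmono (w • (nu + rho b))) * h2

lemma weylActFrac_charFrac (w : R.weylGroup) (nu : weightLattice R) :
    weylActFrac w (charFrac b nu) = charFrac b nu := by
  rw [charFrac, map_sum]
  conv_rhs => rw [← Equiv.sum_comp (Equiv.mulLeft w)]
  exact Finset.sum_congr rfl fun v _ => by rw [Equiv.coe_mulLeft, weylActFrac_mul]

lemma charFrac_eq_of_smul {nu nu' : weightLattice R} {w : R.weylGroup}
    (h : nu' + rho b = w • (nu + rho b)) :
    charFrac b nu' = (-1) ^ length b (ofWeyl w) * charFrac b nu := by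
  have hD : toFrac R (weylDenom b) ≠ 0 := fun h =>
    weylDenom_ne_zero b (toFrac_injective (by rw [h, map_zero]))
  refine mul_right_cancel₀ hD ?_
  rw [charFrac_mul_weylDenom, h, altSum_smul, map_mul, map_pow, map_neg, map_one, mul_assoc,
    charFrac_mul_weylDenom]

/-- Here s_i fixes ν + ρ, so the quotient equals its own negative. -/
lemma charFrac_eq_zero {nu : weightLattice R} {i : ι} (hi : i ∈ b.support)
    (h : zpair (nu + rho b) i = 0) : charFrac b nu = 0 := by
  have h1 := charFrac_eq_of_smul b (nu := nu) (nu' := nu) (w := sRefl R i)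
    (by rw [sRefl_smul, h, zero_smul, sub_zero])
  have h2 := (isSimpleReflection_sRefl hi).2
  rw [h2, pow_one, neg_one_mul] at h1
  have h3 : (2 : Coeff) • charFrac b nu = 0 := by
    rw [two_smul]
    nth_rewrite 1 [h1]
    exact neg_add_cancel _
  exact (smul_eq_zero.1 h3).resolve_left two_ne_zero_coeff

/-- Straightening: move ν + ρ to a dominant weight. If that weight lies on a wall the quotient
vanishes; if not, subtracting ρ still leaves a dominant weight. -/
lemma charFrac_cases (nu : weightLattice R) :
    charFrac b nu = 0 ∨ ∃ (nu' : weightLattice R) (w : R.weylGroup), IsDominant b nu' ∧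
      nu' + rho b = w • (nu + rho b) ∧
      (charFrac b nu = charFrac b nu' ∨ charFrac b nu = -charFrac b nu') := by
  obtain ⟨w, hw⟩ := exists_isDominant_smul b (nu + rho b)
  have h1 := charFrac_eq_of_smul b (nu := nu) (nu' := w • (nu + rho b) + -rho b) (w := w) (by abel)
  have h2 : charFrac b nu = charFrac b (w • (nu + rho b) + -rho b) ∨
      charFrac b nu = -charFrac b (w • (nu + rho b) + -rho b) := by
    rcases neg_one_pow_eq_or (LatticeFrac R) (length b (ofWeyl w)) with h | h
    · left
      rw [h1, h, one_mul]
    · right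
      rw [h1, h, neg_one_mul, neg_neg]
  by_cases hs : ∃ i ∈ b.support, zpair (w • (nu + rho b)) i = 0
  · left
    obtain ⟨i, hi, h0⟩ := hs
    have h3 := charFrac_eq_zero b (nu := w • (nu + rho b) + -rho b) hi (by rwa [neg_add_cancel_right])
    rw [h3, neg_zero, or_self] at h2
    exact h2
  · right
    refine ⟨_, w, isDominant_of_simple fun i hi => ?_, by abel, h2⟩
    push Not at hs
    have h3 := hs i hi
    have h4 := isDominant_iff.1 hw i (b.isPos_of_mem_support hi)
    rw [zpair_add, zpair_neg, zpair_rho b hi]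
    omega

end Characters

/-! ### Expansion over sets of positive roots and triangularity. -/

section RootSums

variable {ι V N : Type*} [AddCommGroup V] [Module ℝ V] [AddCommGroup N] [Module ℝ N]
  {R : RootPairing ι ℝ V N} [Fintype ι] [R.IsRootSystem] [R.IsCrystallographic] [R.IsReduced]
  (b : R.Base)

/-- The reflection permutes the positive roots other than α_i and sends ρ to ρ − α_i, so S' is the
image of S away from α_i, with the membership of α_i reversed. -/
lemma exists_rho_sub_sum_sRefl {i : ι} (hi : i ∈ b.support) {S : Finset ι}
    (hS : S ⊆ posRoots b) :
    ∃ S' ⊆ posRoots b, sRefl R i • (rho b + -∑ j ∈ S, rootWeight R j) =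
      rho b + -∑ j ∈ S', rootWeight R j := by
  classical
  have hip : i ∈ posRoots b := (mem_posRoots b i).2 (b.isPos_of_mem_support hi)
  have himg : (S.erase i).image (R.reflectionPerm i) ⊆ (posRoots b).erase i := by
    intro k hk
    obtain ⟨j, hj, rfl⟩ := Finset.mem_image.1 hk
    exact reflectionPerm_mem_erase b hi (Finset.erase_subset_erase i hS hj)
  have hsum : ∑ j ∈ (S.erase i).image (R.reflectionPerm i), rootWeight R j =
      sRefl R i • ∑ j ∈ S.erase i, rootWeight R j := by
    rw [Finset.sum_image (fun x _ y _ h => (R.reflectionPerm i).injective h), Finset.smul_sum]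
    exact Finset.sum_congr rfl fun j _ => by rw [smul_rootWeight, wIdx_sRefl]
  have hrho : sRefl R i • rho b = rho b + -rootWeight R i := by
    rw [sRefl_smul, zpair_rho b hi, one_smul, sub_eq_add_neg]
  have hii : sRefl R i • rootWeight R i = -rootWeight R i := by
    rw [smul_rootWeight, wIdx_sRefl, rootWeight_neg_index]
  by_cases his : i ∈ S
  · refine ⟨_, himg.trans (Finset.erase_subset _ _), ?_⟩
    rw [hsum, ← Finset.add_sum_erase _ _ his, smul_add, hrho, smul_neg, smul_add, hii]
    abel
  · refine ⟨insert i ((S.erase i).image (R.reflectionPerm i)), ?_, ?_⟩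
    · exact Finset.insert_subset hip (himg.trans (Finset.erase_subset _ _))
    · rw [Finset.sum_insert fun h => Finset.notMem_erase i _ (himg h), hsum,
        Finset.erase_eq_of_notMem his, smul_add, hrho, smul_neg]
      abel

lemma exists_rho_sub_sum_smul (w : R.weylGroup) {S : Finset ι} (hS : S ⊆ posRoots b) :
    ∃ S' ⊆ posRoots b, w • (rho b + -∑ j ∈ S, rootWeight R j) =
      rho b + -∑ j ∈ S', rootWeight R j := by
  refine weyl_induction b (P := fun w => ∃ S' ⊆ posRoots b,
      w • (rho b + -∑ j ∈ S, rootWeight R j) = rho b + -∑ j ∈ S', rootWeight R j)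
    ⟨S, hS, one_smul _ _⟩ (fun i w hi _ ih => ?_) w
  obtain ⟨S', hS', h⟩ := ih
  obtain ⟨S'', hS'', h'⟩ := exists_rho_sub_sum_sRefl b hi hS'
  exact ⟨S'', hS'', by rw [mul_smul, h, h']⟩

lemma ht_sum_nonneg {S : Finset ι} (hS : S ⊆ posRoots b) :
    0 ≤ ht b (∑ j ∈ S, rootWeight R j) := by
  rw [map_sum]
  exact Finset.sum_nonneg fun j hj => (ht_rootWeight_pos b ((mem_posRoots b j).1 (hS hj))).le

lemma eq_empty_of_ht_sum {S : Finset ι} (hS : S ⊆ posRoots b)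
    (h : ht b (∑ j ∈ S, rootWeight R j) = 0) : S = ∅ := by
  by_contra hne
  rw [map_sum] at h
  have := Finset.sum_pos (fun j hj => ht_rootWeight_pos b ((mem_posRoots b j).1 (hS hj)))
    (Finset.nonempty_iff_ne_empty.2 hne)
  omega

/-- Since w(μ − ΣS + ρ) = wμ + (ρ − ΣS'), the weight ν' is wμ − ΣS'. Its height is at most that of
μ, with equality only if wμ = μ and S' is empty. -/
lemma ht_lt_or_eq {mu nu' : weightLattice R} (hmu : IsDominant b mu) {S : Finset ι}
    (hS : S ⊆ posRoots b) {w : R.weylGroup}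
    (h : nu' + rho b = w • (mu + -∑ j ∈ S, rootWeight R j + rho b)) :
    ht b nu' < ht b mu ∨ nu' = mu := by
  obtain ⟨S', hS', h'⟩ := exists_rho_sub_sum_smul b w hS
  have h1 : nu' = w • mu + -∑ j ∈ S', rootWeight R j := by
    refine add_right_cancel (b := rho b) ?_
    rw [h, add_assoc, smul_add, add_comm (-∑ j ∈ S, rootWeight R j), h']
    abel
  have h2 := ht_sum_nonneg b hS'
  have h3 := ht_smul_le hmu w
  have h4 : ht b nu' = ht b (w • mu) - ht b (∑ j ∈ S', rootWeight R j) := by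
    rw [h1, map_add, map_neg, sub_eq_add_neg]
  by_cases hlt : ht b nu' < ht b mu
  · exact Or.inl hlt
  · right
    have h5 := smul_eq_of_ht_eq hmu (w := w) (by omega)
    have h6 := eq_empty_of_ht_sum b hS' (by omega)
    rw [h1, h5, h6, Finset.sum_empty, neg_zero, add_zero]

lemma prod_mono_eq_sum (t : Coeff) (S : Finset ι) :
    ∏ i ∈ S, (-t) • (mono (-rootWeight R i) : LatticeAlg R) =
      (-t) ^ S.card • mono (-∑ i ∈ S, rootWeight R i) := by
  classical
  induction S using Finset.induction_on with
  | empty => simp [mono_zero]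
  | insert i S hi ih =>
    rw [Finset.prod_insert hi, ih, Finset.sum_insert hi, Finset.card_insert_of_notMem hi, neg_add,
      mono_add, smul_mul_smul_comm, pow_succ']

lemma prod_one_sub_mono (t : Coeff) :
    ∏ i ∈ posRoots b, (1 - t • mono (-rootWeight R i) : LatticeAlg R) =
      ∑ S ∈ (posRoots b).powerset, (-t) ^ S.card • mono (-∑ i ∈ S, rootWeight R i) := by
  classical
  simp only [sub_eq_add_neg, ← neg_smul]
  rw [Finset.prod_one_add]
  exact Finset.sum_congr rfl fun S _ => prod_mono_eq_sum t S

lemma cFactor_eq (t : Coeff) :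
    cFactor b t = toFrac R (∏ i ∈ posRoots b, (1 - t • mono (-rootWeight R i))) /
      toFrac R (rootProd b) := by
  rw [cFactor, Finset.prod_div_distrib, rootProd, map_prod, map_prod]
  congr 1
  · exact Finset.prod_congr rfl fun i _ => by rw [map_sub, map_one, toFrac_smul, toFrac_mono]
  · exact Finset.prod_congr rfl fun i _ => by rw [map_sub, map_one, toFrac_mono]

lemma sum_weylActFrac_cFactor (mu : weightLattice R) (t : Coeff) :
    ∑ w : R.weylGroup, weylActFrac w (fmono mu * cFactor b t) =
      ∑ S ∈ (posRoots b).powerset, (-t) ^ S.card •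
        charFrac b (mu + -∑ i ∈ S, rootWeight R i) := by
  have h : fmono mu * cFactor b t = ∑ S ∈ (posRoots b).powerset, (-t) ^ S.card •
      (fmono (mu + -∑ i ∈ S, rootWeight R i) / toFrac R (rootProd b)) := by
    rw [cFactor_eq, prod_one_sub_mono, map_sum, Finset.sum_div, Finset.mul_sum]
    refine Finset.sum_congr rfl fun S _ => ?_
    rw [toFrac_smul, toFrac_mono, fmono_add, mul_div_assoc, smul_div_assoc, mul_smul_comm]
  rw [h]
  simp only [map_sum, weylActFrac_smul]
  rw [Finset.sum_comm]
  exact Finset.sum_congr rfl fun S _ => (Finset.smul_sum).symm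

/-- The span of the characters below `μ` with coefficients in `q⁻¹ ℤ[q⁻¹]`. -/
def lowerChars (mu : weightLattice R) : AddSubgroup (LatticeFrac R) :=
  AddSubgroup.closure {z | ∃ d ∈ degLE (-1), ∃ nu, IsDominant b nu ∧ ht b nu < ht b mu ∧
    z = d • charFrac b nu}

/-- The empty set contributes χ_μ with coefficient 1. A nonempty S carries the factor (−q⁻²)^{|S|},
which lies in q⁻¹ℤ[q⁻¹], and its quotient straightens to 0, to ±χ_μ, or to ± a quotient of smaller
height. -/
lemma exists_triangular {mu : weightLattice R} (hmu : IsDominant b mu) :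
    ∃ c ∈ degLE (-1), ∃ y ∈ lowerChars b mu,
      ∑ w : R.weylGroup, weylActFrac w (fmono mu * cFactor b (q⁻¹ ^ 2)) =
        (1 + c) • charFrac b mu + y := by
  classical
  have key : ∀ S ∈ (posRoots b).powerset.erase ∅, ∃ c ∈ degLE (-1), ∃ y ∈ lowerChars b mu,
      (-(q⁻¹ ^ 2)) ^ S.card • charFrac b (mu + -∑ i ∈ S, rootWeight R i) =
        c • charFrac b mu + y := by
    intro S hS
    obtain ⟨hne, hS⟩ := Finset.mem_erase.1 hS
    rw [Finset.mem_powerset] at hS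
    have ht : (-(q⁻¹ ^ 2)) ^ S.card ∈ degLE (-1) := by
      rw [neg_pow, ← pow_mul]
      have hc : 0 < S.card := Finset.card_pos.2 (Finset.nonempty_iff_ne_empty.2 hne)
      have h1 := q_inv_pow_mem_degLE (n := 2 * S.card) (by omega)
      rcases neg_one_pow_eq_or Coeff S.card with h | h
      · rwa [h, one_mul]
      · rw [h, neg_one_mul]
        exact neg_mem h1
    set t := (-(q⁻¹ ^ 2)) ^ S.card
    rcases charFrac_cases b (mu + -∑ i ∈ S, rootWeight R i) with h | ⟨nu, w, hnu, hw, h⟩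
    · exact ⟨0, zero_mem _, 0, zero_mem _, by rw [h, smul_zero, zero_smul, add_zero]⟩
    · rcases ht_lt_or_eq b hmu hS hw with hlt | heq
      · refine ⟨0, zero_mem _, _, ?_, (by rw [zero_smul, zero_add])⟩
        rcases h with h | h
        · exact AddSubgroup.subset_closure ⟨t, ht, nu, hnu, hlt, by rw [h]⟩
        · exact AddSubgroup.subset_closure ⟨-t, neg_mem ht, nu, hnu, hlt,
            by rw [h, smul_neg, neg_smul]⟩
      · rcases h with h | h
        · exact ⟨t, ht, 0, zero_mem _, by rw [h, heq, add_zero]⟩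
        · exact ⟨-t, neg_mem ht, 0, zero_mem _, by rw [h, heq, smul_neg, neg_smul, add_zero]⟩
  choose! c hc y hy hcy using key
  refine ⟨∑ S ∈ (posRoots b).powerset.erase ∅, c S, sum_mem hc,
    ∑ S ∈ (posRoots b).powerset.erase ∅, y S, sum_mem hy, ?_⟩
  rw [sum_weylActFrac_cFactor, ← Finset.add_sum_erase _ _ (Finset.empty_mem_powerset _),
    Finset.card_empty, pow_zero, one_smul, Finset.sum_empty, neg_zero, add_zero, add_smul, one_smul,
    Finset.sum_smul, add_assoc, ← Finset.sum_add_distrib]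
  congr 1
  exact Finset.sum_congr rfl hcy

end RootSums

/-! ### Weyl characters: polynomiality, the denominator formula, integrality. -/

section WeylCharacter

variable {ι V N : Type*} [AddCommGroup V] [Module ℝ V] [AddCommGroup N] [Module ℝ N]
  {R : RootPairing ι ℝ V N} [Fintype ι] [R.IsRootSystem] [R.IsCrystallographic] [R.IsReduced]
  (b : R.Base)

/-- Polynomiality comes from the Hecke algebra: the symmetrization of x^μ lies in the group algebra
by `exists_symmetrization`. By induction so do the lower quotients, and the triangular relation can
be solved for χ_μ since 1 + c ≠ 0. -/
lemma exists_toFrac_eq_charFrac {mu : weightLattice R} (hmu : IsDominant b mu) :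
    ∃ f, toFrac R f = charFrac b mu := by
  induction hn : (ht b mu).toNat using Nat.strong_induction_on generalizing mu with
  | _ n ih =>
    obtain ⟨c, hc, y, hy, h⟩ := exists_triangular b hmu
    obtain ⟨g, -, hg⟩ := exists_symmetrization b (mono mu)
    have hy' : y ∈ (toFrac R).toAddMonoidHom.range := by
      refine (AddSubgroup.closure_le _).2 ?_ hy
      rintro z ⟨d, -, nu, hnu, hlt, rfl⟩
      have h0 : 0 ≤ ht b nu := by
        rw [← length_translation hnu]
        exact Int.natCast_nonneg _
      obtain ⟨f, hf⟩ := ih _ (by omega) hnu rfl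
      exact ⟨d • f, by rw [← hf]; exact toFrac_smul d f⟩
    obtain ⟨f, hf⟩ := hy'
    change toFrac R f = y at hf
    rw [toFrac_mono, h] at hg
    refine ⟨(1 + c)⁻¹ • ((q ^ (2 * (posRoots b).card))⁻¹ • g - f), ?_⟩
    rw [toFrac_smul, map_sub, toFrac_smul, hg, hf, inv_smul_smul₀ (pow_ne_zero _ q_ne_zero),
      add_sub_cancel_right, inv_smul_smul₀ (one_add_ne_zero hc)]

lemma coeff_mono_mul (lam mu : weightLattice R) (f : LatticeAlg R) :
    (mono lam * f).coeff mu = f.coeff (-lam + mu) := by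
  rw [mono, AddMonoidAlgebra.coeff_single_mul_apply, one_mul]

lemma coeff_mono (lam mu : weightLattice R) :
    (mono lam : LatticeAlg R).coeff mu = Finsupp.single lam 1 mu := rfl

lemma coeff_weylDenom : (weylDenom b).coeff (rho b) = 1 := by
  classical
  rw [weylDenom, coeff_mono_mul, neg_add_cancel]
  have h := prod_one_sub_mono b 1
  simp only [one_smul] at h
  rw [rootProd, h, AddMonoidAlgebra.coeff_sum, Finsupp.finsetSum_apply,
    Finset.sum_eq_single_of_mem ∅ (Finset.empty_mem_powerset _)]
  · rw [Finset.card_empty, pow_zero, one_smul, Finset.sum_empty, neg_zero, coeff_mono,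
      Finsupp.single_eq_same]
  · intro S hS hne
    rw [AddMonoidAlgebra.coeff_smul, Finsupp.smul_apply, coeff_mono, Finsupp.single_eq_of_ne,
      smul_zero]
    intro h0
    refine hne (eq_empty_of_ht_sum b (Finset.mem_powerset.1 hS) ?_)
    rw [neg_eq_zero.1 h0.symm, map_zero]

lemma coeff_altSum_rho : (altSum b (rho b)).coeff (rho b) = 1 := by
  classical
  rw [altSum, AddMonoidAlgebra.coeff_sum, Finsupp.finsetSum_apply,
    Finset.sum_eq_single_of_mem 1 (Finset.mem_univ _)]
  · rw [ofWeyl_one, length_one, pow_zero, one_mul, weylAct_one, coeff_mono, Finsupp.single_eq_same]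
  · intro w _ hw
    have h1 : (weylAct w (mono (rho b)) : LatticeAlg R).coeff (rho b) = 0 := by
      rw [weylAct_mono, coeff_mono, Finsupp.single_eq_of_ne]
      intro h
      refine hw (eq_one_of_isDominant (b := b) (lam := rho b) (fun i hi => ?_) ?_)
      · rw [zpair_rho b hi]; norm_num
      · rw [← h]
        exact isDominant_iff.2 fun i hi => (zpair_rho_pos b hi).le
    rcases neg_one_pow_eq_or (LatticeAlg R) (length b (ofWeyl w)) with h | h
    · rw [h, one_mul, h1]
    · rw [h, neg_one_mul, AddMonoidAlgebra.coeff_neg, Finsupp.neg_apply, h1, neg_zero]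

lemma isDominant_zero : IsDominant b 0 :=
  isDominant_iff.2 fun i _ => by simp

lemma lowerChars_zero {y : LatticeFrac R} (hy : y ∈ lowerChars b 0) : y = 0 := by
  have : lowerChars b 0 ≤ ⊥ := by
    refine (AddSubgroup.closure_le _).2 ?_
    rintro z ⟨d, -, nu, hnu, hlt, rfl⟩
    have h0 : 0 ≤ ht b nu := by
      rw [← length_translation hnu]
      exact Int.natCast_nonneg _
    rw [map_zero] at hlt
    omega
  exact this hy

/-- The Weyl denominator formula. -/
theorem altSum_rho : altSum b (rho b) = weylDenom b := by
  obtain ⟨c, hc, y, hy, h⟩ := exists_triangular b (isDominant_zero b)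
  obtain ⟨g, hg, hg'⟩ := exists_symmetrization b (mono 0)
  rw [mono_zero, map_one, one_mul, sphSum_mul_self] at hg
  -- For μ = 0 the product `sphSum`·`sphSum` is a scalar times `sphSum`; injectivity makes the
  -- symmetrization of 1, and hence χ_0, a scalar.
  have h1 : g = poincare b 0 (q ^ 2) • 1 := by
    refine latHom_mul_sphSum_inj (b := b) ?_
    rw [← hg, map_smul, map_one, smul_mul_assoc, one_mul]
  rw [toFrac_mono, h, lowerChars_zero b hy, add_zero, h1, toFrac_smul, map_one, smul_smul] at hg'
  have hne : q ^ (2 * (posRoots b).card) * (1 + c) ≠ 0 :=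
    mul_ne_zero (pow_ne_zero _ q_ne_zero) (one_add_ne_zero hc)
  have h2 : charFrac b 0 =
      ((q ^ (2 * (posRoots b).card) * (1 + c))⁻¹ * poincare b 0 (q ^ 2)) • 1 := by
    rw [← smul_smul, hg', inv_smul_smul₀ hne]
  set k := (q ^ (2 * (posRoots b).card) * (1 + c))⁻¹ * poincare b 0 (q ^ 2)
  have h3 := charFrac_mul_weylDenom b 0
  rw [h2, smul_mul_assoc, one_mul, ← toFrac_smul, zero_add] at h3
  have h4 := toFrac_injective h3
  -- Both `weylDenom` and the alternating sum have coefficient 1 at x^ρ, so the scalar is 1.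
  have h5 := congrArg (fun f : LatticeAlg R => f.coeff (rho b)) h4
  rw [AddMonoidAlgebra.coeff_smul, Finsupp.smul_apply, coeff_weylDenom, coeff_altSum_rho,
    smul_eq_mul, mul_one] at h5
  rw [← h4, h5, one_smul]

lemma weylCharacter_eq (lam : weightLattice R) : weylCharacter b lam = charFrac b lam := by
  have hD : toFrac R (weylDenom b) ≠ 0 := fun h =>
    weylDenom_ne_zero b (toFrac_injective (by rw [h, map_zero]))
  rw [weylCharacter, altSum_rho, div_eq_iff hD, charFrac_mul_weylDenom]

/-- The elements of the group algebra with integer coefficients. -/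
def intLattice (R : RootPairing ι ℝ V N) : AddSubgroup (LatticeAlg R) where
  carrier := {f | ∀ lam, ∃ n : ℤ, f.coeff lam = n}
  zero_mem' := fun _ => ⟨0, by simp⟩
  add_mem' := by
    intro f g hf hg lam
    obtain ⟨m, hm⟩ := hf lam
    obtain ⟨n, hn⟩ := hg lam
    exact ⟨m + n, by rw [AddMonoidAlgebra.coeff_add, Finsupp.add_apply, hm, hn, Int.cast_add]⟩
  neg_mem' := by
    intro f hf lam
    obtain ⟨m, hm⟩ := hf lam
    exact ⟨-m, by rw [AddMonoidAlgebra.coeff_neg, Finsupp.neg_apply, hm, Int.cast_neg]⟩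

lemma mono_mem_intLattice (lam : weightLattice R) : mono lam ∈ intLattice R := fun mu => by
  classical
  rw [coeff_mono, Finsupp.single_apply]
  split_ifs
  · exact ⟨1, by simp⟩
  · exact ⟨0, by simp⟩

lemma altSum_mem_intLattice (mu : weightLattice R) : altSum b mu ∈ intLattice R := by
  rw [altSum]
  refine sum_mem fun w _ => ?_
  rw [weylAct_mono]
  rcases neg_one_pow_eq_or (LatticeAlg R) (length b (ofWeyl w)) with h | h
  · rw [h, one_mul]
    exact mono_mem_intLattice _
  · rw [h, neg_one_mul]
    exact neg_mem (mono_mem_intLattice _)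

lemma mem_intLattice_of_mono_mul {lam : weightLattice R} {f : LatticeAlg R}
    (h : mono lam * f ∈ intLattice R) : f ∈ intLattice R := fun mu => by
  obtain ⟨n, hn⟩ := h (lam + mu)
  rw [coeff_mono_mul, neg_add_cancel_left] at hn
  exact ⟨n, hn⟩

/-- Modulo integers the coefficients of f at λ and λ + α agree. A nonintegral coefficient of
greatest height would thus give another at greater height. -/
lemma mem_intLattice_of_one_sub_mul {i : ι} (hi : b.IsPos i) {f : LatticeAlg R}
    (h : (1 - mono (-rootWeight R i)) * f ∈ intLattice R) : f ∈ intLattice R := by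
  classical
  have hrec : ∀ lam, ∃ n : ℤ, f.coeff lam = n + f.coeff (rootWeight R i + lam) := fun lam => by
    obtain ⟨n, hn⟩ := h lam
    rw [sub_mul, one_mul, AddMonoidAlgebra.coeff_sub, Finsupp.sub_apply, coeff_mono_mul,
      neg_neg] at hn
    exact ⟨n, by rw [← hn, sub_add_cancel]⟩
  by_contra hf
  set B := f.coeff.support.filter fun lam => ¬ ∃ n : ℤ, f.coeff lam = n with hB
  have hBne : B.Nonempty := by
    have : ∃ lam, ¬ ∃ n : ℤ, f.coeff lam = n := by
      by_contra hall
      push Not at hall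
      exact hf hall
    obtain ⟨lam, hlam⟩ := this
    refine ⟨lam, Finset.mem_filter.2 ⟨Finsupp.mem_support_iff.2 fun h0 => hlam ⟨0, ?_⟩, hlam⟩⟩
    rw [h0, Int.cast_zero]
  obtain ⟨lam, hlam, hmax⟩ := B.exists_max_image (ht b) hBne
  refine (Finset.mem_filter.1 hlam).2 ?_
  obtain ⟨n, hn⟩ := hrec lam
  by_cases hB' : rootWeight R i + lam ∈ B
  · have h1 := hmax _ hB'
    rw [map_add] at h1
    have h2 := ht_rootWeight_pos b hi
    omega
  · have h1 : ∃ m : ℤ, f.coeff (rootWeight R i + lam) = m := by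
      by_contra hno
      refine hB' (Finset.mem_filter.2 ⟨Finsupp.mem_support_iff.2 fun h0 => hno ⟨0, ?_⟩, hno⟩)
      rw [h0, Int.cast_zero]
    obtain ⟨m, hm⟩ := h1
    exact ⟨n + m, by rw [hn, hm, Int.cast_add]⟩

lemma mem_intLattice_of_weylDenom_mul {f : LatticeAlg R}
    (h : weylDenom b * f ∈ intLattice R) : f ∈ intLattice R := by
  classical
  rw [weylDenom, mul_assoc] at h
  have h1 := mem_intLattice_of_mono_mul h
  have key : ∀ S : Finset ι, S ⊆ posRoots b → ∀ f : LatticeAlg R,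
      (∏ i ∈ S, (1 - mono (-rootWeight R i))) * f ∈ intLattice R → f ∈ intLattice R := by
    intro S
    induction S using Finset.induction_on with
    | empty => intro _ f hf; simpa using hf
    | insert i S hi ih =>
      intro hS f hf
      rw [Finset.prod_insert hi, mul_assoc] at hf
      exact ih ((Finset.subset_insert _ _).trans hS) _ (mem_intLattice_of_one_sub_mul b
        ((mem_posRoots b i).1 (hS (Finset.mem_insert_self _ _))) hf)
  exact key _ subset_rfl f h1

lemma charFrac_integral {mu : weightLattice R} {f : LatticeAlg R}
    (hf : toFrac R f = charFrac b mu) : f ∈ intLattice R := by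
  refine mem_intLattice_of_weylDenom_mul b ?_
  have h : weylDenom b * f = altSum b (mu + rho b) := by
    refine toFrac_injective ?_
    rw [map_mul, hf, mul_comm, charFrac_mul_weylDenom]
  rw [h]
  exact altSum_mem_intLattice b _

lemma charFrac_invariant {mu : weightLattice R} {f : LatticeAlg R}
    (hf : toFrac R f = charFrac b mu) (w : R.weylGroup) : weylAct w f = f := by
  refine toFrac_injective ?_
  rw [← weylActFrac_toFrac, hf, weylActFrac_charFrac]

end WeylCharacter

/-! ### The filtration of the Hecke algebra by degree in q. -/

section DegreeFiltration

lemma add_neg_one_smul_add {K M : Type*} [CommRing K] [AddCommMonoid M] [Module K M] (x t : M) :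
    x + (-1 : K) • t + t = x := by
  module

lemma one_add_smul_add_neg_one_smul {K M : Type*} [CommRing K] [AddCommMonoid M] [Module K M]
    (c : K) (x y t : M) :
    (1 + c) • (x + (-1 : K) • t) =
      ((1 + c) • x + y + (-1 : K) • t) + (-c) • t + (-1 : K) • y := by
  module

/-- Writing a = (1 + c)a − ca lowers the degree bound on `a` one unit at a time until it reaches d.
That `a` is a Laurent polynomial is needed to start the descent. -/
lemma mem_degLE_of_one_add_mul {a c : Coeff} {d : ℤ} (ha : a ∈ laurentPart) (hc : c ∈ degLE (-1))
    (h : (1 + c) * a ∈ degLE d) : a ∈ degLE d := by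
  obtain ⟨e, he⟩ := mem_laurentPart.1 ha
  have key : ∀ k : ℕ, a ∈ degLE (d + k) → a ∈ degLE d := by
    intro k
    induction k with
    | zero => intro h; simpa using h
    | succ k ih =>
      intro hk
      refine ih ?_
      have h1 : a = (1 + c) * a - c * a := by ring
      rw [h1]
      refine sub_mem (degLE_mono (by omega) h) ?_
      have h2 := mul_mem_degLE hc hk
      exact degLE_mono (by push_cast; omega) h2
  refine key (e - d).toNat (degLE_mono (by omega) he)

variable {ι V N : Type*} [AddCommGroup V] [Module ℝ V] [AddCommGroup N] [Module ℝ N]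
  {R : RootPairing ι ℝ V N} [R.IsCrystallographic] [Fintype ι] [R.IsReduced]

/-- The elements of the Hecke algebra with coefficients in `q^d ℤ[q⁻¹]`. -/
def heckeDeg (b : R.Base) (d : ℤ) : AddSubgroup (Hecke b) where
  carrier := {x | ∀ y, (heckeBasis b).repr x y ∈ degLE d}
  zero_mem' := fun y => by
    rw [map_zero]
    exact zero_mem _
  add_mem' := fun {x z} hx hz y => by
    rw [map_add, Finsupp.add_apply]
    exact add_mem (hx y) (hz y)
  neg_mem' := fun {x} hx y => by
    rw [map_neg, Finsupp.neg_apply]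
    exact neg_mem (hx y)

variable {b : R.Base}

lemma heckeDeg_mono {d e : ℤ} (h : d ≤ e) : heckeDeg b d ≤ heckeDeg b e :=
  fun _ hx y => degLE_mono h (hx y)

lemma smul_mem_heckeDeg {c : Coeff} {d e : ℤ} (hc : c ∈ degLE d) {x : Hecke b}
    (hx : x ∈ heckeDeg b e) : c • x ∈ heckeDeg b (d + e) := fun y => by
  rw [map_smul, Finsupp.smul_apply]
  exact mul_mem_degLE hc (hx y)

lemma T_mem_heckeDeg (w : ExtWeyl R) : T b w ∈ heckeDeg b 0 := fun y => by
  classical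
  rw [heckeBasis_repr_T, Finsupp.single_apply]
  split_ifs
  · exact one_mem_degLE
  · exact zero_mem _

lemma neg_one_smul_mem_heckeDeg {d : ℤ} {x : Hecke b} (hx : x ∈ heckeDeg b d) :
    (-1 : Coeff) • x ∈ heckeDeg b d := by
  have := smul_mem_heckeDeg (neg_mem one_mem_degLE) hx
  rwa [zero_add] at this

lemma qpow_mem_degLE (n : ℕ) : q ^ n ∈ degLE n := by
  rw [← zpow_natCast]
  exact zpow_mem_degLE _

end DegreeFiltration

/-! ### Cosets of W and the top-degree terms of E x^μ E, for E = `sphSum`. -/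

section Cosets

variable {ι V N : Type*} [AddCommGroup V] [Module ℝ V] [AddCommGroup N] [Module ℝ N]
  {R : RootPairing ι ℝ V N} [Fintype ι] [R.IsRootSystem] [R.IsCrystallographic] [R.IsReduced]
  {b : R.Base}

lemma affPos_of_forall_simple {g : ExtWeyl R}
    (h : ∀ i ∈ b.support, AffPos b (affRootAct g (i, 0))) {j : ι} (hj : b.IsPos j) :
    AffPos b (affRootAct g (j, 0)) := by
  obtain ⟨x, hx⟩ := exists_mem_alcove b
  have h1 : ∀ i, affEval R (affRootAct g (i, 0)) x =
      R.toLinearMap (affAct g⁻¹ x) (R.coroot i) := fun i => by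
    rw [affEval_act', affEval, Int.cast_zero, sub_zero]
    rfl
  by_contra hn
  have h2 := affEval_neg_of_not_affPos hn hx
  rw [h1] at h2
  have h3 : ∀ y ∈ AddSubmonoid.closure (R.coroot '' b.support),
      0 ≤ R.toLinearMap (affAct g⁻¹ x) y := by
    intro y hy
    induction hy using AddSubmonoid.closure_induction with
    | mem y hy =>
      obtain ⟨i, hi, rfl⟩ := hy
      rw [← h1]
      exact ((h i hi).affEval_pos hx).le
    | zero => rw [map_zero]
    | add y z _ _ hy hz =>
      rw [map_add]
      exact add_nonneg hy hz
  exact absurd (h3 _ (coroot_mem_closure hj)) (not_le.2 h2)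

lemma length_mul_ofWeyl_of_minimal {m : ExtWeyl R}
    (h : ∀ i ∈ b.support, AffPos b (affRootAct m (i, 0))) (u : R.weylGroup) :
    length b (m * ofWeyl u) = length b m + length b (ofWeyl u) := by
  have key : ∀ w : R.weylGroup,
      length b (m * ofWeyl w⁻¹) = length b m + length b (ofWeyl w⁻¹) := by
    refine weyl_induction b ?_ fun i w hi hlen ih => ?_
    · rw [inv_one, ofWeyl_one, mul_one, length_one, add_zero]
    · have hS := isSimpleReflection_sRefl hi
      have h1 : length b (ofWeyl (sRefl R i * w)⁻¹) = length b (ofWeyl w⁻¹) + 1 := by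
        rw [ofWeyl_inv, length_inv, hlen, ofWeyl_inv, length_inv]
      rw [h1]
      rw [mul_inv_rev, sRefl_inv] at h1 ⊢
      have hpos : b.IsPos (wIdx w⁻¹ i) := by
        have := (length_ofWeyl_mul_sRefl_lt_iff b hi w⁻¹).not.1 (by omega)
        simpa using this
      have h2 : AffPos b (affRootAct (m * ofWeyl w⁻¹) (i, 0)) := by
        rw [affRootAct_mul, affRootAct_ofWeyl]
        exact affPos_of_forall_simple h hpos
      have h3 := (length_mul_sRefl_lt_iff hi (m * ofWeyl w⁻¹)).not.2 (not_not.2 h2)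
      have h4 := (lengthSystem b).step_right hS (m * ofWeyl w⁻¹)
      rw [ofWeyl_mul, ← mul_assoc]
      omega
  have := key u⁻¹
  rwa [inv_inv] at this

/-- A shortest element m of gW keeps the simple roots positive, hence all positive roots, and
lengths then add along mW. -/
lemma exists_coset_decomposition (b : R.Base) (g : ExtWeyl R) :
    ∃ (m : ExtWeyl R) (v : R.weylGroup), g = m * ofWeyl v ∧
      ∀ u, length b (m * ofWeyl u) = length b m + length b (ofWeyl u) := by
  obtain ⟨u, -, hu⟩ := Finset.exists_min_image (Finset.univ : Finset R.weylGroup)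
    (fun u => length b (g * ofWeyl u)) Finset.univ_nonempty
  refine ⟨g * ofWeyl u, u⁻¹, ?_, length_mul_ofWeyl_of_minimal fun i hi => ?_⟩
  · rw [ofWeyl_inv, mul_inv_cancel_right]
  · by_contra hn
    have h1 := (length_mul_sRefl_lt_iff hi (g * ofWeyl u)).2 hn
    have h2 := hu (u * sRefl R i) (Finset.mem_univ _)
    rw [ofWeyl_mul, ← mul_assoc] at h2
    omega

lemma T_mul_sphSum {m : ExtWeyl R}
    (hm : ∀ u : R.weylGroup, length b (m * ofWeyl u) = length b m + length b (ofWeyl u))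
    (v : R.weylGroup) :
    T b (m * ofWeyl v) * sphSum b = q ^ length b (ofWeyl v) •
      ∑ u : R.weylGroup, q ^ length b (ofWeyl u) • T b (m * ofWeyl u) := by
  rw [← T_mul (hm v), mul_assoc, T_ofWeyl_mul_sphSum, mul_smul_comm, sphSum, Finset.mul_sum]
  congr 1
  refine Finset.sum_congr rfl fun u _ => ?_
  rw [mul_smul_comm, T_mul (hm u)]

lemma length_ofWeyl_le (b : R.Base) (w : R.weylGroup) :
    length b (ofWeyl w) ≤ (posRoots b).card := by
  have := length_longest_mul b w
  omega

lemma T_mul_sphSum_mem (g : ExtWeyl R) :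
    T b g * sphSum b ∈ heckeDeg b (2 * (posRoots b).card) := by
  obtain ⟨m, v, rfl, hm⟩ := exists_coset_decomposition b g
  rw [T_mul_sphSum hm, Finset.smul_sum]
  refine sum_mem fun u _ => ?_
  refine heckeDeg_mono ?_ (smul_mem_heckeDeg (qpow_mem_degLE _)
    (smul_mem_heckeDeg (qpow_mem_degLE _) (T_mem_heckeDeg _)))
  have h1 := length_ofWeyl_le b u
  have h2 := length_ofWeyl_le b v
  omega

lemma eq_longest_of_forall {v : R.weylGroup}
    (h : ∀ i ∈ b.support, ¬ b.IsPos (wIdx v i)) : v = longest b := by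
  classical
  by_contra hne
  have h1 := length_lt_of_ne_longest b hne
  rw [length_ofWeyl, Finset.filter_true_of_mem] at h1
  · exact lt_irrefl _ h1
  · intro i hi
    exact isPos_of_forall_simple b h ((mem_posRoots b i).1 hi)

/-- With g = mv the exponents of q are ℓ(v) + ℓ(u). Here g is longest in its coset, so v = w₀, and
2N is attained only at u = w₀, where the basis element is T_g itself. -/
lemma T_mul_sphSum_of_maximal {g : ExtWeyl R}
    (h : ∀ i ∈ b.support, length b (g * ofWeyl (sRefl R i)) < length b g) :
    T b g * sphSum b + (-q ^ (2 * (posRoots b).card)) • T b g ∈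
      heckeDeg b (2 * (posRoots b).card - 1) := by
  classical
  obtain ⟨m, v, rfl, hm⟩ := exists_coset_decomposition b g
  have hv : v = longest b := by
    refine eq_longest_of_forall fun i hi => ?_
    rw [← length_ofWeyl_mul_sRefl_lt_iff b hi]
    have h1 := h i hi
    rw [mul_assoc, ← ofWeyl_mul, hm, hm] at h1
    omega
  rw [hv, T_mul_sphSum hm, length_longest, ← Finset.add_sum_erase _ _ (Finset.mem_univ (longest b)),
    smul_add, smul_smul, length_longest, ← pow_add, ← two_mul, add_right_comm, ← add_smul,
    add_neg_cancel, zero_smul, zero_add, Finset.smul_sum]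
  refine sum_mem fun u hu => ?_
  refine heckeDeg_mono ?_ (smul_mem_heckeDeg (qpow_mem_degLE _)
    (smul_mem_heckeDeg (qpow_mem_degLE _) (T_mem_heckeDeg _)))
  have h1 := length_lt_of_ne_longest b (Finset.mem_erase.1 hu).1
  omega

lemma length_longest_translation_mul_sRefl {mu : weightLattice R} (hmu : IsDominant b mu) {i : ι}
    (hi : i ∈ b.support) :
    length b (ofWeyl (longest b) * translation mu * ofWeyl (sRefl R i)) <
      length b (ofWeyl (longest b) * translation mu) := by
  rw [length_mul_sRefl_lt_iff hi, affRootAct_mul, affRootAct_translation, affRootAct_ofWeyl]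
  have h1 := isDominant_iff.1 hmu i (b.isPos_of_mem_support hi)
  have h2 : ¬ b.IsPos (wIdx (longest b) i) := by
    rw [isPos_longest, not_not]
    exact b.isPos_of_mem_support hi
  simp only [AffPos, h2, false_and, not_false_eq_true, true_and, false_or, zero_add]
  omega

/-- The left symmetrizer contributes degree at most N and the right one at most 2N. Degree 3N occurs
only for u = w₀, and w₀t_μ is longest in its right W-coset. -/
lemma sphSum_mul_heckeX_mul_sphSum {mu : weightLattice R} (hmu : IsDominant b mu) :
    sphSum b * (heckeX b mu * sphSum b) +
      (-q ^ (3 * (posRoots b).card)) • T b (ofWeyl (longest b) * translation mu) ∈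
      heckeDeg b (3 * (posRoots b).card - 1) := by
  classical
  have h1 : sphSum b * (heckeX b mu * sphSum b) = ∑ u : R.weylGroup,
      q ^ length b (ofWeyl u) • (T b (ofWeyl u * translation mu) * sphSum b) := by
    rw [← mul_assoc, heckeX_of_isDominant hmu]
    conv_lhs => enter [1]; rw [sphSum, Finset.sum_mul]
    rw [Finset.sum_mul]
    refine Finset.sum_congr rfl fun u _ => ?_
    rw [smul_mul_assoc, smul_mul_assoc, T_mul]
    zify
    rw [length_ofWeyl_mul_translation u hmu, length_translation hmu]
  rw [h1, ← Finset.add_sum_erase _ _ (Finset.mem_univ (longest b)), add_right_comm]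
  refine add_mem ?_ (sum_mem fun u hu => ?_)
  · have h2 := T_mul_sphSum_of_maximal (b := b)
      (g := ofWeyl (longest b) * translation mu)
      fun i hi => length_longest_translation_mul_sRefl hmu hi
    have h3 := smul_mem_heckeDeg (qpow_mem_degLE (posRoots b).card) h2
    rw [smul_add, smul_smul, mul_neg, ← pow_add] at h3
    rw [length_longest]
    have e : (posRoots b).card + 2 * (posRoots b).card = 3 * (posRoots b).card := by ring
    rw [e] at h3
    exact heckeDeg_mono (by omega) h3
  · have h2 := length_lt_of_ne_longest b (Finset.mem_erase.1 hu).1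
    exact heckeDeg_mono (by omega) (smul_mem_heckeDeg (qpow_mem_degLE _) (T_mul_sphSum_mem _))

end Cosets

/-! ### Stability of the ℤ[q, q⁻¹]-form of the Hecke algebra. -/

section Integrality

variable {ι V N : Type*} [AddCommGroup V] [Module ℝ V] [AddCommGroup N] [Module ℝ N]
  {R : RootPairing ι ℝ V N} [Fintype ι] [R.IsRootSystem] [R.IsCrystallographic] [R.IsReduced]
  {b : R.Base}

lemma T_zero_mul_mem_heckeLattice {o : ExtWeyl R} (ho : length b o = 0) {x : Hecke b}
    (hx : x ∈ heckeLattice b Set.univ) : T b o * x ∈ heckeLattice b Set.univ := by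
  refine map_mem_heckeLattice (LinearMap.mulLeft Coeff (T b o)) (fun y _ => ?_) hx
  rw [LinearMap.mulLeft_apply, T_zero_mul ho]
  exact T_mem_heckeLattice (Set.mem_univ _)

lemma T_mul_mem_heckeLattice (w : ExtWeyl R) {x : Hecke b}
    (hx : x ∈ heckeLattice b Set.univ) : T b w * x ∈ heckeLattice b Set.univ := by
  refine length_induction (b := b) (P := fun w => T b w * x ∈ heckeLattice b Set.univ)
    (fun o ho => T_zero_mul_mem_heckeLattice ho hx) (fun s w hs hlen ih => ?_) w
  rw [← T_simple_mul hs (by omega), mul_assoc]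
  exact T_simple_mul_mem_heckeLattice hs (fun _ _ => Set.mem_univ _) (fun _ _ => Set.mem_univ _) ih

lemma inverse_T_mul_mem_heckeLattice (w : ExtWeyl R) {x : Hecke b}
    (hx : x ∈ heckeLattice b Set.univ) : Ring.inverse (T b w) * x ∈ heckeLattice b Set.univ := by
  refine length_induction (b := b)
    (P := fun w => ∀ x ∈ heckeLattice b Set.univ, Ring.inverse (T b w) * x ∈ heckeLattice b Set.univ)
    (fun o ho x hx => ?_) (fun s w hs hlen ih x hx => ?_) w x hx
  · have h1 : Ring.inverse (T b o) = T b o⁻¹ := by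
      refine (isUnit_T b o).mul_left_cancel ?_
      rw [T_mul_inverse, T_zero_mul_inv ho]
    rw [h1]
    exact T_mul_mem_heckeLattice _ hx
  · rw [← T_inverse_mul_rev (by rw [hlen, hs.2, add_comm]), mul_assoc]
    refine ih _ ?_
    rw [T_inverse_simple hs, add_mul, smul_mul_assoc, one_mul]
    exact add_mem (T_mul_mem_heckeLattice _ hx)
      (smul_mem_heckeLattice (sub_mem q_inv_mem_laurentPart q_mem_laurentPart) hx)

lemma sphSum_mem_heckeLattice : sphSum b ∈ heckeLattice b Set.univ :=
  sum_mem fun _ _ => smul_mem_heckeLattice (pow_mem q_mem_laurentPart _)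
    (T_mem_heckeLattice (Set.mem_univ _))

lemma latHom_mul_mem_heckeLattice {f : LatticeAlg R} (hf : f ∈ intLattice R) {x : Hecke b}
    (hx : x ∈ heckeLattice b Set.univ) : latHom b f * x ∈ heckeLattice b Set.univ := by
  rw [← latHom_eq, latticeToHecke, Finsupp.sum, Finset.sum_mul]
  refine sum_mem fun lam _ => ?_
  obtain ⟨n, hn⟩ := hf lam
  rw [smul_mul_assoc, hn]
  refine smul_mem_heckeLattice (intCast_mem _ n) ?_
  rw [heckeX, mul_assoc]
  exact T_mul_mem_heckeLattice _ (inverse_T_mul_mem_heckeLattice _ hx)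

end Integrality

/-! ### The leading term of q^{−ℓ(w₀)} χ_μ `sphSum`. -/

section LeadingTerm

variable {ι V N : Type*} [AddCommGroup V] [Module ℝ V] [AddCommGroup N] [Module ℝ N]
  {R : RootPairing ι ℝ V N} [Fintype ι] [R.IsRootSystem] [R.IsCrystallographic] [R.IsReduced]
  (b : R.Base)

/-- The element `q^{-ℓ(w₀)} f ∑ q^{ℓ(w)} T_w`. -/
def charElt (f : LatticeAlg R) : Hecke b :=
  (q⁻¹ ^ (posRoots b).card) • (latHom b f * sphSum b)

lemma charElt_add (f g : LatticeAlg R) : charElt b (f + g) = charElt b f + charElt b g := by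
  rw [charElt, map_add, add_mul, smul_add, charElt, charElt]

lemma charElt_smul (c : Coeff) (f : LatticeAlg R) : charElt b (c • f) = c • charElt b f := by
  rw [charElt, map_smul, smul_mul_assoc, smul_comm, charElt]

/-- Dividing the triangular expansion by q^{3N} shows that (1 + c)`charElt` f plus lower terms is
T_n modulo coefficients in q⁻¹ℤ[q⁻¹]. The lower terms are negligible by induction, and integrality
of χ_μ allows the factor 1 + c to be removed. -/
theorem charElt_sub_T_mem {mu : weightLattice R} (hmu : IsDominant b mu) {f : LatticeAlg R}
    (hf : toFrac R f = charFrac b mu) :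
    charElt b f + (-1 : Coeff) • T b (ofWeyl (longest b) * translation mu) ∈ heckeDeg b (-1) := by
  induction hn : (ht b mu).toNat using Nat.strong_induction_on generalizing mu f with
  | _ n ih =>
    obtain ⟨c, hc, y, hy, h⟩ := exists_triangular b hmu
    obtain ⟨g, hg, hg'⟩ := exists_symmetrization b (mono mu)
    have hlow : ∃ e, toFrac R e = y ∧ charElt b e ∈ heckeDeg b (-1) := by
      refine AddSubgroup.closure_induction
        (p := fun y _ => ∃ e, toFrac R e = y ∧ charElt b e ∈ heckeDeg b (-1)) ?_ ?_ ?_ ?_ hy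
      · rintro z ⟨d, hd, nu, hnu, hlt, rfl⟩
        have h0 : 0 ≤ ht b nu := by
          rw [← length_translation hnu]
          exact Int.natCast_nonneg _
        obtain ⟨e, he⟩ := exists_toFrac_eq_charFrac b hnu
        refine ⟨d • e, by rw [toFrac_smul, he], ?_⟩
        rw [charElt_smul]
        -- By induction the element for ν has coefficients in ℤ[q⁻¹]; the factor d brings them into
        -- q⁻¹ℤ[q⁻¹].
        have h1 := heckeDeg_mono (show (-1 : ℤ) ≤ 0 by omega) (ih _ (by omega) hnu he rfl)
        have h2 := add_mem h1 (T_mem_heckeDeg (b := b) (ofWeyl (longest b) * translation nu))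
        rw [add_neg_one_smul_add] at h2
        exact heckeDeg_mono (by omega) (smul_mem_heckeDeg hd h2)
      · refine ⟨0, map_zero _, ?_⟩
        rw [charElt, map_zero, zero_mul, smul_zero]
        exact zero_mem _
      · rintro x z - - ⟨e, he, he'⟩ ⟨e', h1, h1'⟩
        exact ⟨e + e', by rw [map_add, he, h1], by rw [charElt_add]; exact add_mem he' h1'⟩
      · rintro x - ⟨e, he, he'⟩
        refine ⟨(-1 : Coeff) • e, by rw [toFrac_smul, he, neg_one_smul], ?_⟩
        rw [charElt_smul]
        exact neg_one_smul_mem_heckeDeg he'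
    obtain ⟨e, he, he'⟩ := hlow
    have hge : g = q ^ (2 * (posRoots b).card) • ((1 + c) • f + e) := by
      refine toFrac_injective ?_
      rw [hg', toFrac_mono, h, toFrac_smul, map_add, toFrac_smul, hf, he]
    have hq := q_ne_zero
    have h1 : (1 + c) • charElt b f + charElt b e =
        q ^ (-(3 * (posRoots b).card : ℤ)) • (sphSum b * (heckeX b mu * sphSum b)) := by
      rw [← latHom_mono, hg, hge, ← charElt_smul, ← charElt_add, charElt, map_smul, smul_mul_assoc,
        smul_smul]
      congr 1
      rw [inv_pow, ← zpow_natCast, ← zpow_natCast, ← zpow_neg, ← zpow_add₀ hq]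
      congr 1
      push_cast
      ring
    have h2 := smul_mem_heckeDeg (zpow_mem_degLE (-(3 * (posRoots b).card : ℤ)))
      (sphSum_mul_heckeX_mul_sphSum hmu)
    rw [smul_add, ← h1, smul_smul, mul_neg, ← zpow_natCast, ← zpow_add₀ hq] at h2
    have e0 : (-(3 * (posRoots b).card : ℤ)) + ((3 * (posRoots b).card : ℕ) : ℤ) = 0 := by
      push_cast; ring
    rw [e0, zpow_zero] at h2
    have h3 := heckeDeg_mono (show _ ≤ (-1 : ℤ) by omega) h2
    set n := ofWeyl (longest b) * translation mu
    have h4 : (1 + c) • (charElt b f + (-1 : Coeff) • T b n) ∈ heckeDeg b (-1) := by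
      rw [one_add_smul_add_neg_one_smul c _ (charElt b e)]
      refine add_mem (add_mem h3 ?_) ?_
      · exact heckeDeg_mono (by omega) (smul_mem_heckeDeg (neg_mem hc) (T_mem_heckeDeg n))
      · exact neg_one_smul_mem_heckeDeg he'
    have hint : charElt b f + (-1 : Coeff) • T b n ∈ heckeLattice b Set.univ := by
      refine add_mem (smul_mem_heckeLattice (pow_mem q_inv_mem_laurentPart _)
        (latHom_mul_mem_heckeLattice (charFrac_integral b hf) sphSum_mem_heckeLattice)) ?_
      exact smul_mem_heckeLattice (neg_mem (one_mem _)) (T_mem_heckeLattice (Set.mem_univ _))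
    intro y
    refine mem_degLE_of_one_add_mul (hint y).1 hc ?_
    have := h4 y
    rwa [map_smul, Finsupp.smul_apply] at this

end LeadingTerm

/-! ### Bar invariance of q^{−ℓ(w₀)} f `sphSum` for integral W-invariant f. -/

section BarInvariance

variable {ι V N : Type*} [AddCommGroup V] [Module ℝ V] [AddCommGroup N] [Module ℝ N]
  {R : RootPairing ι ℝ V N} [Fintype ι] [R.IsRootSystem] [R.IsCrystallographic] [R.IsReduced]
  {b : R.Base}

lemma sphSum_mul_T_ofWeyl (w : R.weylGroup) :
    sphSum b * T b (ofWeyl w) = q ^ length b (ofWeyl w) • sphSum b := by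
  refine weyl_induction b
    (P := fun w => sphSum b * T b (ofWeyl w) = q ^ length b (ofWeyl w) • sphSum b)
    ?_ (fun i w hi hlen ih => ?_) w
  · rw [ofWeyl_one, T_one, mul_one, length_one, pow_zero, one_smul]
  · rw [hlen, ofWeyl_mul, ← T_simple_mul (isSimpleReflection_sRefl hi)
      (by rw [← ofWeyl_mul]; omega), ← mul_assoc, sphSum_mul_T_sRefl hi, smul_mul_assoc, ih,
      smul_smul, pow_succ']

lemma sphSum_mul_inverse_T (w : R.weylGroup) :
    sphSum b * Ring.inverse (T b (ofWeyl w)) = q⁻¹ ^ length b (ofWeyl w) • sphSum b := by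
  refine (isUnit_T b (ofWeyl w)).mul_right_cancel ?_
  rw [mul_assoc, T_inverse_mul, mul_one, smul_mul_assoc, sphSum_mul_T_ofWeyl, smul_smul, ← mul_pow,
    inv_mul_cancel₀ q_ne_zero, one_pow, one_smul]

lemma coeffBar_q_pow (n : ℕ) : coeffBar (q ^ n) = q⁻¹ ^ n := by
  rw [map_pow, coeffBar_q]

/-- The image is again an eigenvector of every T_{s_i} with eigenvalue q. Computing
`sphSum`·bar(`sphSum`) from the left factor and from the right factor then determines the scalar. -/
lemma IsBarInvolution.map_sphSum {bar : Hecke b ≃+* Hecke b} (hb : IsBarInvolution b bar) :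
    bar (sphSum b) = q⁻¹ ^ (2 * (posRoots b).card) • sphSum b := by
  have h1 : ∀ i ∈ b.support,
      T b (ofWeyl (sRefl R i)) * bar (sphSum b) = q • bar (sphSum b) := fun i hi => by
    have h := congrArg bar (T_sRefl_mul_sphSum hi)
    rw [map_mul, hb.map_T_simple (isSimpleReflection_sRefl hi), hb.apply_smul, coeffBar_q, add_mul,
      smul_mul_assoc, one_mul] at h
    have h2 := congrArg (· + (q - q⁻¹) • bar (sphSum b)) h
    rw [add_assoc, ← add_smul, ← add_smul, sub_add_sub_cancel, sub_self, zero_smul, add_zero,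
      add_sub_cancel] at h2
    exact h2
  have h2 := sphSum_mul_of_eigen h1
  have h3 : sphSum b * bar (sphSum b) = poincare b 0 (q⁻¹ ^ 2) • sphSum b := by
    conv_lhs => enter [2]; rw [sphSum, map_sum]
    rw [Finset.mul_sum, poincare_zero, Finset.sum_smul]
    refine Finset.sum_congr rfl fun w _ => ?_
    rw [hb.apply_smul, coeffBar_q_pow, hb.map_T, mul_smul_comm, ← ofWeyl_inv, sphSum_mul_inverse_T,
      smul_smul, ofWeyl_inv, length_inv, ← pow_add, ← two_mul, pow_mul]
  have h4 := poincare_inv_ne_zero b 0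
  rw [h3, poincare_zero_eq, mul_comm, mul_smul] at h2
  have h5 := smul_right_injective _ h4 h2
  conv_rhs => rw [h5]
  rw [smul_smul, inv_pow, inv_mul_cancel₀ (pow_ne_zero _ q_ne_zero), one_smul]

lemma isDominant_neg_longest_smul {lam : weightLattice R} (h : IsDominant b lam) :
    IsDominant b (-(longest b • lam)) := by
  rw [isDominant_iff] at *
  intro i hi
  have h1 : b.IsPos (R.reflectionPerm (wIdx (longest b)⁻¹ i) (wIdx (longest b)⁻¹ i)) := by
    rw [isPos_reflectionPerm_self, isPos_longest_inv, not_not]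
    exact hi
  have h2 := h _ h1
  rw [zpair_reflectionPerm_self] at h2
  rw [zpair_neg, zpair_smul']
  exact h2

lemma translation_inv (lam : weightLattice R) :
    (translation lam)⁻¹ = translation (-lam) := by
  refine inv_eq_of_mul_eq_one_right ?_
  rw [← translation_add, add_neg_cancel, translation_zero]

lemma ht_neg_longest_smul {lam : weightLattice R} (h : IsDominant b lam) :
    ht b (-(longest b • lam)) = ht b lam := by
  rw [← sum_abs_zpair_of_isDominant (isDominant_neg_longest_smul h),
    ← sum_abs_zpair_of_isDominant h, ← sum_abs_zpair_smul b (longest b) lam]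
  exact Finset.sum_congr rfl fun i _ => by rw [zpair_neg, abs_neg]

lemma heckeX_neg_mul (lam : weightLattice R) : heckeX b (-lam) * heckeX b lam = 1 := by
  rw [← heckeX_add, neg_add_cancel, heckeX_zero]

lemma heckeX_mul_neg (lam : weightLattice R) : heckeX b lam * heckeX b (-lam) = 1 := by
  rw [← heckeX_add, add_neg_cancel, heckeX_zero]

/-- Both −w₀λ and λ are dominant, and w₀t_{−w₀λ} = t_{−λ}w₀ with lengths adding on both sides. Hence
T_{w₀} conjugates x^{−w₀λ} into T_{t_{−λ}}, whose inverse is the bar of x^λ. -/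
lemma IsBarInvolution.map_T_translation {bar : Hecke b ≃+* Hecke b} (hb : IsBarInvolution b bar)
    {lam : weightLattice R} (h : IsDominant b lam) :
    bar (heckeX b lam) * T b (ofWeyl (longest b)) =
      T b (ofWeyl (longest b)) * heckeX b (longest b • lam) := by
  have hd := isDominant_neg_longest_smul h
  have e1 : ofWeyl (longest b) * translation (-(longest b • lam)) =
      translation (-lam) * ofWeyl (longest b) := by
    rw [ofWeyl_mul_translation, smul_neg, ← mul_smul, longest_mul_self, one_smul]
  have hlen : length b (translation (-lam)) = length b (translation lam) := by
    rw [← translation_inv, length_inv]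
  have e2 : T b (translation (-lam)) * T b (ofWeyl (longest b)) =
      T b (ofWeyl (longest b)) * T b (translation (-(longest b • lam))) := by
    have h1 := length_ofWeyl_mul_translation (longest b) hd
    have h2 := length_translation hd
    have h3 := length_translation h
    have h4 := ht_neg_longest_smul h
    rw [T_mul, T_mul, e1]
    · omega
    · rw [← e1]
      omega
  rw [← heckeX_of_isDominant hd] at e2
  rw [heckeX_of_isDominant h, hb.map_T, translation_inv]
  refine (isUnit_T b (translation (-lam))).mul_left_cancel ?_
  rw [← mul_assoc, T_mul_inverse, one_mul, ← mul_assoc, e2, mul_assoc, heckeX_neg_mul, mul_one]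

lemma IsBarInvolution.map_heckeX {bar : Hecke b ≃+* Hecke b} (hb : IsBarInvolution b bar)
    (lam : weightLattice R) :
    bar (heckeX b lam) * T b (ofWeyl (longest b)) =
      T b (ofWeyl (longest b)) * heckeX b (longest b • lam) := by
  obtain ⟨⟨p, r⟩, hp, hr, rfl⟩ := exists_dominant_sub b lam
  dsimp only at *
  have h1 : bar (heckeX b (p - r)) * bar (heckeX b r) = bar (heckeX b p) := by
    rw [← map_mul, ← heckeX_add, sub_add_cancel]
  have h2 := congrArg (· * T b (ofWeyl (longest b))) h1
  rw [mul_assoc, hb.map_T_translation hr, hb.map_T_translation hp, ← mul_assoc] at h2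
  have h3 := congrArg (· * heckeX b (-(longest b • r))) h2
  rw [mul_assoc, heckeX_mul_neg, mul_one, mul_assoc, ← heckeX_add] at h3
  rw [h3, ← smul_neg, ← smul_add, ← sub_eq_add_neg]

lemma sum_coeff_mono (f : LatticeAlg R) :
    ∑ lam ∈ f.coeff.support, f.coeff lam • (mono lam : LatticeAlg R) = f := by
  conv_rhs => rw [← AddMonoidAlgebra.sum_coeff_single f]
  rw [Finsupp.sum]
  refine Finset.sum_congr rfl fun lam _ => ?_
  rw [mono, AddMonoidAlgebra.smul_single, smul_eq_mul, mul_one]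

lemma IsBarInvolution.map_latHom {bar : Hecke b ≃+* Hecke b} (hb : IsBarInvolution b bar)
    {f : LatticeAlg R} (hf : f ∈ intLattice R) :
    bar (latHom b f) * T b (ofWeyl (longest b)) =
      T b (ofWeyl (longest b)) * latHom b (weylAct (longest b) f) := by
  rw [← sum_coeff_mono f, map_sum, map_sum, map_sum, map_sum, Finset.sum_mul, Finset.mul_sum]
  refine Finset.sum_congr rfl fun lam _ => ?_
  obtain ⟨n, hn⟩ := hf lam
  rw [map_smul (latHom b), hb.apply_smul, map_smul (weylAct _), map_smul (latHom b), hn, map_intCast, latHom_mono, weylAct_mono,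
    latHom_mono, smul_mul_assoc, hb.map_heckeX, mul_smul_comm]

/-- The divided difference of a W-invariant f vanishes, so T_{s_i} commutes with f. -/
lemma T_mul_latHom_mul_sphSum {f : LatticeAlg R} (hf : ∀ w : R.weylGroup, weylAct w f = f) {i : ι}
    (hi : i ∈ b.support) :
    T b (ofWeyl (sRefl R i)) * (latHom b f * sphSum b) = q • (latHom b f * sphSum b) := by
  obtain ⟨d, hd, hd'⟩ := exists_isBernstein hi f
  rw [hf, sub_self] at hd
  have h1 : (1 - mono (-rootWeight R i) : LatticeAlg R) ≠ 0 := by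
    rw [← mono_zero]
    exact sub_ne_zero.2 fun h => rootWeight_ne_zero i (neg_eq_zero.1 (mono_injective h).symm)
  rw [(mul_eq_zero.1 hd).resolve_left h1, hf, map_zero, smul_zero, add_zero] at hd'
  rw [← mul_assoc, hd', mul_assoc, T_sRefl_mul_sphSum hi, mul_smul_comm]

/-- Write `sphSum` as q^{−N}T_{w₀}`sphSum` to replace bar(f) by f in front of it. The scalar q^{−2N}
from bar(`sphSum`) then offsets the change of q^{−N} into q^N. -/
theorem IsBarInvolution.map_charElt {bar : Hecke b ≃+* Hecke b} (hb : IsBarInvolution b bar)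
    {f : LatticeAlg R} (hf : f ∈ intLattice R) (hinv : ∀ w : R.weylGroup, weylAct w f = f) :
    bar (charElt b f) = charElt b f := by
  have hq := q_ne_zero
  have hqn := pow_ne_zero (posRoots b).card hq
  have h1 : sphSum b = q⁻¹ ^ (posRoots b).card • (T b (ofWeyl (longest b)) * sphSum b) := by
    rw [T_ofWeyl_mul_sphSum, length_longest, smul_smul, ← mul_pow, inv_mul_cancel₀ hq, one_pow,
      one_smul]
  have h2 : bar (latHom b f) * sphSum b = latHom b f * sphSum b := by
    rw [h1, mul_smul_comm, ← mul_assoc, hb.map_latHom hf, hinv, mul_assoc,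
      T_ofWeyl_mul_of_eigen fun i hi => T_mul_latHom_mul_sphSum hinv hi, length_longest,
      T_ofWeyl_mul_sphSum, length_longest, smul_smul, smul_smul, ← mul_pow, inv_mul_cancel₀ hq,
      one_pow, one_smul, one_smul]
  rw [charElt, hb.apply_smul, map_mul, hb.map_sphSum, mul_smul_comm, h2, smul_smul, map_pow,
    coeffBar_q_inv]
  congr 1
  rw [two_mul, pow_add, ← mul_assoc, ← mul_pow, mul_inv_cancel₀ hq, one_pow, one_mul]

end BarInvariance

/-! ### The longest element of a double coset of W. -/

section MaximalElement

variable {ι V N : Type*} [AddCommGroup V] [Module ℝ V] [AddCommGroup N] [Module ℝ N]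
  {R : RootPairing ι ℝ V N} [Fintype ι] [R.IsRootSystem] [R.IsCrystallographic] [R.IsReduced]
  {b : R.Base}

lemma isDominant_longest_smul {lam : weightLattice R} (h : ∀ i, b.IsPos i → zpair lam i ≤ 0) :
    IsDominant b (longest b • lam) := by
  have h1 : IsDominant b (-lam) := isDominant_iff.2 fun i hi => by
    rw [zpair_neg]
    have := h i hi
    omega
  have h2 := isDominant_neg_longest_smul h1
  rwa [smul_neg, neg_neg] at h2

/-- Compare lengths root by root: each term for t_{uλ}uv is at most |⟨uλ, α^∨⟩| + 1, and these
bounds add up to ℓ(w₀t_λ). Equality everywhere forces uv = w₀ and uλ antidominant, hence uλ = w₀λ.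
-/
theorem isLongest_weylDoubleCoset {lam : weightLattice R} (hlam : IsDominant b lam) :
    IsLongest b (weylDoubleCoset (translation lam)) (ofWeyl (longest b) * translation lam) := by
  refine ⟨⟨longest b, 1, by rw [ofWeyl_one, mul_one]⟩, ?_⟩
  rintro y ⟨u, v, rfl⟩ hne
  have e1 : ofWeyl u * translation lam * ofWeyl v =
      translation (u • lam) * ofWeyl (u * v) := by
    rw [ofWeyl_mul_translation, mul_assoc, ofWeyl_mul]
  have hn : length b (ofWeyl (longest b) * translation lam) =
      ∑ i ∈ posRoots b, ((zpair (u • lam) i).natAbs + 1) := by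
    have h1 := length_ofWeyl_mul_translation (longest b) hlam
    rw [length_longest, ← sum_abs_zpair_of_isDominant hlam, ← sum_abs_zpair_smul b u] at h1
    zify
    rw [h1, Finset.sum_add_distrib, add_comm]
    simp
  rw [e1] at hne ⊢
  classical
  have hle : ∀ i ∈ posRoots b, (zpair (u • lam) i -
      if b.IsPos (wIdx (u * v)⁻¹ i) then 0 else 1).natAbs ≤ (zpair (u • lam) i).natAbs + 1 := by
    intro i _
    split_ifs <;> omega
  rw [hn, length_translation_mul]
  refine lt_of_le_of_ne (Finset.sum_le_sum fun i hi => ?_) fun heq => hne ?_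
  · exact le_trans (le_of_eq (by congr)) (hle i hi)
  · have h1 := (Finset.sum_eq_sum_iff_of_le (fun i hi =>
      le_trans (le_of_eq (by congr)) (hle i hi))).1 heq
    have h2 : ∀ i, b.IsPos i →
        ¬ b.IsPos (wIdx (u * v)⁻¹ i) ∧ zpair (u • lam) i ≤ 0 := by
      intro i hi
      have h3 := h1 i ((mem_posRoots b i).2 hi)
      split_ifs at h3 with h
      · omega
      · exact ⟨h, by omega⟩
    have h3 := eq_longest_of_forall (v := (u * v)⁻¹) (b := b)
      fun i hi => (h2 i (b.isPos_of_mem_support hi)).1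
    have h4 : u * v = longest b := by rw [← inv_inv (u * v), h3, longest_inv]
    have h5 := isDominant_longest_smul (b := b) fun i hi => (h2 i hi).2
    rw [← mul_smul] at h5
    have h6 := smul_eq_of_isDominant hlam h5
    have h7 : u • lam = longest b • lam := by
      have h8 := congrArg (longest b • ·) h6
      rwa [← mul_smul, ← mul_assoc, longest_mul_self, one_mul] at h8
    rw [ofWeyl_mul_translation, h4, h7]

end MaximalElement

/-! ### Part (b): identification with C'_n. -/

section KazhdanLusztigBasis

variable {ι V N : Type*} [AddCommGroup V] [Module ℝ V] [AddCommGroup N] [Module ℝ N]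
  {R : RootPairing ι ℝ V N} [Fintype ι] [R.IsRootSystem] [R.IsCrystallographic] [R.IsReduced]
  (b : R.Base)

lemma smul_latticeToHecke_mul_one₀ (f : LatticeAlg R) :
    (q⁻¹ ^ length b (ofWeyl (longest b)) * poincare b 0 (q ^ 2)) •
      (latticeToHecke b f * one₀ b) = charElt b f := by
  rw [latHom_eq, one₀_eq, mul_smul_comm, smul_smul, mul_assoc,
    mul_inv_cancel₀ (poincare_ne_zero b), mul_one, length_longest, charElt]

/-- Both `charElt` and C'_n are bar invariant and equal T_n up to coefficients in q⁻¹ℤ[q⁻¹], so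
their difference vanishes. The Bruhat condition on the support is inherited from C'_n. -/
theorem isKazhdanLusztig_iff_eq_charElt {lam : weightLattice R} (hlam : IsDominant b lam)
    {f : LatticeAlg R} (hf : toFrac R f = charFrac b lam) (C : Hecke b) :
    IsKazhdanLusztig b (ofWeyl (longest b) * translation lam) C ↔ C = charElt b f := by
  obtain ⟨C', hC'⟩ := exists_isKazhdanLusztig b (ofWeyl (longest b) * translation lam)
  have hrepr := hC'.repr_mem
  obtain ⟨⟨bar, hb, hbar⟩, -⟩ := hC'
  set n := ofWeyl (longest b) * translation lam
  have h1 := charElt_sub_T_mem b hlam hf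
  have h2 := hb.map_charElt (charFrac_integral b hf) (charFrac_invariant b hf)
  have h3 : charElt b f + (-1 : Coeff) • C' = 0 := by
    refine hb.eq_zero ?_ fun y => ?_
    · rw [map_add, h2, hb.apply_smul, hbar, map_neg, map_one]
    · have h4 := h1 y
      rw [map_add, map_smul, Finsupp.add_apply, Finsupp.smul_apply, heckeBasis_repr_T] at h4
      rw [map_add, map_smul, Finsupp.add_apply, Finsupp.smul_apply]
      by_cases hy : y = n
      · rw [hy, Finsupp.single_eq_same] at h4
        rw [hy, hrepr.1]
        exact h4
      · rw [Finsupp.single_eq_of_ne hy, smul_zero, add_zero] at h4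
        rw [smul_eq_mul, neg_one_mul]
        exact add_mem h4 (neg_mem (hrepr.2 y hy))
  have h5 : charElt b f = C' := by
    have h6 := add_neg_one_smul_add (K := Coeff) (charElt b f) C'
    rw [h3, zero_add] at h6
    exact h6.symm
  rw [h5]
  exact isKazhdanLusztig_iff hb hbar hrepr C

end KazhdanLusztigBasis

end AffineHecke

end

theorem theorem2p22 {ι V N : Type*} [Fintype ι] [AddCommGroup V] [Module ℝ V]
    [AddCommGroup N] [Module ℝ N] (R : RootPairing ι ℝ V N) [R.IsRootSystem]
    [R.IsCrystallographic] [R.IsReduced] [R.IsIrreducible] (b : R.Base) :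
    (∀ mu : AffineHecke.weightLattice R,
      ∃ P : AffineHecke.LatticeAlg R,
        algebraMap (AffineHecke.LatticeAlg R) (AffineHecke.LatticeFrac R) P =
          AffineHecke.sphericalP b mu (AffineHecke.q⁻¹ ^ 2) ∧
        (AffineHecke.poincare b mu (AffineHecke.q⁻¹ ^ 2) /
            AffineHecke.poincare b 0 (AffineHecke.q⁻¹ ^ 2)) •
          (AffineHecke.latticeToHecke b P * AffineHecke.one₀ b) = AffineHecke.heckeM b mu) ∧
    (∃ w₀ : AffineHecke.ExtWeyl R,
      AffineHecke.IsLongest b (Set.range AffineHecke.ofWeyl) w₀ ∧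
      ∀ lam : AffineHecke.weightLattice R, AffineHecke.IsDominant b lam →
        ∃ (s : AffineHecke.LatticeAlg R) (n : AffineHecke.ExtWeyl R),
          algebraMap (AffineHecke.LatticeAlg R) (AffineHecke.LatticeFrac R) s =
            AffineHecke.weylCharacter b lam ∧
          AffineHecke.IsLongest b
            (AffineHecke.weylDoubleCoset (AffineHecke.translation lam)) n ∧
          ∀ C : AffineHecke.Hecke b,
            AffineHecke.IsKazhdanLusztig b n C ↔
              C = (AffineHecke.q⁻¹ ^ AffineHecke.length b w₀ *
                  AffineHecke.poincare b 0 (AffineHecke.q ^ 2)) •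
                (AffineHecke.latticeToHecke b s * AffineHecke.one₀ b)) := by
  refine ⟨AffineHecke.sphericalP_mul_one₀ b, AffineHecke.ofWeyl (AffineHecke.longest b),
    AffineHecke.isLongest_longest b, fun lam hlam => ?_⟩
  obtain ⟨f, hf⟩ := AffineHecke.exists_toFrac_eq_charFrac b hlam
  refine ⟨f, AffineHecke.ofWeyl (AffineHecke.longest b) * AffineHecke.translation lam,
    hf.trans (AffineHecke.weylCharacter_eq b lam).symm,
    AffineHecke.isLongest_weylDoubleCoset hlam, fun C => ?_⟩
  rw [AffineHecke.smul_latticeToHecke_mul_one₀]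
  exact AffineHecke.isKazhdanLusztig_iff_eq_charElt b hlam hf C
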